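/- **Theorem.** Let $G$ be a connected Lie group which is quasi-compact, i.e. its Lie algebra $\mathfrak g$ is compact (it admits an inner product for which every $\operatorname{ad}x$ is skew-symmetric). Let $H\subset G$ be a compact subgroup such that $G$ acts effectively on the smooth coset space $G/H$. In the space of all smooth Finsler metrics on $G/H$, endowed with the local $C^0$-topology (uniform convergence on compact subsets of $T(G/H)$), the set of all $G$-$\delta$-homogeneous metrics equals the closure of the set of all $G$-normal homogeneous metrics. Here the following definitions are used. - A *smooth Finsler metric* on a manifold $M$ is a continuous function $F:TM\to[0,\infty)$, smooth on $TM\setminus 0$, whose restriction to each $T_xM$ is a Minkowski norm: positive and smooth off $0$, positively homogeneous of degree one, and with positive definite Hessian of $\tfrac12F^2$ at every $y\neq0$. Its (possibly non-symmetric) distance is $d_F(x,y)=\inf_\gamma\int_0^1F(\gamma(t),\dot\gamma(t))\,dt$ over $C^1$ curves $\gamma$ from $x$ to $y$. - $F$ on $G/H$ is *$G$-homogeneous* if $F(g_*v)=F(v)$ for all $g\in G$, $v\in T(G/H)$. - $F$ is *$G$-$\delta$-homogeneous* if it is $G$-homogeneous and for all $x,y\in G/H$ there is $g\in G$ with $gx=y$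 such that the displacement function $z\mapsto d_F(z,gz)$ attains its maximum at $x$. - $F$ is *$G$-normal homogeneous* if it is $G$-homogeneous and there is a smooth bi-invariant Finsler metric $\bar F$ on $G$ such that the projection $\pi:(G,\bar F)\to(G/H,F)$ is a Finsler submersion, i.e. for every $g\in G$ the tangent map $\pi_*:T_gG\to T_{\pi(g)}(G/H)$ maps $\{w:\bar F(w)\le1\}$ onto $\{u:F(u)\le1\}$. -/

import Mathlib

open Bundle Set Topology MeasureTheory
open scoped Manifold ContDiff ENNReal

noncomputable section

/-! ### Minkowski norms -/

/-- The fundamental tensor `g_y(u, v) = ½ ∂²/∂s∂t F²(y + t u + s v)` at `s = t = 0`, i.e. the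
Hessian of `½ F²` at `y`, in the directions `u` and `v`. -/
def fundamentalTensor {V : Type*} [NormedAddCommGroup V] [NormedSpace ℝ V]
    (F : V → ℝ) (y u v : V) : ℝ :=
  iteratedFDeriv ℝ 2 (fun z => F z ^ 2 / 2) y ![u, v]

/-- (Smooth) Minkowski norms on a finite-dimensional real vector space. -/
structure IsMinkowskiNorm {V : Type*} [NormedAddCommGroup V] [NormedSpace ℝ V]
    (F : V → ℝ) : Prop where
  continuous : Continuous F
  pos : ∀ y, y ≠ 0 → 0 < F y
  smooth : ContDiffOn ℝ ∞ F {y | y ≠ 0}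
  homogeneous : ∀ (c : ℝ) (y : V), 0 ≤ c → F (c • y) = c * F y
  strongly_convex : ∀ y u, y ≠ 0 → u ≠ 0 → 0 < fundamentalTensor F y u u

/-- A linear map `p : (V₁, F₁) → (V₂, F₂)` is a Finsler submersion if it maps the closed unit ball
of `F₁` onto the closed unit ball of `F₂`. -/
def IsLinearFinslerSubmersion {V₁ V₂ : Type*} [AddCommGroup V₁] [Module ℝ V₁]
    [AddCommGroup V₂] [Module ℝ V₂] (F₁ : V₁ → ℝ) (F₂ : V₂ → ℝ) (p : V₁ →ₗ[ℝ] V₂) : Prop :=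
  p '' {w | F₁ w ≤ 1} = {u | F₂ u ≤ 1}

/-! ### Finsler metrics -/

section Finsler

variable (E : Type*) [NormedAddCommGroup E] [NormedSpace ℝ E]
  (M : Type*) [TopologicalSpace M] [ChartedSpace E M] [IsManifold 𝓘(ℝ, E) ∞ M]

/-- A smooth Finsler metric on a manifold `M` modelled on `E`: a continuous function on `TM`, smooth
on the slit tangent bundle, whose restriction to every tangent space is a Minkowski norm. (The
tangent space at `x` is, as a vector space, the model space `E`.) -/
structure FinslerMetric where
  toFun : TangentBundle 𝓘(ℝ, E) M → ℝ
  continuous_toFun : Continuous toFun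
  smooth_slit : ContMDiffOn 𝓘(ℝ, E).tangent 𝓘(ℝ, ℝ) ∞ toFun {v | v.2 ≠ 0}
  minkowski : ∀ x : M, IsMinkowskiNorm (V := E) (fun v => toFun ⟨x, v⟩)

variable {E M}

namespace FinslerMetric

instance : CoeFun (FinslerMetric E M) (fun _ => TangentBundle 𝓘(ℝ, E) M → ℝ) := ⟨toFun⟩

/-- A Finsler metric as an element of `C(TM, ℝ)`. -/
def toContinuousMap (F : FinslerMetric E M) : C(TangentBundle 𝓘(ℝ, E) M, ℝ) :=
  ⟨F.toFun, F.continuous_toFun⟩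

/-- The local `C⁰` topology on the space of Finsler metrics: the topology induced by the
compact-open topology of `C(TM, ℝ)`, i.e. that of uniform convergence on compact subsets of `TM`
(see `tendsto_iff`). -/
instance : TopologicalSpace (FinslerMetric E M) :=
  TopologicalSpace.induced toContinuousMap inferInstance

theorem tendsto_iff {ι : Type*} {l : Filter ι} {Fs : ι → FinslerMetric E M}
    {F : FinslerMetric E M} :
    Filter.Tendsto Fs l (𝓝 F) ↔
      ∀ K : Set (TangentBundle 𝓘(ℝ, E) M), IsCompact K →
        TendstoUniformlyOn (fun i => (Fs i).toFun) F.toFun l K := by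
  rw [nhds_induced, Filter.tendsto_comap_iff,
    ContinuousMap.tendsto_iff_forall_isCompact_tendstoUniformlyOn]
  rfl

/-- The length `∫₀¹ F(γ(t), γ'(t)) dt` of a curve `γ : [0, 1] → M`. -/
def curveLength (F : FinslerMetric E M) (γ : ℝ → M) : ℝ≥0∞ :=
  ∫⁻ t in Icc (0 : ℝ) 1,
    ENNReal.ofReal (F ⟨γ t, mfderivWithin 𝓘(ℝ, ℝ) 𝓘(ℝ, E) γ (Icc 0 1) t (1 : ℝ)⟩)

/-- The (not necessarily symmetric) distance `d_F(x, y)`: the infimum of the lengths of the `C¹`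
curves from `x` to `y`. It is finite if `M` is connected. -/
def edist (F : FinslerMetric E M) (x y : M) : ℝ≥0∞ :=
  ⨅ (γ : ℝ → M) (_ : ContMDiffOn 𝓘(ℝ, ℝ) 𝓘(ℝ, E) 1 γ (Icc 0 1) ∧ γ 0 = x ∧ γ 1 = y),
    F.curveLength γ

/-- `F` is invariant under the (smooth) map `f`. -/
def InvariantUnder (F : FinslerMetric E M) (f : M → M) : Prop :=
  ∀ v : TangentBundle 𝓘(ℝ, E) M, F (tangentMap 𝓘(ℝ, E) 𝓘(ℝ, E) f v) = F v

end FinslerMetric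

/-- A map between Finsler manifolds is a Finsler submersion if it is smooth and all its tangent maps
`T_x M → T_{p x} N` are Finsler submersions of Minkowski spaces. -/
def IsFinslerSubmersion {E' : Type*} [NormedAddCommGroup E'] [NormedSpace ℝ E']
    {N : Type*} [TopologicalSpace N] [ChartedSpace E' N] [IsManifold 𝓘(ℝ, E') ∞ N]
    (F₁ : FinslerMetric E M) (F₂ : FinslerMetric E' N) (p : M → N) : Prop :=
  ContMDiff 𝓘(ℝ, E) 𝓘(ℝ, E') ∞ p ∧
    ∀ x : M, IsLinearFinslerSubmersion
      (fun v : TangentSpace 𝓘(ℝ, E) x => F₁ ⟨x, v⟩)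
      (fun v : TangentSpace 𝓘(ℝ, E') (p x) => F₂ ⟨p x, v⟩)
      (mfderiv 𝓘(ℝ, E) 𝓘(ℝ, E') p x : TangentSpace 𝓘(ℝ, E) x →ₗ[ℝ] TangentSpace 𝓘(ℝ, E') (p x))

end Finsler

/-! ### Quasi-compact Lie groups -/

/-- A Lie group is quasi-compact if its Lie algebra `𝔤` is a compact Lie algebra, i.e. admits a
(positive definite) inner product for which all the maps `ad x` are skew-symmetric. -/
def IsQuasiCompact (E : Type*) [NormedAddCommGroup E] [NormedSpace ℝ E]
    (G : Type*) [TopologicalSpace G] [ChartedSpace E G] [Group G] : Prop :=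
  ∃ B : LinearMap.BilinForm ℝ (GroupLieAlgebra 𝓘(ℝ, E) G),
    (∀ x y, B x y = B y x) ∧ (∀ x, x ≠ 0 → 0 < B x x) ∧
      ∀ x y z : GroupLieAlgebra 𝓘(ℝ, E) G, B ⁅x, y⁆ z + B y ⁅x, z⁆ = 0

/-! ### Homogeneous Finsler metrics on `G ⧸ H` -/

section Homogeneous

variable {E : Type*} [NormedAddCommGroup E] [NormedSpace ℝ E]
  {G : Type*} [TopologicalSpace G] [ChartedSpace E G] [Group G]
  {E' : Type*} [NormedAddCommGroup E'] [NormedSpace ℝ E']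
  {H : Subgroup G} [ChartedSpace E' (G ⧸ H)] [IsManifold 𝓘(ℝ, E') ∞ (G ⧸ H)]

namespace FinslerMetric

/-- `G`-homogeneous Finsler metrics on `G ⧸ H`: those for which `G` acts by isometries. -/
def IsHomogeneous (F : FinslerMetric E' (G ⧸ H)) : Prop :=
  ∀ g : G, F.InvariantUnder (fun x : G ⧸ H => g • x)

/-- `G`-`δ`-homogeneous Finsler metrics on `G ⧸ H`. -/
def IsDeltaHomogeneous (F : FinslerMetric E' (G ⧸ H)) : Prop :=
  F.IsHomogeneous ∧
    ∀ x y : G ⧸ H, ∃ g : G, g • x = y ∧ ∀ z : G ⧸ H, F.edist z (g • z) ≤ F.edist x (g • x)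

/-- Bi-invariant Finsler metrics on the Lie group `G`. -/
def IsBiinvariant [IsManifold 𝓘(ℝ, E) ∞ G] (F : FinslerMetric E G) : Prop :=
  (∀ g : G, F.InvariantUnder (fun x => g * x)) ∧ (∀ g : G, F.InvariantUnder (fun x => x * g))

variable (E) in
/-- `G`-normal homogeneous Finsler metrics on `G ⧸ H`: the `G`-homogeneous ones that are induced by
a bi-invariant (smooth) Finsler metric on `G` for which the projection is a Finsler submersion. -/
def IsNormalHomogeneous [IsManifold 𝓘(ℝ, E) ∞ G] (F : FinslerMetric E' (G ⧸ H)) : Prop :=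
  F.IsHomogeneous ∧
    ∃ Fbar : FinslerMetric E G, Fbar.IsBiinvariant ∧
      IsFinslerSubmersion Fbar F (QuotientGroup.mk : G → G ⧸ H)

end FinslerMetric

end Homogeneous

end

/-! Let N be the norm of F at the base point o = H and let π_* be the differential of the projection
at the identity (`cosetDeriv`). For homogeneous F, the fundamental vector field of a Lie algebra
element w has length N(π_* Ad(k⁻¹) w) at kH. Both sides of the equality turn out to consist of the
homogeneous F satisfying one infinitesimal condition, `HasAlmostMaximalLifts`: for each δ > 0, every
v tangent at o has a lift w with N(π_* Ad(k) w) ≤ (1 + δ) N(v) for all k.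

δ-homogeneity implies the condition (`IsDeltaHomogeneous.hasAlmostMaximalLifts`). Move o by g(s) to
the point at parameter s on a line with velocity v, with displacement maximal at o. All
displacements tend to 0 with s, so compactness of H and effectiveness force g(s) → 1 along an
ultrafilter. The rescaled chart coordinates of g(s) converge to a Lie algebra element, and comparing
displacements to first order shows that a multiple of it is the required lift.

The condition implies δ-homogeneity (`IsHomogeneous.isDeltaHomogeneous`). An almost shortest curve
from x to y is lifted to G in small pieces whose velocities are almost maximal lifts. The product of
the resulting group elements moves x to y and moves no point by more than d(x, y) + ε. The elements
carrying x to y form a compact set, so ε can go to 0.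

Normal homogeneous metrics satisfy the condition without error: a lift of v that is optimal for the
bi-invariant norm stays in the same ball under Ad, and balls project to balls. Since the condition
has a multiplicative slack, it passes to local C⁰ limits, which settles one inclusion.

For the other inclusion, P(w) = sup over k of N(π_* Ad(k) w) is an Ad-invariant norm on the Lie
algebra: finite because Ad(G) is bounded, definite because the action is effective. The condition
says that N is the quotient norm of P. P is in general not smooth, so P² is averaged over
endomorphisms near the identity with a density invariant under orthogonal conjugation, and a small
multiple of the Euclidean square is added (`IsAsymmetricNorm.exists_smooth_approx`). The result is
Ad-invariant, smooth off 0 and strongly convex, and these regularity properties pass to quotients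
(`IsStrongEnergy.exists_pushforward`). It yields a normal homogeneous metric close to F
(`IsHomogeneous.exists_isNormalHomogeneous`).

Quasi-compactness enters through an Ad-invariant Euclidean structure. It is obtained from the
skew-symmetry of ad by identifying the differential of Ad with the bracket (`tderiv_adjointAction`).
-/

section Minkowski

/-! ### Minkowski norms and strong convexity -/

variable {V : Type*} [NormedAddCommGroup V] [NormedSpace ℝ V]

theorem two_le_infty : (2 : ℕ∞ω) ≤ ((⊤ : ℕ∞) : ℕ∞ω) :=
  WithTop.coe_le_coe.2 (le_top : (2 : ℕ∞) ≤ ⊤)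

theorem hasDerivAt_comp_line {h : V → ℝ} {x u : V} {t : ℝ} (hh : DifferentiableAt ℝ h (x + t • u)) :
    HasDerivAt (fun s : ℝ => h (x + s • u)) (fderiv ℝ h (x + t • u) u) t := by
  have h1 : HasDerivAt (fun s : ℝ => x + s • u) u t := by
    simpa using ((hasDerivAt_id t).smul_const u).const_add x
  exact hh.hasFDerivAt.comp_hasDerivAt t h1

theorem hasDerivAt_fderiv_comp_line {h : V → ℝ} {x u : V} {t : ℝ}
    (hh : ContDiffAt ℝ 2 h (x + t • u)) :
    HasDerivAt (fun s : ℝ => fderiv ℝ h (x + s • u) u)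
      (iteratedFDeriv ℝ 2 h (x + t • u) ![u, u]) t := by
  have h2 : DifferentiableAt ℝ (fderiv ℝ h) (x + t • u) :=
    (hh.fderiv_right (m := 1) (by norm_num)).differentiableAt (by norm_num)
  have h3 : HasFDerivAt (fun z => fderiv ℝ h z u)
      ((ContinuousLinearMap.apply ℝ ℝ u).comp (fderiv ℝ (fderiv ℝ h) (x + t • u))) (x + t • u) :=
    (ContinuousLinearMap.apply ℝ ℝ u).hasFDerivAt.comp _ h2.hasFDerivAt
  have h4 := hasDerivAt_comp_line h3.differentiableAt
  rw [h3.fderiv] at h4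
  exact h4.congr_deriv (iteratedFDeriv_two_apply h (x + t • u) ![u, u]).symm

/-- The second derivative of a strongly convex function is bounded below. -/
theorem StrongConvexOn.le_iteratedFDeriv_two {m : ℝ} {h : V → ℝ} (hm : StrongConvexOn univ m h)
    {y : V} (hy : ContDiffAt ℝ 2 h y) (u : V) :
    m * ‖u‖ ^ 2 ≤ iteratedFDeriv ℝ 2 h y ![u, u] := by
  have hsc : StrongConvexOn univ (m * ‖u‖ ^ 2) (fun t : ℝ => h (y + t • u)) := by
    refine ⟨convex_univ, fun s _ t _ a b ha hb hab => ?_⟩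
    have := hm.2 (mem_univ (y + s • u)) (mem_univ (y + t • u)) ha hb hab
    have e1 : a • (y + s • u) + b • (y + t • u) = y + (a • s + b • t) • u := by
      have : y = (a + b) • y := by simp [hab]
      conv_rhs => rw [this]
      simp only [smul_eq_mul]
      module
    have e2 : (y + s • u) - (y + t • u) = (s - t) • u := by module
    rw [e1, e2] at this
    simp only [smul_eq_mul, norm_smul, mul_pow] at this ⊢
    convert this using 2
    ring
  have hconv := strongConvexOn_iff_convex.1 hsc
  have hev : ∀ᶠ t : ℝ in 𝓝 0, ContDiffAt ℝ 2 h (y + t • u) := by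
    have hc : ContinuousAt (fun t : ℝ => y + t • u) 0 := by fun_prop
    have := hy.eventually (by simp)
    apply hc.eventually
    simpa using this
  obtain ⟨δ, hδ, hball⟩ := Metric.eventually_nhds_iff_ball.1 hev
  -- Removing the quadratic term leaves a convex function of t, so its derivative is monotone near 0
  -- and its second derivative at 0 is nonnegative.
  set ψ : ℝ → ℝ := fun t => h (y + t • u) - m * ‖u‖ ^ 2 / 2 * ‖t‖ ^ 2 with hψ
  have hd : ∀ t ∈ Metric.ball (0 : ℝ) δ, HasDerivAt ψ
      (fderiv ℝ h (y + t • u) u - m * ‖u‖ ^ 2 * t) t := by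
    intro t ht
    have h1 := hasDerivAt_comp_line ((hball t ht).differentiableAt (by norm_num))
    have h2 : HasDerivAt (fun t : ℝ => m * ‖u‖ ^ 2 / 2 * ‖t‖ ^ 2) (m * ‖u‖ ^ 2 * t) t := by
      have := ((hasDerivAt_id t).pow 2).const_mul (m * ‖u‖ ^ 2 / 2)
      simp only [Real.norm_eq_abs, sq_abs]
      refine this.congr_deriv ?_
      simp; ring
    exact h1.sub h2
  have hmono : MonotoneOn (deriv ψ) (Metric.ball 0 δ) :=
    (hconv.subset (subset_univ _) (convex_ball _ _)).monotoneOn_deriv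
      fun t ht => (hd t ht).differentiableAt
  have h0 : (0 : ℝ) ∈ Metric.ball (0 : ℝ) δ := Metric.mem_ball_self hδ
  have hnn := hmono.derivWithin_nonneg (x := 0)
  rw [derivWithin_of_isOpen Metric.isOpen_ball h0] at hnn
  have heq : deriv ψ =ᶠ[𝓝 0] fun t => fderiv ℝ h (y + t • u) u - m * ‖u‖ ^ 2 * t := by
    filter_upwards [Metric.ball_mem_nhds (0 : ℝ) hδ] with t ht using (hd t ht).deriv
  have hd2 : HasDerivAt (fun t : ℝ => fderiv ℝ h (y + t • u) u - m * ‖u‖ ^ 2 * t)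
      (iteratedFDeriv ℝ 2 h y ![u, u] - m * ‖u‖ ^ 2) 0 := by
    have h1 := hasDerivAt_fderiv_comp_line (h := h) (x := y) (u := u) (t := 0) (by simpa using hy)
    have h2 := (hasDerivAt_id (0 : ℝ)).const_mul (m * ‖u‖ ^ 2)
    refine (h1.sub h2).congr_deriv ?_
    simp
  rw [heq.deriv_eq, hd2.deriv] at hnn
  linarith

namespace IsMinkowskiNorm

variable {F : V → ℝ}

theorem map_zero (hF : IsMinkowskiNorm F) : F 0 = 0 := by
  simpa using hF.homogeneous 0 0 le_rfl

theorem nonneg (hF : IsMinkowskiNorm F) (y : V) : 0 ≤ F y := by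
  rcases eq_or_ne y 0 with rfl | h
  · exact hF.map_zero.ge
  · exact (hF.pos y h).le

theorem eq_zero_of_le (hF : IsMinkowskiNorm F) {y : V} (h : F y ≤ 0) : y = 0 := by
  by_contra hy
  exact absurd (hF.pos y hy) (not_lt.2 h)

theorem contDiffAt (hF : IsMinkowskiNorm F) {y : V} (hy : y ≠ 0) : ContDiffAt ℝ ∞ F y :=
  hF.smooth.contDiffAt (isOpen_ne.mem_nhds hy)

/-- On a line that avoids the origin the square of a Minkowski norm is convex. -/
theorem convexOn_sq_line (hF : IsMinkowskiNorm F) {x u : V} (hx : ∀ t : ℝ, x + t • u ≠ 0) :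
    ConvexOn ℝ univ (fun t : ℝ => F (x + t • u) ^ 2 / 2) := by
  set h : V → ℝ := fun z => F z ^ 2 / 2
  have hh : ∀ t : ℝ, ContDiffAt ℝ 2 h (x + t • u) := fun t =>
    (((hF.contDiffAt (hx t)).pow 2).div_const 2).of_le two_le_infty
  have h1 : ∀ t : ℝ, HasDerivAt (fun s : ℝ => h (x + s • u)) (fderiv ℝ h (x + t • u) u) t :=
    fun t => hasDerivAt_comp_line ((hh t).differentiableAt (by norm_num))
  have h2 : ∀ t : ℝ, HasDerivAt (fun s : ℝ => fderiv ℝ h (x + s • u) u)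
      (iteratedFDeriv ℝ 2 h (x + t • u) ![u, u]) t := fun t => hasDerivAt_fderiv_comp_line (hh t)
  have e1 : deriv (fun s : ℝ => h (x + s • u)) = fun t => fderiv ℝ h (x + t • u) u :=
    funext fun t => (h1 t).deriv
  apply convexOn_univ_of_deriv2_nonneg
  · exact fun t => (h1 t).differentiableAt
  · rw [e1]
    exact fun t => (h2 t).differentiableAt
  · intro t
    rw [Function.iterate_succ, Function.iterate_one, Function.comp_apply, e1, (h2 t).deriv]
    rcases eq_or_ne u 0 with rfl | hu
    · exact ((iteratedFDeriv ℝ 2 h (x + t • (0 : V))).map_coord_zero 0 rfl).ge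
    · exact (hF.strongly_convex _ _ (hx t) hu).le

/-- Proportional vectors are handled by homogeneity. Otherwise the line through x / F x and y / F y
avoids the origin, so F² is convex on it. The point (x + y) / (F x + F y) lies between these two
unit vectors and hence in the unit ball. -/
theorem add_le (hF : IsMinkowskiNorm F) (x y : V) : F (x + y) ≤ F x + F y := by
  rcases eq_or_ne x 0 with rfl | hx
  · simp [hF.map_zero]
  rcases eq_or_ne y 0 with rfl | hy
  · simp [hF.map_zero]
  have ha := hF.pos x hx
  have hb := hF.pos y hy
  by_cases hdep : ∃ c : ℝ, y = c • x
  · obtain ⟨c, rfl⟩ := hdep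
    have e : x + c • x = (1 + c) • x := by module
    have en : ∀ d : ℝ, d ≤ 0 → F (d • x) = -d * F (-x) := fun d hd => by
      rw [← hF.homogeneous _ _ (by linarith)]; congr 1; module
    have hn := hF.nonneg (-x)
    rw [e]
    rcases le_total 0 c with hc | hc
    · rw [hF.homogeneous _ _ (by linarith), hF.homogeneous _ _ hc]; linarith
    · rw [en c hc]
      rcases le_total 0 (1 + c) with h1 | h1
      · rw [hF.homogeneous _ _ h1]; nlinarith
      · rw [en _ h1]; nlinarith
  · have hline : ∀ t : ℝ, (F x)⁻¹ • x + t • ((F y)⁻¹ • y - (F x)⁻¹ • x) ≠ 0 := by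
      intro t ht
      have ht' : ((1 - t) * (F x)⁻¹) • x + (t * (F y)⁻¹) • y = 0 := by
        rw [← ht]; module
      by_cases h0 : t = 0
      · subst h0
        simp [ha.ne', hx] at ht'
      · refine hdep ⟨-((t * (F y)⁻¹)⁻¹ * ((1 - t) * (F x)⁻¹)), ?_⟩
        have hne : t * (F y)⁻¹ ≠ 0 := by positivity
        have : (t * (F y)⁻¹) • y = -(((1 - t) * (F x)⁻¹) • x) := by
          rw [eq_neg_iff_add_eq_zero, add_comm]; exact ht'
        rw [neg_smul, mul_smul, ← smul_neg, ← this, smul_smul, inv_mul_cancel₀ hne, one_smul]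
    have hc := hF.convexOn_sq_line hline
    have hab : 0 < F x + F y := by positivity
    have := hc.2 (mem_univ 0) (mem_univ 1) (show 0 ≤ F x / (F x + F y) by positivity)
      (show 0 ≤ F y / (F x + F y) by positivity) (by field_simp)
    have e0 : F ((F x)⁻¹ • x) = 1 := by
      rw [hF.homogeneous _ _ (by positivity)]; field_simp
    have e1 : F ((F y)⁻¹ • y) = 1 := by
      rw [hF.homogeneous _ _ (by positivity)]; field_simp
    have e2 : (F x)⁻¹ • x + (F x / (F x + F y) * 0 + F y / (F x + F y) * 1) •
        ((F y)⁻¹ • y - (F x)⁻¹ • x) = (F x + F y)⁻¹ • (x + y) := by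
      match_scalars <;> field_simp <;> ring
    simp only [smul_eq_mul] at this
    rw [e2] at this
    simp only [zero_smul, add_zero, one_smul, add_sub_cancel, e0, e1] at this
    rw [hF.homogeneous _ _ (by positivity)] at this
    have h3 : ((F x + F y)⁻¹ * F (x + y)) ^ 2 ≤ 1 := by
      have : F x / (F x + F y) + F y / (F x + F y) = 1 := by field_simp
      nlinarith
    have h4 : (F x + F y)⁻¹ * F (x + y) ≤ 1 := by
      nlinarith [sq_nonneg ((F x + F y)⁻¹ * F (x + y) - 1)]
    rwa [inv_mul_le_iff₀ hab, mul_one] at h4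

theorem comp_equiv {W : Type*} [NormedAddCommGroup W] [NormedSpace ℝ W]
    (hF : IsMinkowskiNorm F) (e : W ≃L[ℝ] V) : IsMinkowskiNorm (fun w => F (e w)) where
  continuous := hF.continuous.comp e.continuous
  pos y hy := hF.pos _ (by simpa using hy)
  smooth := hF.smooth.comp e.contDiff.contDiffOn fun y hy => by simpa using hy
  homogeneous c y hc := by rw [map_smul, hF.homogeneous _ _ hc]
  strongly_convex y u hy hu := by
    have h := hF.strongly_convex (e y) (e u) (by simpa using hy) (by simpa using hu)
    unfold fundamentalTensor at h ⊢
    have := e.iteratedFDerivWithin_comp_right (fun z => F z ^ 2 / 2) uniqueDiffOn_univ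
      (x := y) (mem_univ _) 2
    rw [preimage_univ, iteratedFDerivWithin_univ, iteratedFDerivWithin_univ] at this
    change 0 < iteratedFDeriv ℝ 2 ((fun z => F z ^ 2 / 2) ∘ e) y ![u, u]
    rw [this]
    rw [show (![e u, e u] : Fin 2 → V) = fun i => e ((![u, u] : Fin 2 → W) i) by
      ext i; fin_cases i <;> rfl] at h
    exact h

end IsMinkowskiNorm

/-- The square root of a strongly convex, slit-smooth, `2`-homogeneous function is a
Minkowski norm. -/
theorem isMinkowskiNorm_sqrt {Q : V → ℝ} {m : ℝ} (hm : 0 < m) (hc : Continuous Q)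
    (hpos : ∀ y, y ≠ 0 → 0 < Q y) (hhom : ∀ (c : ℝ) (y : V), 0 ≤ c → Q (c • y) = c ^ 2 * Q y)
    (hs : ∀ y, y ≠ 0 → ContDiffAt ℝ ∞ Q y) (hconv : StrongConvexOn univ m Q) :
    IsMinkowskiNorm (fun y => √(Q y)) where
  continuous := by fun_prop
  pos y hy := Real.sqrt_pos.2 (hpos y hy)
  smooth y hy := ((hs y hy).sqrt (hpos y hy).ne').contDiffWithinAt
  homogeneous c y h := by
    rw [hhom c y h, Real.sqrt_mul (sq_nonneg c), Real.sqrt_sq h]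
  strongly_convex y u hy hu := by
    have hQ0 : ∀ z, 0 ≤ Q z := fun z => by
      rcases eq_or_ne z 0 with rfl | h
      · have := hhom 0 0 le_rfl
        simp at this
        exact this.ge
      · exact (hpos z h).le
    have e : (fun z => √(Q z) ^ 2 / 2) = fun z => Q z / 2 := by
      ext z; rw [Real.sq_sqrt (hQ0 z)]
    unfold fundamentalTensor
    rw [e]
    have h2 : StrongConvexOn univ (m / 2) (fun z => Q z / 2) := by
      refine ⟨convex_univ, fun x hx y hy a b ha hb hab => ?_⟩
      have := hconv.2 hx hy ha hb hab
      simp only [smul_eq_mul] at this ⊢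
      linarith
    have := h2.le_iteratedFDeriv_two (y := y)
      (((hs y hy).div_const 2).of_le two_le_infty) u
    have : 0 < m / 2 * ‖u‖ ^ 2 := by positivity
    linarith

end Minkowski

/-! ### Smoothing a norm without losing its isometries -/

section Smoothing

/-- Only the independence of c from g matters: c is later eliminated by testing on a function whose
integral is known. -/
theorem exists_integral_comp_equiv {W : Type*} [NormedAddCommGroup W] [NormedSpace ℝ W]
    [FiniteDimensional ℝ W] [MeasurableSpace W] [BorelSpace W] (μ : Measure W)
    [μ.IsAddHaarMeasure] (Φ : W ≃ₗ[ℝ] W) :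
    ∃ c : ℝ, ∀ g : W → ℝ, ∫ A, g (Φ A) ∂μ = c * ∫ A, g A ∂μ := by
  refine ⟨(ENNReal.ofReal |(LinearMap.det (Φ : W →ₗ[ℝ] W))⁻¹|).toReal, fun g => ?_⟩
  have h1 := Measure.map_linearMap_addHaar_eq_smul_addHaar μ
    (f := (Φ : W →ₗ[ℝ] W)) (LinearEquiv.isUnit_det' Φ).ne_zero
  have h2 : ∫ A, g (Φ A) ∂μ = ∫ A, g A ∂(Measure.map Φ μ) :=
    (Φ.toContinuousLinearEquiv.toHomeomorph.measurableEmbedding.integral_map g).symm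
  rw [h2, show (Φ : W → W) = ((Φ : W →ₗ[ℝ] W) : W → W) from rfl, h1, integral_smul_measure]
  rfl

variable {V : Type*} [NormedAddCommGroup V] [InnerProductSpace ℝ V] [FiniteDimensional ℝ V]

/-- This is the basis independence of the Hilbert–Schmidt norm: expanding both sums by Parseval
gives the same sum for the adjoint. -/
theorem sum_sq_norm_eq_of_orthonormalBasis {ι : Type*} [Fintype ι] (b c : OrthonormalBasis ι ℝ V)
    (Z : V →L[ℝ] V) : ∑ i, ‖Z (c i)‖ ^ 2 = ∑ i, ‖Z (b i)‖ ^ 2 := by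
  have key : ∀ d : OrthonormalBasis ι ℝ V,
      ∑ i, ‖Z (d i)‖ ^ 2 = ∑ j, ‖ContinuousLinearMap.adjoint Z (b j)‖ ^ 2 := by
    intro d
    simp_rw [← b.sum_sq_norm_inner_right (Z _), ← d.sum_sq_norm_inner_left
      (ContinuousLinearMap.adjoint Z _), ContinuousLinearMap.adjoint_inner_left]
    exact Finset.sum_comm
  rw [key b, key c]

omit [FiniteDimensional ℝ V] in
theorem sq_norm_le_sum_sq_norm {ι : Type*} [Fintype ι] (b : OrthonormalBasis ι ℝ V)
    (Z : V →L[ℝ] V) : ‖Z‖ ^ 2 ≤ ∑ i, ‖Z (b i)‖ ^ 2 := by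
  have h0 : 0 ≤ ∑ i, ‖Z (b i)‖ ^ 2 := Finset.sum_nonneg fun i _ => sq_nonneg _
  refine Real.le_sqrt (norm_nonneg _) h0 |>.1 ?_
  refine ContinuousLinearMap.opNorm_le_bound _ (Real.sqrt_nonneg _) fun y => ?_
  have h1 : Z y = ∑ i, inner ℝ (b i) y • Z (b i) := by
    conv_lhs => rw [← b.sum_repr' y]
    simp
  have h2 : ‖Z y‖ ≤ ∑ i, ‖Z (b i)‖ * ‖inner ℝ (b i) y‖ := by
    rw [h1]
    refine (norm_sum_le _ _).trans (Finset.sum_le_sum fun i _ => ?_)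
    rw [norm_smul, mul_comm]
  refine h2.trans ((Real.sum_mul_le_sqrt_mul_sqrt _ _ _).trans ?_)
  rw [b.sum_sq_norm_inner_right, Real.sqrt_sq (norm_nonneg _)]

/-- A mollifier on the space of endomorphisms, invariant under conjugation by isometries. -/
theorem exists_conj_invariant_mollifier (V : Type*) [NormedAddCommGroup V] [InnerProductSpace ℝ V]
    [FiniteDimensional ℝ V] (μ : Measure (V →L[ℝ] V)) [μ.IsAddHaarMeasure]
    {r : ℝ} (hr : 0 < r) :
    ∃ ρ : (V →L[ℝ] V) → ℝ, ContDiff ℝ ∞ ρ ∧ (∀ A, 0 ≤ ρ A) ∧ (∀ A, ρ A ≠ 0 → ‖A - 1‖ ≤ r) ∧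
      ∫ A, ρ A ∂μ = 1 ∧
      ∀ (T : V ≃ₗᵢ[ℝ] V) (A B : V →L[ℝ] V), (∀ y, T (B y) = A (T y)) → ρ B = ρ A := by
  set b := stdOrthonormalBasis ℝ V
  -- The squared Hilbert–Schmidt norm is smooth, unlike that of the operator norm in general. It
  -- dominates the squared operator norm and is invariant under orthogonal conjugation.
  set q : (V →L[ℝ] V) → ℝ := fun Z => ∑ i, ‖Z (b i)‖ ^ 2 with hq
  have hqs : ContDiff ℝ ∞ q := by
    apply ContDiff.sum
    intro i _
    exact (ContinuousLinearMap.apply ℝ V (b i)).contDiff.norm_sq ℝ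
  set ρ₀ : (V →L[ℝ] V) → ℝ := fun A => Real.smoothTransition (1 - q (A - 1) / r ^ 2) with hρ₀
  have hs : ContDiff ℝ ∞ ρ₀ :=
    Real.smoothTransition.contDiff.comp
      (contDiff_const.sub ((hqs.comp (contDiff_id.sub contDiff_const)).div_const _))
  have hsupp : ∀ A, ρ₀ A ≠ 0 → ‖A - 1‖ ≤ r := by
    intro A hA
    by_contra hlt
    push Not at hlt
    apply hA
    apply Real.smoothTransition.zero_of_nonpos
    have h1 := sq_norm_le_sum_sq_norm b (A - 1)
    have h2 : r ^ 2 ≤ q (A - 1) := le_trans (by gcongr) h1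
    rw [sub_nonpos, one_le_div (by positivity)]
    exact h2
  have hnn : ∀ A, 0 ≤ ρ₀ A := fun A => Real.smoothTransition.nonneg _
  have h1 : ρ₀ 1 ≠ 0 := by
    simp [hρ₀, hq]
  have hcs : HasCompactSupport ρ₀ := by
    apply HasCompactSupport.intro (isCompact_closedBall (1 : V →L[ℝ] V) r)
    intro A hA
    by_contra h
    exact hA (by simpa [dist_eq_norm] using hsupp A h)
  have hpos : 0 < ∫ A, ρ₀ A ∂μ :=
    hs.continuous.integral_pos_of_hasCompactSupport_nonneg_nonzero hcs hnn h1
  refine ⟨fun A => ρ₀ A / ∫ A, ρ₀ A ∂μ, hs.div_const _, fun A => div_nonneg (hnn A) hpos.le,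
    fun A hA => hsupp A fun h => hA (by simp [h]), ?_, ?_⟩
  · rw [integral_div, div_self hpos.ne']
  · intro T A B hAB
    have : q (B - 1) = q (A - 1) := by
      have h2 : ∀ y, ‖(B - 1) y‖ = ‖(A - 1) (T y)‖ := fun y => by
        rw [← T.norm_map]; simp [hAB]
      simp only [hq, h2]
      exact sum_sq_norm_eq_of_orthonormalBasis b (b.map T) (A - 1)
    simp only [hρ₀, this]

/-- A (not necessarily symmetric) norm on a vector space. -/
structure IsAsymmetricNorm {V : Type*} [NormedAddCommGroup V] [NormedSpace ℝ V]
    (p : V → ℝ) : Prop where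
  continuous : Continuous p
  pos : ∀ y, y ≠ 0 → 0 < p y
  homogeneous : ∀ (c : ℝ) (y : V), 0 ≤ c → p (c • y) = c * p y
  add_le : ∀ x y, p (x + y) ≤ p x + p y

namespace IsAsymmetricNorm

variable {W : Type*} [NormedAddCommGroup W] [NormedSpace ℝ W] {p : W → ℝ}

theorem map_zero (hp : IsAsymmetricNorm p) : p 0 = 0 := by
  simpa using hp.homogeneous 0 0 le_rfl

theorem nonneg (hp : IsAsymmetricNorm p) (y : W) : 0 ≤ p y := by
  rcases eq_or_ne y 0 with rfl | h
  · exact hp.map_zero.ge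
  · exact (hp.pos y h).le

theorem exists_bounds [FiniteDimensional ℝ W] (hp : IsAsymmetricNorm p) :
    ∃ c C : ℝ, 0 < c ∧ 0 < C ∧ ∀ y, c * ‖y‖ ≤ p y ∧ p y ≤ C * ‖y‖ := by
  rcases subsingleton_or_nontrivial W with h | h
  · exact ⟨1, 1, one_pos, one_pos, fun y => by simp [Subsingleton.elim y 0, hp.map_zero]⟩
  have hne : (Metric.sphere (0 : W) 1).Nonempty := NormedSpace.sphere_nonempty.2 zero_le_one
  obtain ⟨a, ha, hmin⟩ := (isCompact_sphere (0 : W) 1).exists_isMinOn hne hp.continuous.continuousOn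
  obtain ⟨b, hb, hmax⟩ := (isCompact_sphere (0 : W) 1).exists_isMaxOn hne hp.continuous.continuousOn
  have hS : ∀ z ∈ Metric.sphere (0 : W) 1, 0 < p z := fun z hz =>
    hp.pos z (ne_zero_of_mem_unit_sphere ⟨z, hz⟩)
  refine ⟨p a, p b, hS a ha, hS b hb, fun y => ?_⟩
  rcases eq_or_ne y 0 with rfl | hy
  · simp [hp.map_zero]
  have hz : ‖y‖⁻¹ • y ∈ Metric.sphere (0 : W) 1 := by
    simp [norm_smul, hy]
  have e : p y = ‖y‖ * p (‖y‖⁻¹ • y) := by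
    rw [← hp.homogeneous _ _ (norm_nonneg y), smul_smul, mul_inv_cancel₀ (norm_ne_zero_iff.2 hy),
      one_smul]
  rw [e, mul_comm (p a), mul_comm (p b)]
  exact ⟨by gcongr; exact hmin hz, by gcongr; exact hmax hz⟩

end IsAsymmetricNorm

variable {p : V → ℝ}

/-- The average of `p²` over a family of endomorphisms with density `ρ`. -/
noncomputable def mollifiedSq (μ : Measure (V →L[ℝ] V)) (ρ : (V →L[ℝ] V) → ℝ) (p : V → ℝ) (y : V) :
    ℝ :=
  ∫ A, p (A y) ^ 2 * ρ A ∂μ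

/-- As p is merely continuous, the dependence on y has to be moved into ρ. For y near y₀ there is an
invertible T(y), smooth in y, with T(y) y₀ = y. Replacing A by A T(y)⁻¹ turns the integrand into p(A
y₀)² ρ(A T(y)⁻¹), up to a Jacobian. -/
theorem contDiffAt_mollifiedSq (μ : Measure (V →L[ℝ] V)) [μ.IsAddHaarMeasure]
    {ρ : (V →L[ℝ] V) → ℝ} (hρ : ContDiff ℝ ∞ ρ) {r : ℝ} (hsupp : ∀ A, ρ A ≠ 0 → ‖A - 1‖ ≤ r)
    (hint : ∫ A, ρ A ∂μ = 1) (hp : Continuous p) {y₀ : V} (hy₀ : y₀ ≠ 0) :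
    ContDiffAt ℝ ∞ (mollifiedSq μ ρ p) y₀ := by
  set ℓ : V →L[ℝ] ℝ := (‖y₀‖ ^ 2)⁻¹ • innerSL ℝ y₀ with hℓ
  have hℓ1 : ℓ y₀ = 1 := by
    have : ‖y₀‖ ≠ 0 := norm_ne_zero_iff.2 hy₀
    simp [hℓ, this]
  set T : V → (V →L[ℝ] V) := fun y => 1 + ℓ.smulRight (y - y₀) with hT
  have hTs : ContDiff ℝ ∞ T := by
    apply contDiff_const.add
    exact ((ContinuousLinearMap.smulRightL ℝ V V ℓ).contDiff).comp (contDiff_id.sub contDiff_const)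
  have hTy : ∀ y, T y y₀ = y := fun y => by simp [hT, hℓ1]
  set S : Set V := {y | IsUnit (T y) ∧ ‖T y‖ < 2} with hSdef
  have hS : IsOpen S :=
    (Units.isOpen.preimage hTs.continuous).inter (isOpen_lt hTs.continuous.norm continuous_const)
  have hy₀S : y₀ ∈ S := by
    have : T y₀ = 1 := by simp [hT]
    refine ⟨by rw [this]; exact isUnit_one, ?_⟩
    rw [this]
    exact lt_of_le_of_lt ContinuousLinearMap.norm_id_le (by norm_num)
  -- The sign makes the integral below the convolution with g y evaluated at 0, so that smoothness
  -- of parametrized convolutions applies.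
  set g : V → (V →L[ℝ] V) → ℝ := fun y A => ρ (-A * Ring.inverse (T y)) with hg
  have hgs : ∀ y, ∀ A, y ∈ S → A ∉ Metric.closedBall (0 : V →L[ℝ] V) ((1 + r) * 2) → g y A = 0 := by
    intro y A hy hA
    by_contra hne
    apply hA
    have h1 := hsupp _ hne
    have h2 : ‖-A * Ring.inverse (T y)‖ ≤ 1 + r := by
      calc ‖-A * Ring.inverse (T y)‖ = ‖1 + (-A * Ring.inverse (T y) - 1)‖ := by congr 1; abel
        _ ≤ ‖(1 : V →L[ℝ] V)‖ + ‖-A * Ring.inverse (T y) - 1‖ := norm_add_le _ _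
        _ ≤ 1 + r := add_le_add ContinuousLinearMap.norm_id_le h1
    have h3 : A = -((-A * Ring.inverse (T y)) * T y) := by
      rw [mul_assoc, Ring.inverse_mul_cancel _ hy.1]; simp
    have hr : 0 ≤ r := (norm_nonneg _).trans h1
    rw [mem_closedBall_zero_iff, h3, norm_neg]
    calc _ ≤ ‖-A * Ring.inverse (T y)‖ * ‖T y‖ := norm_mul_le _ _
      _ ≤ (1 + r) * 2 := by gcongr; exact hy.2.le
  have hgc : ContDiffOn ℝ ∞ ↿g (S ×ˢ univ) := by
    have h1 : ContDiffOn ℝ ∞ (fun q : V × (V →L[ℝ] V) => Ring.inverse (T q.1)) (S ×ˢ univ) := by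
      intro q hq
      obtain ⟨u, hu⟩ := hq.1.1
      have := contDiffAt_ringInverse ℝ u (n := ∞)
      rw [hu] at this
      exact (this.comp q ((hTs.comp contDiff_fst).contDiffAt)).contDiffWithinAt
    exact hρ.comp_contDiffOn ((contDiff_snd.neg.contDiffOn).mul h1)
  have hconv : ∀ f : (V →L[ℝ] V) → ℝ, Continuous f →
      ContDiffOn ℝ ∞ (fun y => ∫ A, f A * ρ (A * Ring.inverse (T y)) ∂μ) S := by
    intro f hf
    have := contDiffOn_convolution_right_with_param_comp (n := ⊤) (μ := μ)
      (ContinuousLinearMap.mul ℝ ℝ) (s := S) (v := fun _ => (0 : V →L[ℝ] V)) contDiffOn_const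
      (f := f) (g := g) hS (isCompact_closedBall (0 : V →L[ℝ] V) ((1 + r) * 2)) hgs
      hf.locallyIntegrable hgc
    refine this.congr fun y hy => ?_
    simp [convolution, hg]
  have hM := hconv (fun A => p (A y₀) ^ 2) (by fun_prop)
  have hN := hconv (fun _ => 1) continuous_const
  -- The Jacobian c is not computed. Since ρ has integral 1, the first equation exhibits it as the
  -- reciprocal of an integral that is already known to be smooth in y.
  have hkey : ∀ y ∈ S, ∃ c : ℝ,
      1 = c * (∫ A, 1 * ρ (A * Ring.inverse (T y)) ∂μ) ∧
      mollifiedSq μ ρ p y = c * ∫ A, p (A y₀) ^ 2 * ρ (A * Ring.inverse (T y)) ∂μ := by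
    intro y hy
    obtain ⟨u, hu⟩ := hy.1
    let Φ : (V →L[ℝ] V) ≃ₗ[ℝ] (V →L[ℝ] V) :=
      LinearEquiv.ofLinearMap (LinearMap.mulRight ℝ (T y)) (LinearMap.mulRight ℝ (Ring.inverse (T y)))
        (LinearMap.ext fun A => by simp [mul_assoc, Ring.inverse_mul_cancel _ hy.1])
        (LinearMap.ext fun A => by simp [mul_assoc, Ring.mul_inverse_cancel _ hy.1])
    have hΦ : ∀ A, Φ A = A * T y := fun A => rfl
    obtain ⟨c, hc⟩ := exists_integral_comp_equiv μ Φ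
    refine ⟨c, ?_, ?_⟩
    · rw [← hc]
      refine hint.symm.trans ?_
      congr 1 with A
      rw [hΦ, mul_assoc, Ring.mul_inverse_cancel _ hy.1, mul_one, one_mul]
    · rw [← hc, mollifiedSq]
      congr 1 with A
      rw [hΦ, mul_assoc, Ring.mul_inverse_cancel _ hy.1, mul_one, mul_apply_eq_comp,
        hTy]
  have hfin : ContDiffOn ℝ ∞ (mollifiedSq μ ρ p) S := by
    refine (hM.div hN fun y hy => ?_).congr fun y hy => ?_
    · obtain ⟨c, h1, -⟩ := hkey y hy
      intro h0
      rw [h0] at h1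
      simp at h1
    · obtain ⟨c, h1, h2⟩ := hkey y hy
      have h0 : (∫ A, 1 * ρ (A * Ring.inverse (T y)) ∂μ) ≠ 0 := by
        intro h0; rw [h0] at h1; simp at h1
      have hc : c = 1 / (∫ A, 1 * ρ (A * Ring.inverse (T y)) ∂μ) := by
        exact eq_div_of_mul_eq h0 h1.symm
      rw [h2, hc]
      simp only [Pi.div_apply]
      ring
  exact hfin.contDiffAt (hS.mem_nhds hy₀S)

theorem integrable_mollifiedSq (μ : Measure (V →L[ℝ] V)) [μ.IsAddHaarMeasure]
    {ρ : (V →L[ℝ] V) → ℝ} (hρ : Continuous ρ) {r : ℝ} (hsupp : ∀ A, ρ A ≠ 0 → ‖A - 1‖ ≤ r)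
    {f : (V →L[ℝ] V) → ℝ} (hf : Continuous f) : Integrable (fun A => f A * ρ A) μ := by
  apply (hf.mul hρ).integrable_of_hasCompactSupport
  apply HasCompactSupport.intro (isCompact_closedBall (1 : V →L[ℝ] V) r)
  intro A hA
  by_contra h
  exact hA (by simpa [dist_eq_norm] using hsupp A (right_ne_zero_of_mul h))

/-- An asymmetric norm on a Euclidean space can be approximated by slit-smooth strongly convex ones
that have the same isometries. -/
theorem IsAsymmetricNorm.exists_smooth_approx (hp : IsAsymmetricNorm p) {ε : ℝ} (hε : 0 < ε)
    (hε1 : ε < 1) :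
    ∃ (Q : V → ℝ) (m : ℝ), 0 < m ∧ Continuous Q ∧ (∀ y, y ≠ 0 → 0 < Q y) ∧
      (∀ (c : ℝ) (y : V), 0 ≤ c → Q (c • y) = c ^ 2 * Q y) ∧
      (∀ y, y ≠ 0 → ContDiffAt ℝ ∞ Q y) ∧ StrongConvexOn univ m Q ∧
      (∀ T : V ≃ₗᵢ[ℝ] V, (∀ y, p (T y) = p y) → ∀ y, Q (T y) = Q y) ∧
      ∀ y, ((1 - ε) * p y) ^ 2 ≤ Q y ∧ Q y ≤ ((1 + ε) * p y) ^ 2 := by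
  obtain ⟨c, C, hc, hC, hb⟩ := hp.exists_bounds
  let μ : Measure (V →L[ℝ] V) := Measure.addHaar
  -- With this radius C r ‖y‖ ≤ (ε / 2) p y, so an endomorphism r-close to 1 changes p by a relative
  -- error of at most ε / 2.
  set r : ℝ := c * (ε / 2) / C with hr
  obtain ⟨ρ, hρ, hρ0, hsupp, hint, hconj⟩ :=
    exists_conj_invariant_mollifier V μ (r := r) (by positivity)
  have hpc := hp.continuous
  have hI : ∀ f : (V →L[ℝ] V) → ℝ, Continuous f → Integrable (fun A => f A * ρ A) μ :=
    fun f hf => integrable_mollifiedSq μ hρ.continuous hsupp hf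
  have hev : ∀ y : V, Continuous fun A : V →L[ℝ] V => p (A y) ^ 2 := fun y => by fun_prop
  have hmono : ∀ f g : (V →L[ℝ] V) → ℝ, Continuous f → Continuous g →
      (∀ A, ‖A - 1‖ ≤ r → f A ≤ g A) → ∫ A, f A * ρ A ∂μ ≤ ∫ A, g A * ρ A ∂μ := by
    intro f g hf hg hfg
    refine integral_mono (hI f hf) (hI g hg) fun A => ?_
    by_cases hA : ρ A = 0
    · simp [hA]
    · exact mul_le_mul_of_nonneg_right (hfg A (hsupp A hA)) (hρ0 A)
  have hconst : ∀ a : ℝ, ∫ A, a * ρ A ∂μ = a := fun a => by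
    rw [integral_const_mul, hint, mul_one]
  set Q₀ := mollifiedSq μ ρ p with hQ₀
  have hest : ∀ (A : V →L[ℝ] V) (y : V), ‖A - 1‖ ≤ r →
      (1 - ε / 2) * p y ≤ p (A y) ∧ p (A y) ≤ (1 + ε / 2) * p y := by
    intro A y hA
    have hCr : C * (r * ‖y‖) ≤ ε / 2 * p y := by
      have : C * (r * ‖y‖) = ε / 2 * (c * ‖y‖) := by rw [hr]; field_simp
      rw [this]; gcongr; exact (hb y).1
    have hn : ‖(A - 1) y‖ ≤ r * ‖y‖ := (ContinuousLinearMap.le_opNorm _ _).trans (by gcongr)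
    have h1 : p ((A - 1) y) ≤ ε / 2 * p y :=
      (hb _).2.trans (le_trans (by gcongr) hCr)
    have h2 : p (-((A - 1) y)) ≤ ε / 2 * p y :=
      (hb _).2.trans (le_trans (by rw [norm_neg]; gcongr) hCr)
    have e1 : A y = y + (A - 1) y := by simp
    have e2 : y = A y + -((A - 1) y) := by simp
    have h3 := hp.add_le y ((A - 1) y)
    have h4 := hp.add_le (A y) (-((A - 1) y))
    rw [← e1] at h3
    rw [← e2] at h4
    constructor <;> linarith
  have hlow : ∀ y, ((1 - ε / 2) * p y) ^ 2 ≤ Q₀ y := fun y => by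
    rw [← hconst (((1 - ε / 2) * p y) ^ 2)]
    refine hmono _ _ continuous_const (hev y) fun A hA => ?_
    have h0 : 0 ≤ (1 - ε / 2) * p y := mul_nonneg (by linarith) (hp.nonneg y)
    gcongr
    exact (hest A y hA).1
  have hupp : ∀ y, Q₀ y ≤ ((1 + ε / 2) * p y) ^ 2 := fun y => by
    rw [← hconst (((1 + ε / 2) * p y) ^ 2)]
    refine hmono _ _ (hev y) continuous_const fun A hA => ?_
    have h0 := hp.nonneg (A y)
    gcongr
    exact (hest A y hA).2
  have hhom : ∀ (a : ℝ) (y : V), 0 ≤ a → Q₀ (a • y) = a ^ 2 * Q₀ y := by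
    intro a y ha
    simp only [hQ₀, mollifiedSq]
    rw [← integral_const_mul]
    congr 1 with A
    rw [map_smul, hp.homogeneous _ _ ha]
    ring
  have hconv : ConvexOn ℝ univ Q₀ := by
    refine ⟨convex_univ, fun x _ y _ a b ha hb' hab => ?_⟩
    have e : a • Q₀ x + b • Q₀ y = ∫ A, (a * p (A x) ^ 2 + b * p (A y) ^ 2) * ρ A ∂μ := by
      simp only [hQ₀, mollifiedSq, smul_eq_mul]
      rw [← integral_const_mul, ← integral_const_mul, ← integral_add]
      · congr 1 with A; ring
      · exact (hI _ (hev x)).const_mul a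
      · exact (hI _ (hev y)).const_mul b
    rw [e]
    refine hmono _ _ (hev _) (((hev x).const_mul a).add ((hev y).const_mul b)) fun A _ => ?_
    have h1 : p (A (a • x + b • y)) ≤ a * p (A x) + b * p (A y) := by
      rw [map_add, map_smul, map_smul, ← hp.homogeneous _ _ ha, ← hp.homogeneous _ _ hb']
      exact hp.add_le _ _
    have h0 := hp.nonneg (A (a • x + b • y))
    calc p (A (a • x + b • y)) ^ 2 ≤ (a * p (A x) + b * p (A y)) ^ 2 := by gcongr
      _ ≤ a * p (A x) ^ 2 + b * p (A y) ^ 2 := by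
        obtain rfl : b = 1 - a := by linarith
        nlinarith [mul_nonneg (mul_nonneg ha hb') (sq_nonneg (p (A x) - p (A y)))]
  have hcont : Continuous Q₀ := by
    rw [← continuousOn_univ]
    exact hconv.continuousOn isOpen_univ
  have hinv : ∀ T : V ≃ₗᵢ[ℝ] V, (∀ y, p (T y) = p y) → ∀ y, Q₀ (T y) = Q₀ y := by
    intro T hT y
    let t : V →L[ℝ] V := T.toContinuousLinearEquiv
    let t' : V →L[ℝ] V := T.symm.toContinuousLinearEquiv
    have ht : t * t' = 1 := by ext z; simp [t, t']
    have ht' : t' * t = 1 := by ext z; simp [t, t']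
    let Φ : (V →L[ℝ] V) ≃ₗ[ℝ] (V →L[ℝ] V) :=
      LinearEquiv.ofLinearMap (LinearMap.mulLeft ℝ t' ∘ₗ LinearMap.mulRight ℝ t)
        (LinearMap.mulLeft ℝ t ∘ₗ LinearMap.mulRight ℝ t')
        (LinearMap.ext fun A => by
          simp [mul_assoc, ht']; rw [← mul_assoc, ht', one_mul])
        (LinearMap.ext fun A => by
          simp [mul_assoc, ht]; rw [← mul_assoc, ht, one_mul])
    have hΦ : ∀ A z, T (Φ A z) = A (T z) := fun A z => by
      change T (T.symm (A (T z))) = _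
      simp
    obtain ⟨k, hk⟩ := exists_integral_comp_equiv μ Φ
    have hρΦ : ∀ A, ρ (Φ A) = ρ A := fun A => hconj T A (Φ A) (hΦ A)
    -- Conjugation by T preserves ρ, whose integral is 1, so its Jacobian is 1.
    have hk1 : k = 1 := by
      have := hk ρ
      simp only [hρΦ, hint] at this
      linarith
    have := hk fun A => p (A y) ^ 2 * ρ A
    rw [hk1, one_mul] at this
    simp only [hQ₀, mollifiedSq]
    rw [← this]
    congr 1 with A
    rw [hρΦ, ← hΦ, hT]
  -- Adding η ‖y‖² gives strong convexity. It costs at most (ε / 2) p(y)², which fits between (1 + ε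
  -- / 2)² p(y)² and (1 + ε)² p(y)².
  set η : ℝ := c ^ 2 * (ε / 2) with hη
  have hη0 : 0 < η := by positivity
  have hηp : ∀ y, η * ‖y‖ ^ 2 ≤ ε / 2 * p y ^ 2 := fun y => by
    have : η * ‖y‖ ^ 2 = ε / 2 * (c * ‖y‖) ^ 2 := by rw [hη]; ring
    rw [this]
    have := (hb y).1
    gcongr
  refine ⟨fun y => Q₀ y + η * ‖y‖ ^ 2, 2 * η, by positivity, by fun_prop, fun y hy => ?_,
    fun a y ha => ?_, fun y hy => ?_, ?_, fun T hT y => ?_, fun y => ⟨?_, ?_⟩⟩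
  · have h1 : 0 < ‖y‖ := norm_pos_iff.2 hy
    have h2 : 0 ≤ Q₀ y := (sq_nonneg _).trans (hlow y)
    positivity
  · simp only [hhom a y ha, norm_smul, Real.norm_eq_abs, mul_pow, sq_abs]
    ring
  · exact (contDiffAt_mollifiedSq μ hρ hsupp hint hpc hy).add
      (contDiffAt_const.mul (contDiff_norm_sq ℝ).contDiffAt)
  · rw [strongConvexOn_iff_convex]
    convert hconv using 2 with y
    ring
  · simp only [hinv T hT, LinearIsometryEquiv.norm_map]
  · have h1 : ((1 - ε) * p y) ^ 2 ≤ ((1 - ε / 2) * p y) ^ 2 := by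
      have h0 := hp.nonneg y
      have : 0 ≤ 1 - ε := by linarith
      gcongr
      linarith
    have h2 : 0 ≤ η * ‖y‖ ^ 2 := by positivity
    linarith [hlow y]
  · have h3 := hupp y
    have h4 := hηp y
    have : ((1 + ε / 2) * p y) ^ 2 + ε / 2 * p y ^ 2 ≤ ((1 + ε) * p y) ^ 2 := by
      have : 0 ≤ p y ^ 2 := sq_nonneg _
      nlinarith [mul_nonneg hε.le this, mul_nonneg (mul_nonneg hε.le hε.le) this]
    linarith

end Smoothing

/-! ### Quotients of smooth strongly convex energies -/

section Pushdown

/-- Squares of slit-smooth strongly convex asymmetric norms. -/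
structure IsStrongEnergy {V : Type*} [NormedAddCommGroup V] [NormedSpace ℝ V]
    (Q : V → ℝ) (m : ℝ) : Prop where
  modulus_pos : 0 < m
  continuous : Continuous Q
  pos : ∀ y, y ≠ 0 → 0 < Q y
  homogeneous : ∀ (c : ℝ) (y : V), 0 ≤ c → Q (c • y) = c ^ 2 * Q y
  smooth : ∀ y, y ≠ 0 → ContDiffAt ℝ ∞ Q y
  strongConvex : StrongConvexOn univ m Q

variable {V : Type*} [NormedAddCommGroup V] [NormedSpace ℝ V]

namespace IsStrongEnergy

variable {Q : V → ℝ} {m : ℝ}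

theorem map_zero (hQ : IsStrongEnergy Q m) : Q 0 = 0 := by
  simpa using hQ.homogeneous 0 0 le_rfl

theorem nonneg (hQ : IsStrongEnergy Q m) (y : V) : 0 ≤ Q y := by
  rcases eq_or_ne y 0 with rfl | h
  · exact hQ.map_zero.ge
  · exact (hQ.pos y h).le

theorem isMinkowskiNorm (hQ : IsStrongEnergy Q m) : IsMinkowskiNorm (fun y => √(Q y)) :=
  isMinkowskiNorm_sqrt hQ.modulus_pos hQ.continuous hQ.pos hQ.homogeneous hQ.smooth hQ.strongConvex

/-- Strong convexity at the midpoint of y and 0, combined with Q(y / 2) = Q(y) / 4. -/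
theorem le_apply (hQ : IsStrongEnergy Q m) (y : V) : m / 2 * ‖y‖ ^ 2 ≤ Q y := by
  have h := hQ.strongConvex.2 (mem_univ y) (mem_univ 0) (show (0 : ℝ) ≤ 1 / 2 by norm_num)
    (show (0 : ℝ) ≤ 1 / 2 by norm_num) (by norm_num)
  rw [smul_zero, add_zero, hQ.homogeneous _ _ (by norm_num), hQ.map_zero] at h
  simp only [sub_zero, smul_eq_mul, mul_zero, add_zero] at h
  linarith

theorem convexOn (hQ : IsStrongEnergy Q m) : ConvexOn ℝ univ Q :=
  UniformConvexOn.convexOn hQ.strongConvex fun r => by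
    have := hQ.modulus_pos
    positivity

/-- The quadratic lower bound makes sublevel sets compact. -/
theorem exists_min_fiber [FiniteDimensional ℝ V] {V' : Type*} [NormedAddCommGroup V']
    [NormedSpace ℝ V'] (hQ : IsStrongEnergy Q m) {P : V →L[ℝ] V'} (hP : Function.Surjective P)
    (v : V') : ∃ w, P w = v ∧ ∀ w', P w' = v → Q w ≤ Q w' := by
  obtain ⟨w₀, hw₀⟩ := hP v
  have hm := hQ.modulus_pos
  set K : Set V := {w | P w = v} ∩ {w | Q w ≤ Q w₀} with hK
  have hKc : IsCompact K := by
    refine Metric.isCompact_of_isClosed_isBounded ?_ ?_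
    · exact (isClosed_eq P.continuous continuous_const).inter
        (isClosed_le hQ.continuous continuous_const)
    · refine (Metric.isBounded_closedBall (x := (0 : V)) (r := √(2 / m * Q w₀))).subset ?_
      intro w hw
      rw [mem_closedBall_zero_iff]
      apply Real.le_sqrt_of_sq_le
      have h1 := hQ.le_apply w
      have h2 : Q w ≤ Q w₀ := hw.2
      have h3 : m / 2 * ‖w‖ ^ 2 ≤ Q w₀ := h1.trans h2
      calc ‖w‖ ^ 2 = 2 / m * (m / 2 * ‖w‖ ^ 2) := by field_simp
        _ ≤ 2 / m * Q w₀ := by gcongr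
  obtain ⟨w, hw, hmin⟩ := hKc.exists_isMinOn ⟨w₀, hw₀, le_refl (Q w₀)⟩ hQ.continuous.continuousOn
  refine ⟨w, hw.1, fun w' hw' => ?_⟩
  by_cases h : Q w' ≤ Q w₀
  · exact hmin ⟨hw', h⟩
  · exact (show Q w ≤ Q w₀ from hw.2).trans (not_le.1 h).le

/-- A critical point of the energy along an affine subspace is a minimum. -/
theorem apply_le_of_fderiv_eq_zero (hQ : IsStrongEnergy Q m) {w η : V} (hw : w ≠ 0)
    (h : fderiv ℝ Q w η = 0) : Q w ≤ Q (w + η) := by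
  have hd : HasDerivAt (fun t : ℝ => Q (w + t • η)) 0 0 := by
    have := hasDerivAt_comp_line (h := Q) (x := w) (u := η) (t := 0)
      (by simpa using (hQ.smooth w hw).differentiableAt (by simp))
    simpa [h] using this
  have hc : ConvexOn ℝ univ (fun t : ℝ => Q (w + t • η)) := by
    refine ⟨convex_univ, fun s _ t _ a b ha hb hab => ?_⟩
    have := hQ.convexOn.2 (mem_univ (w + s • η)) (mem_univ (w + t • η)) ha hb hab
    convert this using 2
    have : w = (a + b) • w := by simp [hab]
    conv_lhs => rw [this]
    simp only [smul_eq_mul]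
    module
  have := hc.le_slope_of_hasDerivAt (mem_univ 0) (mem_univ 1) one_pos hd
  simpa [slope] using this

theorem fderiv_eq_zero_of_min (hQ : IsStrongEnergy Q m) {w η : V} (hw : w ≠ 0)
    (h : ∀ t : ℝ, Q w ≤ Q (w + t • η)) : fderiv ℝ Q w η = 0 := by
  have hd := hasDerivAt_comp_line (h := Q) (x := w) (u := η) (t := 0)
      (by simpa using (hQ.smooth w hw).differentiableAt (by simp))
  have hmin : IsLocalMin (fun t : ℝ => Q (w + t • η)) 0 :=
    Filter.Eventually.of_forall fun t => by simpa using h t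
  simpa using hmin.hasDerivAt_eq_zero hd

/-- The minimizers of the energy in the fibres of a linear map depend smoothly on the fibre. -/
theorem exists_contDiffAt_min [FiniteDimensional ℝ V] {V' : Type*} [NormedAddCommGroup V']
    [NormedSpace ℝ V'] [FiniteDimensional ℝ V'] (hQ : IsStrongEnergy Q m) {P : V →L[ℝ] V'}
    (hP : Function.Surjective P) {w₀ : V} (hw₀ : w₀ ≠ 0)
    (hmin : ∀ w', P w' = P w₀ → Q w₀ ≤ Q w') :
    ∃ s : V' → V, ContDiffAt ℝ ∞ s (P w₀) ∧ s (P w₀) = w₀ ∧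
      ∀ᶠ v in 𝓝 (P w₀), P (s v) = v ∧ ∀ w', P w' = v → Q (s v) ≤ Q w' := by
  have hm := hQ.modulus_pos
  let K : Submodule ℝ V := LinearMap.ker (P : V →ₗ[ℝ] V')
  let b := Module.finBasis ℝ K
  have hext : ∀ f : V →L[ℝ] ℝ, (∀ i, f (b i) = 0) → ∀ η ∈ K, f η = 0 := by
    intro f hf η hη
    have : (f : V →ₗ[ℝ] ℝ) ∘ₗ K.subtype = 0 := b.ext hf
    exact LinearMap.congr_fun this ⟨η, hη⟩
  -- The minimizers in fibres are the points where dQ vanishes on the kernel K of P, that is, where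
  -- the second component of Ψ is zero. The differential of Ψ at w₀ is injective because the Hessian
  -- of Q is definite on K, hence bijective by dimension count. The local inverse along (v, 0) is
  -- the desired section.
  let Ψ : V → V' × (Fin (Module.finrank ℝ K) → ℝ) := fun w => (P w, fun i => fderiv ℝ Q w (b i))
  have hdQ : ContDiffAt ℝ ∞ (fderiv ℝ Q) w₀ := (hQ.smooth w₀ hw₀).fderiv_right (by simp)
  have hΨ : ContDiffAt ℝ ∞ Ψ w₀ :=
    P.contDiff.contDiffAt.prodMk (contDiffAt_pi.2 fun i => hdQ.clm_apply contDiffAt_const)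
  let D : V →L[ℝ] V' × (Fin (Module.finrank ℝ K) → ℝ) := P.prod
    (ContinuousLinearMap.pi fun i =>
      (ContinuousLinearMap.apply ℝ ℝ (b i : V)).comp (fderiv ℝ (fderiv ℝ Q) w₀))
  have hD : HasFDerivAt Ψ D w₀ :=
    P.hasFDerivAt.prodMk (hasFDerivAt_pi.2 fun i =>
      (ContinuousLinearMap.apply ℝ ℝ (b i : V)).hasFDerivAt.comp w₀
        (hdQ.differentiableAt (by simp)).hasFDerivAt)
  have hinj : Function.Injective D := by
    rw [injective_iff_map_eq_zero]
    intro u hu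
    have h1 : P u = 0 := congrArg Prod.fst hu
    have h2 : ∀ i, fderiv ℝ (fderiv ℝ Q) w₀ u (b i) = 0 := fun i =>
      congrFun (congrArg Prod.snd hu) i
    have h3 : fderiv ℝ (fderiv ℝ Q) w₀ u u = 0 := hext _ h2 u h1
    have h4 := hQ.strongConvex.le_iteratedFDeriv_two ((hQ.smooth w₀ hw₀).of_le two_le_infty) u
    rw [iteratedFDeriv_two_apply] at h4
    have h5 : m * ‖u‖ ^ 2 ≤ 0 := by simpa [h3] using h4
    have h6 : ‖u‖ ^ 2 ≤ 0 := by
      by_contra h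
      push Not at h
      have := mul_pos hm h
      linarith
    simpa using h6
  have hrank : Module.finrank ℝ V =
      Module.finrank ℝ (V' × (Fin (Module.finrank ℝ K) → ℝ)) := by
    rw [Module.finrank_prod, Module.finrank_fin_fun]
    have h2 := LinearMap.finrank_range_add_finrank_ker (P : V →ₗ[ℝ] V')
    rwa [LinearMap.range_eq_top.2 hP, finrank_top, eq_comm] at h2
  let e : V ≃L[ℝ] V' × (Fin (Module.finrank ℝ K) → ℝ) :=
    (LinearEquiv.ofInjectiveOfFinrankEq (D : V →ₗ[ℝ] V' × (Fin (Module.finrank ℝ K) → ℝ)) hinj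
      hrank).toContinuousLinearEquiv
  have he : HasFDerivAt Ψ (e : V →L[ℝ] V' × (Fin (Module.finrank ℝ K) → ℝ)) w₀ := hD
  have hn : ((⊤ : ℕ∞) : ℕ∞ω) ≠ 0 := by simp
  have hstrict := hΨ.hasStrictFDerivAt' he hn
  have hcrit : (fun i => fderiv ℝ Q w₀ (b i)) = 0 := by
    ext i
    refine hQ.fderiv_eq_zero_of_min hw₀ fun t => hmin _ ?_
    have : P (b i) = 0 := (b i).2
    simp [this]
  have hΨ₀ : Ψ w₀ = (P w₀, 0) := by simp only [Ψ, hcrit]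
  let L := hstrict.localInverse Ψ e w₀
  have hL : ContDiffAt ℝ ∞ L (P w₀, 0) := by
    have := hΨ.to_localInverse he hn
    rwa [hΨ₀] at this
  have hL₀ : L (P w₀, 0) = w₀ := by rw [← hΨ₀]; exact hstrict.localInverse_apply_image
  have hι : ContDiff ℝ ∞ (fun v : V' => (v, (0 : Fin (Module.finrank ℝ K) → ℝ))) := contDiff_id.prodMk contDiff_const
  have hs : ContDiffAt ℝ ∞ (fun v => L (v, 0)) (P w₀) :=
    ContDiffAt.comp (f := fun v : V' => (v, (0 : Fin (Module.finrank ℝ K) → ℝ))) _ hL hι.contDiffAt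
  refine ⟨fun v => L (v, 0), hs, hL₀, ?_⟩
  have h1 : ∀ᶠ v in 𝓝 (P w₀), Ψ (L (v, 0)) = (v, 0) := by
    have := hstrict.eventually_right_inverse
    rw [hΨ₀] at this
    exact (hι.continuous.tendsto (P w₀)).eventually this
  have h2 : ∀ᶠ v in 𝓝 (P w₀), L (v, 0) ≠ 0 := by
    apply hs.continuousAt.eventually_ne
    rwa [hL₀]
  filter_upwards [h1, h2] with v hv hv0
  have h3 : P (L (v, 0)) = v := congrArg Prod.fst hv
  refine ⟨h3, fun w' hw' => ?_⟩
  have hk : w' - L (v, 0) ∈ K := by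
    change P (w' - L (v, 0)) = 0
    rw [map_sub, hw', h3, sub_self]
  have h5 : fderiv ℝ Q (L (v, 0)) (w' - L (v, 0)) = 0 :=
    hext _ (fun i => congrFun (congrArg Prod.snd hv) i) _ hk
  simpa using hQ.apply_le_of_fderiv_eq_zero hv0 h5

/-- The quotient of a strong energy under a surjective linear map. -/
theorem exists_pushforward [FiniteDimensional ℝ V] {V' : Type*} [NormedAddCommGroup V']
    [NormedSpace ℝ V'] [FiniteDimensional ℝ V'] (hQ : IsStrongEnergy Q m) {P : V →L[ℝ] V'}
    (hP : Function.Surjective P) :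
    ∃ (Q' : V' → ℝ) (m' : ℝ), IsStrongEnergy Q' m' ∧ (∀ w, Q' (P w) ≤ Q w) ∧
      ∀ v, ∃ w, P w = v ∧ Q w = Q' v := by
  have hm := hQ.modulus_pos
  choose W hWP hWmin using fun v => hQ.exists_min_fiber hP v
  have hle : ∀ w, Q (W (P w)) ≤ Q w := fun w => hWmin _ _ rfl
  have hW0 : ∀ v, v ≠ 0 → W v ≠ 0 := fun v hv h => hv (by rw [← hWP v, h, _root_.map_zero])
  -- The distance of x and y is at most ‖P‖ times that of their minimizing lifts, whence the
  -- modulus; the summand 1 keeps the denominator positive.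
  have hconv : StrongConvexOn univ (m / (‖P‖ + 1) ^ 2) (fun v => Q (W v)) := by
    refine ⟨convex_univ, fun x _ y _ a b ha hb hab => ?_⟩
    have h1 := hQ.strongConvex.2 (mem_univ (W x)) (mem_univ (W y)) ha hb hab
    have h2 : Q (W (a • x + b • y)) ≤ Q (a • W x + b • W y) :=
      hWmin _ _ (by simp [hWP])
    have h3 : ‖x - y‖ ≤ (‖P‖ + 1) * ‖W x - W y‖ := by
      have : x - y = P (W x - W y) := by simp [hWP]
      rw [this]
      exact (P.le_opNorm _).trans (by gcongr; linarith)
    have h4 : m / (‖P‖ + 1) ^ 2 / 2 * ‖x - y‖ ^ 2 ≤ m / 2 * ‖W x - W y‖ ^ 2 := by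
      have h0 : 0 < ‖P‖ + 1 := by positivity
      calc m / (‖P‖ + 1) ^ 2 / 2 * ‖x - y‖ ^ 2
          ≤ m / (‖P‖ + 1) ^ 2 / 2 * ((‖P‖ + 1) * ‖W x - W y‖) ^ 2 := by gcongr
        _ = m / 2 * ‖W x - W y‖ ^ 2 := by field_simp
    have h5 := mul_le_mul_of_nonneg_left h4 (mul_nonneg ha hb)
    simp only [smul_eq_mul] at h1 ⊢
    linarith
  have hcont : Continuous fun v => Q (W v) := by
    rw [← continuousOn_univ]
    exact (UniformConvexOn.convexOn hconv fun r => by positivity).continuousOn isOpen_univ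
  have hhom_le : ∀ (c : ℝ) (y : V'), 0 ≤ c → Q (W (c • y)) ≤ c ^ 2 * Q (W y) := fun c y hc => by
    rw [← hQ.homogeneous _ _ hc]
    exact hWmin _ _ (by simp [hWP])
  refine ⟨fun v => Q (W v), m / (‖P‖ + 1) ^ 2,
    ⟨by positivity, hcont, fun y hy => hQ.pos _ (hW0 y hy), fun c y hc => ?_, fun y hy => ?_,
      hconv⟩, hle, fun v => ⟨W v, hWP v, rfl⟩⟩
  · refine le_antisymm (hhom_le c y hc) ?_
    rcases hc.eq_or_lt with rfl | hc
    · simpa using hQ.nonneg _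
    · have := hhom_le c⁻¹ (c • y) (by positivity)
      rw [smul_smul, inv_mul_cancel₀ hc.ne', one_smul] at this
      calc c ^ 2 * Q (W y) ≤ c ^ 2 * (c⁻¹ ^ 2 * Q (W (c • y))) := by gcongr
        _ = Q (W (c • y)) := by field_simp
  -- The chosen minimizers W need not vary smoothly, but near y the smooth section s has the same
  -- energy.
  · obtain ⟨s, hs, hs0, hsev⟩ := hQ.exists_contDiffAt_min hP (hW0 y hy)
      (fun w' hw' => hWmin _ _ (hw'.trans (hWP y)))
    rw [hWP] at hs hs0 hsev
    have h1 : ContDiffAt ℝ ∞ (fun v => Q (s v)) y := by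
      refine ContDiffAt.comp y ?_ hs
      rw [hs0]
      exact hQ.smooth _ (hW0 y hy)
    refine h1.congr_of_eventuallyEq ?_
    filter_upwards [hsev] with v hv
    exact le_antisymm (hWmin _ _ hv.1) (hv.2 _ (hWP v))

end IsStrongEnergy

/-- Coordinates that turn a positive definite symmetric bilinear form into the standard one. -/
theorem exists_linearEquiv_euclideanSpace {W : Type*} [AddCommGroup W] [Module ℝ W]
    [FiniteDimensional ℝ W] (B : LinearMap.BilinForm ℝ W) (hsymm : ∀ x y, B x y = B y x)
    (hpos : ∀ x, x ≠ 0 → 0 < B x x) :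
    ∃ (n : ℕ) (e : W ≃ₗ[ℝ] EuclideanSpace ℝ (Fin n)), ∀ x, ‖e x‖ ^ 2 = B x x := by
  let core : InnerProductSpace.Core ℝ W :=
    { inner := fun x y => B x y
      conj_inner_symm := fun x y => by simp [hsymm x y]
      re_inner_nonneg := fun x => by
        rcases eq_or_ne x 0 with rfl | h
        · simp
        · simpa using (hpos x h).le
      add_left := fun x y z => by simp
      smul_left := fun x y r => by simp
      definite := fun x hx => by
        by_contra h
        exact (hpos x h).ne' hx }
  let _ : NormedAddCommGroup W := core.toNormedAddCommGroup
  let _ : InnerProductSpace ℝ W := InnerProductSpace.ofCore core.toCore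
  refine ⟨Module.finrank ℝ W, (stdOrthonormalBasis ℝ W).repr.toLinearEquiv, fun x => ?_⟩
  have h1 : ‖(stdOrthonormalBasis ℝ W).repr.toLinearEquiv x‖ = ‖x‖ :=
    (stdOrthonormalBasis ℝ W).repr.norm_map x
  rw [h1, ← real_inner_self_eq_norm_sq]
  rfl

end Pushdown

/-! ### Lengths of curves and the asymmetric distance -/

section Length

variable {E : Type*} [NormedAddCommGroup E] [NormedSpace ℝ E]
  {M : Type*} [TopologicalSpace M] [ChartedSpace E M]

/-- The velocity of a curve, as a point of the tangent bundle. -/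
noncomputable def velocity (γ : ℝ → M) (t : ℝ) : TangentBundle 𝓘(ℝ, E) M :=
  ⟨γ t, mfderiv 𝓘(ℝ, ℝ) 𝓘(ℝ, E) γ t (1 : ℝ)⟩

theorem velocity_congr {γ γ' : ℝ → M} {t : ℝ} (h : γ =ᶠ[𝓝 t] γ') :
    (velocity γ t : TangentBundle 𝓘(ℝ, E) M) = velocity γ' t := by
  have h1 := h.eq_of_nhds
  have h2 := h.mfderiv_eq (I := 𝓘(ℝ, ℝ)) (I' := 𝓘(ℝ, E))
  unfold velocity
  congr! 1
  exact DFunLike.congr_fun h2 (1 : ℝ)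

variable [IsManifold 𝓘(ℝ, E) ∞ M]

namespace FinslerMetric

variable (F : FinslerMetric E M) {γ γ' : ℝ → M} {a b c : ℝ} {x y z : M}

theorem map_smul {c : ℝ} (hc : 0 ≤ c) (x : M) (v : TangentSpace 𝓘(ℝ, E) x) :
    F ⟨x, c • v⟩ = c * F ⟨x, v⟩ :=
  (F.minkowski x).homogeneous c v hc

theorem nonneg (v : TangentBundle 𝓘(ℝ, E) M) : 0 ≤ F v := (F.minkowski v.1).nonneg v.2

/-- The length of a curve between the parameters `a` and `b`. -/
noncomputable def pathLength (γ : ℝ → M) (a b : ℝ) : ℝ≥0∞ :=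
  ∫⁻ t in Icc a b, ENNReal.ofReal (F (velocity γ t))

theorem pathLength_eq_lintegral_Ioo :
    F.pathLength γ a b = ∫⁻ t in Ioo a b, ENNReal.ofReal (F (velocity γ t)) := by
  rw [pathLength, restrict_Ioo_eq_restrict_Icc]

theorem pathLength_eq_lintegral_mfderivWithin :
    F.pathLength γ a b = ∫⁻ t in Icc a b, ENNReal.ofReal
      (F ⟨γ t, mfderivWithin 𝓘(ℝ, ℝ) 𝓘(ℝ, E) γ (Icc a b) t (1 : ℝ)⟩) := by
  rw [pathLength, ← restrict_Ioo_eq_restrict_Icc]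
  apply setLIntegral_congr_fun measurableSet_Ioo (fun t ht => ?_)
  rw [velocity, mfderivWithin_of_mem_nhds (Icc_mem_nhds ht.1 ht.2)]

theorem curveLength_eq : F.curveLength γ = F.pathLength γ 0 1 :=
  F.pathLength_eq_lintegral_mfderivWithin.symm

@[simp] theorem pathLength_self : F.pathLength γ a a = 0 := by
  simp [pathLength]

theorem pathLength_congr_Ioo (h : EqOn γ γ' (Ioo a b)) :
    F.pathLength γ a b = F.pathLength γ' a b := by
  simp only [pathLength_eq_lintegral_Ioo]
  apply setLIntegral_congr_fun measurableSet_Ioo (fun t ht => ?_)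
  have : (velocity γ t : TangentBundle 𝓘(ℝ, E) M) = velocity γ' t := velocity_congr <| by
    filter_upwards [Ioo_mem_nhds ht.1 ht.2] with s hs using h hs
  rw [this]

theorem pathLength_mono {a' b' : ℝ} (h : a' ≤ a) (h' : b ≤ b') :
    F.pathLength γ a b ≤ F.pathLength γ a' b' :=
  lintegral_mono_set (Icc_subset_Icc h h')

theorem pathLength_add (h : a ≤ b) (h' : b ≤ c) :
    F.pathLength γ a b + F.pathLength γ b c = F.pathLength γ a c := by
  symm
  have : Icc a c = Icc a b ∪ Ioc b c := (Icc_union_Ioc_eq_Icc h h').symm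
  rw [pathLength, this, lintegral_union measurableSet_Ioc]; swap
  · exact disjoint_iff_forall_ne.mpr (fun a ha b hb => (ha.2.trans_lt hb.1).ne)
  simp [restrict_Ioc_eq_restrict_Icc, pathLength]

theorem pathLength_comp_of_monotoneOn {f : ℝ → ℝ} (h : a ≤ b) (hf : MonotoneOn f (Icc a b))
    (h'f : DifferentiableOn ℝ f (Icc a b))
    (hγ : MDifferentiableOn 𝓘(ℝ, ℝ) 𝓘(ℝ, E) γ (Icc (f a) (f b))) :
    F.pathLength (γ ∘ f) a b = F.pathLength γ (f a) (f b) := by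
  rcases h.eq_or_lt with rfl | h
  · simp
  have f_im : f '' (Icc a b) = Icc (f a) (f b) := h'f.continuousOn.image_Icc_of_monotoneOn h.le hf
  simp only [pathLength_eq_lintegral_mfderivWithin, ← f_im]
  have B (t) (ht : t ∈ Icc a b) : HasDerivWithinAt f (derivWithin f (Icc a b) t) (Icc a b) t :=
    (h'f t ht).hasDerivWithinAt
  rw [lintegral_image_eq_lintegral_deriv_mul_of_monotoneOn measurableSet_Icc B hf]
  apply setLIntegral_congr_fun measurableSet_Icc (fun t ht => ?_)
  have h1 : (mfderivWithin 𝓘(ℝ, ℝ) 𝓘(ℝ, E) (γ ∘ f) (Icc a b) t) =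
      (mfderivWithin 𝓘(ℝ, ℝ) 𝓘(ℝ, E) γ (Icc (f a) (f b)) (f t)) ∘L
        mfderivWithin 𝓘(ℝ, ℝ) 𝓘(ℝ, ℝ) f (Icc a b) t := by
    rw [← f_im] at hγ ⊢
    apply mfderivWithin_comp
    · apply hγ _ (mem_image_of_mem _ ht)
    · rw [mdifferentiableWithinAt_iff_differentiableWithinAt]
      exact h'f _ ht
    · exact subset_preimage_image _ _
    · rw [uniqueMDiffWithinAt_iff_uniqueDiffWithinAt]
      exact uniqueDiffOn_Icc h _ ht
  have h2 : mfderivWithin 𝓘(ℝ, ℝ) 𝓘(ℝ, ℝ) f (Icc a b) t (1 : ℝ) =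
      derivWithin f (Icc a b) t • (1 : TangentSpace 𝓘(ℝ, ℝ) (f t)) := by
    simp only [mfderivWithin_eq_fderivWithin, ← fderivWithin_derivWithin]
    exact (mul_one (fderivWithin ℝ f (Icc a b) t 1)).symm
  have h3 : mfderivWithin 𝓘(ℝ, ℝ) 𝓘(ℝ, E) (γ ∘ f) (Icc a b) t (1 : ℝ) =
      derivWithin f (Icc a b) t •
        mfderivWithin 𝓘(ℝ, ℝ) 𝓘(ℝ, E) γ (f '' Icc a b) (f t) (1 : ℝ) := by
    rw [h1, f_im]
    refine (congrArg (mfderivWithin 𝓘(ℝ, ℝ) 𝓘(ℝ, E) γ (Icc (f a) (f b)) (f t)) h2).trans ?_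
    exact ContinuousLinearMap.map_smul _ _ _
  have h4 : 0 ≤ derivWithin f (Icc a b) t := hf.derivWithin_nonneg
  have h5 := F.map_smul h4 (γ (f t))
    (mfderivWithin 𝓘(ℝ, ℝ) 𝓘(ℝ, E) γ (f '' Icc a b) (f t) (1 : ℝ))
  rw [← ENNReal.ofReal_mul h4]
  congr 1
  refine Eq.trans ?_ h5
  exact congrArg (fun v => F ⟨γ (f t), v⟩) h3

theorem edist_le_pathLength (hγ : ContMDiffOn 𝓘(ℝ, ℝ) 𝓘(ℝ, E) 1 γ (Icc a b))
    (ha : γ a = x) (hb : γ b = y) (hab : a ≤ b) : F.edist x y ≤ F.pathLength γ a b := by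
  let η : ℝ → ℝ := fun t => a + (b - a) * t
  have hηs : ContDiff ℝ 1 η := by fun_prop
  have hmono : Monotone η := fun s t hst => by
    have : 0 ≤ b - a := sub_nonneg.2 hab
    simp only [η]
    gcongr
  have e0 : η 0 = a := by simp [η]
  have e1 : η 1 = b := by simp [η]
  have hη : ContMDiffOn 𝓘(ℝ, ℝ) 𝓘(ℝ, E) 1 (γ ∘ η) (Icc 0 1) := by
    apply hγ.comp
    · rw [contMDiffOn_iff_contDiffOn]
      exact hηs.contDiffOn
    · intro t ht
      exact ⟨e0 ▸ hmono ht.1, e1 ▸ hmono ht.2⟩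
  have h1 : F.edist x y ≤ F.curveLength (γ ∘ η) :=
    iInf₂_le (γ ∘ η) ⟨hη, by simp [e0, ha], by simp [e1, hb]⟩
  rw [curveLength_eq, F.pathLength_comp_of_monotoneOn zero_le_one (hmono.monotoneOn _)
    (hηs.differentiable one_ne_zero).differentiableOn (by
      rw [e0, e1]; exact hγ.mdifferentiableOn one_ne_zero), e0, e1] at h1
  exact h1

theorem edist_self : F.edist x x = 0 := by
  have h := F.edist_le_pathLength (γ := fun _ => x) (a := 0) (b := 0) (x := x) (y := x)
    contMDiffOn_const rfl rfl le_rfl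
  simpa using h

/-- Curves of almost minimal length which are constant near their ends. -/
theorem exists_pathLength_lt_of_edist_lt {r : ℝ≥0∞} (hr : F.edist x y < r) (hab : a < b) :
    ∃ γ : ℝ → M, γ a = x ∧ γ b = y ∧ ContMDiff 𝓘(ℝ, ℝ) 𝓘(ℝ, E) 1 γ ∧
      F.pathLength γ a b < r ∧ γ =ᶠ[𝓝 a] (fun _ => x) ∧ γ =ᶠ[𝓝 b] (fun _ => y) := by
  simp only [edist, iInf_lt_iff, exists_prop] at hr
  obtain ⟨γ, ⟨γ_smooth, hγx, hγy⟩, hγ⟩ := hr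
  rw [curveLength_eq] at hγ
  rcases exists_between hab with ⟨a', haa', ha'b⟩
  rcases exists_between ha'b with ⟨b', ha'b', hb'b⟩
  -- This reparametrization is 0 before a' and 1 after b'. It makes the curve constant near its
  -- ends, so that two such curves can be concatenated to a C¹ curve.
  let η (t : ℝ) : ℝ := Real.smoothTransition ((b' - a')⁻¹ * (t - a'))
  have A (t) (ht : t < a') : η t = 0 := by
    simp only [η, Real.smoothTransition.zero_iff_nonpos]
    apply mul_nonpos_of_nonneg_of_nonpos
    · simpa using ha'b'.le
    · linarith
  have A' (t) (ht : t < a') : (γ ∘ η) t = x := by simp [A t ht, hγx]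
  have B (t) (ht : b' < t) : η t = 1 := by
    simp only [η, Real.smoothTransition.eq_one_iff_one_le, inv_mul_eq_div]
    rw [one_le_div₀] <;> linarith
  have B' (t) (ht : b' < t) : (γ ∘ η) t = y := by simp [B t ht, hγy]
  have hηs : ContDiff ℝ 1 η := by fun_prop
  refine ⟨γ ∘ η, A' _ haa', B' _ hb'b, ?_, ?_, ?_, ?_⟩
  · rw [← contMDiffOn_univ]
    apply γ_smooth.comp
    · rw [contMDiffOn_univ, contMDiff_iff_contDiff]
      exact hηs
    · intro t ht
      exact ⟨Real.smoothTransition.nonneg _, Real.smoothTransition.le_one _⟩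
  · convert hγ using 1
    rw [← A a haa', ← B b hb'b]
    apply F.pathLength_comp_of_monotoneOn hab.le
    · apply Monotone.monotoneOn
      apply Real.smoothTransition.monotone.comp
      intro t u htu
      dsimp only
      gcongr
    · exact (hηs.differentiable one_ne_zero).differentiableOn
    · rw [A a haa', B b hb'b]
      apply γ_smooth.mdifferentiableOn one_ne_zero
  · filter_upwards [Iio_mem_nhds haa'] with t ht using A' t ht
  · filter_upwards [Ioi_mem_nhds hb'b] with t ht using B' t ht

theorem edist_triangle (x y z : M) : F.edist x z ≤ F.edist x y + F.edist y z := by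
  apply le_of_forall_gt (fun r hr => ?_)
  rcases ENNReal.exists_add_lt_of_add_lt hr with ⟨u, hu, v, hv, huv⟩
  rcases F.exists_pathLength_lt_of_edist_lt hu zero_lt_one with
    ⟨γ₁, hγ₁0, hγ₁1, hγ₁_smooth, hγ₁, -, hγ₁_const⟩
  rcases F.exists_pathLength_lt_of_edist_lt hv one_lt_two with
    ⟨γ₂, hγ₂1, hγ₂2, hγ₂_smooth, hγ₂, hγ₂_const, -⟩
  let γ := piecewise (Iic 1) γ₁ γ₂
  have : F.edist x z ≤ F.pathLength γ 0 2 := by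
    apply F.edist_le_pathLength
    · apply ContMDiff.contMDiffOn
      exact ContMDiff.piecewise_Iic hγ₁_smooth hγ₂_smooth (hγ₁_const.trans hγ₂_const.symm)
    · simp [γ, hγ₁0]
    · simp [γ, hγ₂2]
    · exact zero_le_two
  apply this.trans_lt (lt_trans ?_ huv)
  rw [← F.pathLength_add zero_le_one one_le_two]
  gcongr
  · convert hγ₁ using 1
    apply F.pathLength_congr_Ioo
    intro t ht
    simp [γ, ht.2.le]
  · convert hγ₂ using 1
    apply F.pathLength_congr_Ioo
    intro t ht
    simp [γ, ht.1]

end FinslerMetric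

end Length

/-! ### Comparison of a Finsler metric with its value at a point -/

section LocalBounds

theorem IsMinkowskiNorm.isAsymmetricNorm {V : Type*} [NormedAddCommGroup V] [NormedSpace ℝ V]
    {F : V → ℝ} (hF : IsMinkowskiNorm F) : IsAsymmetricNorm F :=
  ⟨hF.continuous, hF.pos, hF.homogeneous, hF.add_le⟩

variable {E : Type*} [NormedAddCommGroup E] [NormedSpace ℝ E]

theorem IsAsymmetricNorm.convexOn {p : E → ℝ} (hp : IsAsymmetricNorm p) : ConvexOn ℝ univ p := by
  refine ⟨convex_univ, fun x _ y _ a b ha hb _ => ?_⟩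
  calc p (a • x + b • y) ≤ p (a • x) + p (b • y) := hp.add_le _ _
    _ = a • p x + b • p y := by simp [hp.homogeneous _ _ ha, hp.homogeneous _ _ hb]

/-- The straight segment is the shortest curve for an asymmetric norm. -/
theorem IsAsymmetricNorm.ofReal_le_lintegral [CompleteSpace E] {p : E → ℝ}
    (hp : IsAsymmetricNorm p)
    {u u' : ℝ → E} {T : ℝ} (hT : 0 < T) (hu : ContinuousOn u (Icc 0 T))
    (hd : ∀ t ∈ Ioo 0 T, HasDerivAt u (u' t) t) (hc : ContinuousOn u' (Icc 0 T)) :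
    ENNReal.ofReal (p (u T - u 0)) ≤ ∫⁻ t in Icc 0 T, ENNReal.ofReal (p (u' t)) := by
  have hi : IntegrableOn u' (Icc 0 T) := hc.integrableOn_Icc
  have hpi : IntegrableOn (p ∘ u') (Icc 0 T) :=
    (hp.continuous.comp_continuousOn hc).integrableOn_Icc
  have hftc : ∫ t in Icc 0 T, u' t = u T - u 0 := by
    rw [integral_Icc_eq_integral_Ioc, ← intervalIntegral.integral_of_le hT.le]
    refine intervalIntegral.integral_eq_sub_of_hasDerivAt_of_le hT.le hu hd ?_
    rw [intervalIntegrable_iff_integrableOn_Icc_of_le hT.le]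
    exact hi
  have hne : NeZero (volume.restrict (Icc 0 T)) := ⟨by
    rw [Ne, Measure.restrict_eq_zero, Real.volume_Icc]
    simpa using hT⟩
  -- Jensen's inequality for the average of u' over [0, T]; the integral of u' is u T - u 0.
  have hj := hp.convexOn.map_average_le (μ := volume.restrict (Icc 0 T))
    hp.continuous.continuousOn isClosed_univ (by simp) hi hpi
  have hr : (volume.restrict (Icc 0 T)).real univ = T := by
    simp [measureReal_def, hT.le]
  rw [average_eq, average_eq, hr, hftc, hp.homogeneous _ _ (by positivity), smul_eq_mul] at hj
  have hj' := (mul_le_mul_iff_right₀ (inv_pos.2 hT)).1 hj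
  calc ENNReal.ofReal (p (u T - u 0)) ≤ ENNReal.ofReal (∫ t in Icc 0 T, p (u' t)) :=
        ENNReal.ofReal_le_ofReal hj'
    _ = ∫⁻ t in Icc 0 T, ENNReal.ofReal (p (u' t)) :=
        ofReal_integral_eq_lintegral_ofReal hpi (Filter.Eventually.of_forall fun t => hp.nonneg _)

variable {M : Type*} [TopologicalSpace M] [ChartedSpace E M] [IsManifold 𝓘(ℝ, E) ∞ M]

namespace FinslerMetric

/-- The Minkowski norm on a tangent space, seen as a function on the model space. -/
def fiber (F : FinslerMetric E M) (x : M) (u : E) : ℝ := F ⟨x, u⟩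

theorem isMinkowskiNorm_fiber (F : FinslerMetric E M) (x : M) : IsMinkowskiNorm (F.fiber x) :=
  F.minkowski x

/-- A Finsler metric expressed in the preferred chart at `x₀`. -/
noncomputable def chartRep (F : FinslerMetric E M) (x₀ : M) (p : E × E) : ℝ :=
  F ((chartAt (ModelProd E E) (⟨x₀, 0⟩ : TangentBundle 𝓘(ℝ, E) M)).symm p)

variable (F : FinslerMetric E M) (x₀ : M)

theorem continuousOn_chartRep :
    ContinuousOn (F.chartRep x₀) ((chartAt E x₀).target ×ˢ univ) := by
  refine F.continuous_toFun.comp_continuousOn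
    ((chartAt (ModelProd E E) (⟨x₀, 0⟩ : TangentBundle 𝓘(ℝ, E) M)).continuousOn_symm.mono ?_)
  intro p hp
  exact (TangentBundle.mem_chart_target_iff (I := 𝓘(ℝ, E)) p ⟨x₀, 0⟩).2 hp.1

theorem chartRep_apply {w : TangentBundle 𝓘(ℝ, E) M} (hw : w.1 ∈ (chartAt E x₀).source) :
    F.chartRep x₀ (chartAt E x₀ w.1, mfderiv 𝓘(ℝ, E) 𝓘(ℝ, E) (chartAt E x₀) w.1 w.2) = F w := by
  have : IsManifold 𝓘(ℝ, E) 1 M := IsManifold.of_le (n := ∞) (by simp)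
  have h := tangentMap_chart (I := 𝓘(ℝ, E)) (p := (⟨x₀, 0⟩ : TangentBundle 𝓘(ℝ, E) M)) (q := w) hw
  have h2 : chartAt (ModelProd E E) (⟨x₀, 0⟩ : TangentBundle 𝓘(ℝ, E) M) w =
      (chartAt E x₀ w.1, mfderiv 𝓘(ℝ, E) 𝓘(ℝ, E) (chartAt E x₀) w.1 w.2) :=
    (congrArg (TotalSpace.toProd E E) h).symm
  have h3 := (chartAt (ModelProd E E) (⟨x₀, 0⟩ : TangentBundle 𝓘(ℝ, E) M)).left_inv
    ((TangentBundle.mem_chart_source_iff (I := 𝓘(ℝ, E)) w ⟨x₀, 0⟩).2 hw)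
  rw [h2] at h3
  exact congrArg F.toFun h3

theorem chartRep_self (u : E) : F.chartRep x₀ (chartAt E x₀ x₀, u) = F.fiber x₀ u := by
  have : IsManifold 𝓘(ℝ, E) 1 M := IsManifold.of_le (n := ∞) (by simp)
  have h := F.chartRep_apply x₀ (w := ⟨x₀, u⟩) (mem_chart_source E x₀)
  have h1 := mfderiv_extChartAt_self (I := 𝓘(ℝ, E)) (x := x₀)
  refine Eq.trans ?_ h
  exact congrArg (fun v => F.chartRep x₀ (chartAt E x₀ x₀, v)) (DFunLike.congr_fun h1 u).symm

theorem chartRep_smul {e u : E} (he : e ∈ (chartAt E x₀).target) {c : ℝ} (hc : 0 ≤ c) :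
    F.chartRep x₀ (e, c • u) = c * F.chartRep x₀ (e, u) := by
  have : IsManifold 𝓘(ℝ, E) 1 M := IsManifold.of_le (n := ∞) (by simp)
  have h : ∀ u, F.chartRep x₀ (e, u) = F ⟨(chartAt E x₀).symm e,
      mfderiv 𝓘(ℝ, E) 𝓘(ℝ, E) (chartAt E x₀).symm e u⟩ := fun u =>
    congrArg F.toFun (tangentMap_chart_symm (I := 𝓘(ℝ, E))
      (p := (⟨x₀, 0⟩ : TangentBundle 𝓘(ℝ, E) M)) (q := ⟨e, u⟩) he).symm
  rw [h, h, ← F.map_smul hc]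
  exact congrArg (F.fiber ((chartAt E x₀).symm e)) 
      ((mfderiv 𝓘(ℝ, E) 𝓘(ℝ, E) (chartAt E x₀).symm e).map_smul c u)

theorem velocity_eq_chartRep {γ : ℝ → M} {t : ℝ} (hγ : MDifferentiableAt 𝓘(ℝ, ℝ) 𝓘(ℝ, E) γ t)
    (ht : γ t ∈ (chartAt E x₀).source) :
    F (velocity γ t) = F.chartRep x₀ (chartAt E x₀ (γ t), deriv (chartAt E x₀ ∘ γ) t) := by
  have : IsManifold 𝓘(ℝ, E) 1 M := IsManifold.of_le (n := ∞) (by simp)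
  refine (F.chartRep_apply x₀ (w := velocity γ t) ht).symm.trans ?_
  have h1 := mfderiv_comp (I := 𝓘(ℝ, ℝ)) (I' := 𝓘(ℝ, E)) (I'' := 𝓘(ℝ, E)) t
    (mdifferentiableAt_atlas (I := 𝓘(ℝ, E)) (chart_mem_atlas E x₀) ht) hγ
  rw [mfderiv_eq_fderiv] at h1
  have h2 : deriv (chartAt E x₀ ∘ γ) t =
      mfderiv 𝓘(ℝ, E) 𝓘(ℝ, E) (chartAt E x₀) (γ t) (mfderiv 𝓘(ℝ, ℝ) 𝓘(ℝ, E) γ t (1 : ℝ)) :=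
    (fderiv_apply_one_eq_deriv (f := chartAt E x₀ ∘ γ)).symm.trans (DFunLike.congr_fun h1 (1 : ℝ))
  rw [h2]
  rfl

variable [FiniteDimensional ℝ E]

/-- Near its base point a Finsler metric is close to a constant one. -/
theorem exists_chartRep_close {ε : ℝ} (hε : 0 < ε) :
    ∃ δ > 0, Metric.closedBall (chartAt E x₀ x₀) δ ⊆ (chartAt E x₀).target ∧
      ∀ e ∈ Metric.closedBall (chartAt E x₀ x₀) δ, ∀ u,
        (1 - ε) * F.fiber x₀ u ≤ F.chartRep x₀ (e, u) ∧
          F.chartRep x₀ (e, u) ≤ (1 + ε) * F.fiber x₀ u := by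
  obtain ⟨c, C, hc, hC, hb⟩ := (F.isMinkowskiNorm_fiber x₀).isAsymmetricNorm.exists_bounds
  have hx : chartAt E x₀ x₀ ∈ (chartAt E x₀).target := mem_chart_target E x₀
  -- By homogeneity it suffices to compare on the unit sphere. There F is at least c, so an absolute
  -- error ε c is a relative error ε.
  have h1 : ∀ᶠ e in 𝓝 (chartAt E x₀ x₀), ∀ u ∈ Metric.sphere (0 : E) 1,
      |F.chartRep x₀ (e, u) - F.fiber x₀ u| < ε * c := by
    refine (isCompact_sphere (0 : E) 1).eventually_forall_of_forall_eventually fun u _ => ?_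
    have hcont : ContinuousAt (F.chartRep x₀) (chartAt E x₀ x₀, u) :=
      (F.continuousOn_chartRep x₀).continuousAt
        (prod_mem_nhds ((chartAt E x₀).open_target.mem_nhds hx) Filter.univ_mem)
    have hcont2 : ContinuousAt
        (fun q : E × E => |F.chartRep x₀ (q.1, q.2) - F.fiber x₀ q.2|) (chartAt E x₀ x₀, u) :=
      (hcont.sub ((F.isMinkowskiNorm_fiber x₀).continuous.comp continuous_snd).continuousAt).abs
    refine hcont2.eventually (gt_mem_nhds ?_)
    simp only [F.chartRep_self, sub_self, abs_zero]
    positivity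
  obtain ⟨δ, hδ, hball⟩ := Metric.eventually_nhds_iff_ball.1
    (h1.and ((chartAt E x₀).open_target.mem_nhds hx))
  have hsub : ∀ e ∈ Metric.closedBall (chartAt E x₀ x₀) (δ / 2), e ∈
      Metric.ball (chartAt E x₀ x₀) δ := fun e he =>
    Metric.closedBall_subset_ball (half_lt_self hδ) he
  refine ⟨δ / 2, half_pos hδ, fun e he => (hball e (hsub e he)).2, fun e he u => ?_⟩
  obtain ⟨hs, ht⟩ := hball e (hsub e he)
  rcases eq_or_ne u 0 with rfl | hu
  · have := F.chartRep_smul x₀ ht (u := 0) (c := 0) le_rfl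
    have h0 := (F.isMinkowskiNorm_fiber x₀).map_zero
    rw [zero_smul, zero_mul] at this
    rw [this, h0]
    simp
  have hn : ‖u‖ ≠ 0 := norm_ne_zero_iff.2 hu
  have e1 : u = ‖u‖ • (‖u‖⁻¹ • u) := by rw [smul_smul, mul_inv_cancel₀ hn, one_smul]
  have h2 := hs (‖u‖⁻¹ • u) (by simp [norm_smul, hn])
  have h3 : F.chartRep x₀ (e, u) = ‖u‖ * F.chartRep x₀ (e, ‖u‖⁻¹ • u) := by
    conv_lhs => rw [e1]
    exact F.chartRep_smul x₀ ht (norm_nonneg u)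
  have h4 : F.fiber x₀ u = ‖u‖ * F.fiber x₀ (‖u‖⁻¹ • u) := by
    conv_lhs => rw [e1]
    exact (F.isMinkowskiNorm_fiber x₀).homogeneous _ _ (norm_nonneg u)
  have h5 := (hb u).1
  have h6 : |F.chartRep x₀ (e, u) - F.fiber x₀ u| ≤ ε * F.fiber x₀ u := by
    rw [h3, h4, ← mul_sub, abs_mul, abs_norm, ← h4]
    calc ‖u‖ * |F.chartRep x₀ (e, ‖u‖⁻¹ • u) - F.fiber x₀ (‖u‖⁻¹ • u)| ≤ ‖u‖ * (ε * c) := by gcongr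
      _ = ε * (c * ‖u‖) := by ring
      _ ≤ ε * F.fiber x₀ u := by gcongr
  rw [abs_le] at h6
  constructor <;> linarith [h6.1, h6.2]

end FinslerMetric

end LocalBounds

/-! ### Comparison of the distance with the norm of a tangent space -/

section DistanceBounds

variable {E : Type*} [NormedAddCommGroup E] [NormedSpace ℝ E] [FiniteDimensional ℝ E]
  {M : Type*} [TopologicalSpace M] [ChartedSpace E M] [IsManifold 𝓘(ℝ, E) ∞ M]

namespace FinslerMetric

variable (F : FinslerMetric E M) (x₀ : M)

/-- A straight segment in the chart, which stays in a ball by convexity, is an admissible curve. -/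
theorem exists_edist_le {ε : ℝ} (hε : 0 < ε) :
    ∃ U ∈ 𝓝 x₀, U ⊆ (chartAt E x₀).source ∧ ∀ y ∈ U, ∀ z ∈ U,
      F.edist y z ≤ ENNReal.ofReal ((1 + ε) * F.fiber x₀ (chartAt E x₀ z - chartAt E x₀ y)) := by
  have : IsManifold 𝓘(ℝ, E) 1 M := IsManifold.of_le (n := ∞) (by simp)
  obtain ⟨δ, hδ, hsub, hest⟩ := F.exists_chartRep_close x₀ hε
  set ψ := chartAt E x₀ with hψ
  refine ⟨ψ.source ∩ ψ ⁻¹' Metric.ball (ψ x₀) δ,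
    (ψ.continuousAt (mem_chart_source E x₀)).preimage_mem_nhds (Metric.ball_mem_nhds _ hδ) |>
      Filter.inter_mem (ψ.open_source.mem_nhds (mem_chart_source E x₀)), inter_subset_left, ?_⟩
  rintro y ⟨hys, hyb⟩ z ⟨hzs, hzb⟩
  set ℓ : ℝ → E := fun t => ψ y + t • (ψ z - ψ y) with hℓ
  have hℓs : ContDiff ℝ 1 ℓ := by fun_prop
  have hℓb : ∀ t ∈ Icc (0 : ℝ) 1, ℓ t ∈ Metric.closedBall (ψ x₀) δ := fun t ht =>
    Metric.ball_subset_closedBall ((convex_ball (ψ x₀) δ).add_smul_sub_mem hyb hzb ht)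
  have hγ : ContMDiffOn 𝓘(ℝ, ℝ) 𝓘(ℝ, E) 1 (ψ.symm ∘ ℓ) (Icc 0 1) :=
    (contMDiffOn_chart_symm (I := 𝓘(ℝ, E)) (x := x₀) (n := 1)).comp
      hℓs.contMDiff.contMDiffOn fun t ht => hsub (hℓb t ht)
  have h1 := F.edist_le_pathLength hγ (x := y) (y := z) (by simp [hℓ, hys]) (by simp [hℓ, hzs])
    zero_le_one
  refine h1.trans ?_
  rw [pathLength_eq_lintegral_Ioo]
  calc ∫⁻ t in Ioo (0 : ℝ) 1, ENNReal.ofReal (F (velocity (ψ.symm ∘ ℓ) t))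
      ≤ ∫⁻ t in Ioo (0 : ℝ) 1, ENNReal.ofReal ((1 + ε) * F.fiber x₀ (ψ z - ψ y)) := by
        refine setLIntegral_mono measurable_const fun t ht => ENNReal.ofReal_le_ofReal ?_
        have htI : t ∈ Icc (0 : ℝ) 1 := Ioo_subset_Icc_self ht
        have hmd : MDifferentiableAt 𝓘(ℝ, ℝ) 𝓘(ℝ, E) (ψ.symm ∘ ℓ) t :=
          (hγ.mdifferentiableOn one_ne_zero t htI).mdifferentiableAt (Icc_mem_nhds ht.1 ht.2)
        have hsrc : (ψ.symm ∘ ℓ) t ∈ ψ.source := ψ.map_target (hsub (hℓb t htI))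
        rw [F.velocity_eq_chartRep x₀ hmd hsrc]
        have hev : ψ ∘ (ψ.symm ∘ ℓ) =ᶠ[𝓝 t] ℓ := by
          filter_upwards [Ioo_mem_nhds ht.1 ht.2] with s hs
          exact ψ.right_inv (hsub (hℓb s (Ioo_subset_Icc_self hs)))
        have hd : HasDerivAt ℓ (ψ z - ψ y) t := by
          exact (((hasDerivAt_id t).smul_const (ψ z - ψ y)).const_add (ψ y)).congr_deriv (by simp)
        rw [hev.deriv_eq, hd.deriv]
        refine (hest _ ?_ _).2
        have := hev.self_of_nhds
        rw [Function.comp_apply] at this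
        rw [← hψ, this]
        exact hℓb t htI
    _ = ENNReal.ofReal ((1 + ε) * F.fiber x₀ (ψ z - ψ y)) := by simp

/-- While the curve stays in the chart ball, its length is at least 1 - ε times the length of its
chart image for the constant norm, and straight segments are shortest for the latter. -/
theorem le_pathLength_of_mapsTo {ε δ : ℝ} (hε : ε < 1)
    (hest : ∀ e ∈ Metric.closedBall (chartAt E x₀ x₀) δ, ∀ u,
        (1 - ε) * F.fiber x₀ u ≤ F.chartRep x₀ (e, u))
    {γ : ℝ → M} (hγ : ContMDiff 𝓘(ℝ, ℝ) 𝓘(ℝ, E) 1 γ) (h0 : γ 0 = x₀) {T : ℝ} (hT : 0 < T)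
    (hmaps : ∀ t ∈ Icc 0 T, γ t ∈ (chartAt E x₀).source ∧
      chartAt E x₀ (γ t) ∈ Metric.closedBall (chartAt E x₀ x₀) δ) :
    ENNReal.ofReal ((1 - ε) * F.fiber x₀ (chartAt E x₀ (γ T) - chartAt E x₀ x₀)) ≤
      F.pathLength γ 0 T := by
  have : IsManifold 𝓘(ℝ, E) 1 M := IsManifold.of_le (n := ∞) (by simp)
  set ψ := chartAt E x₀ with hψ
  have hs : ∀ t ∈ Icc 0 T, ContDiffAt ℝ 1 (ψ ∘ γ) t := fun t ht =>
    ((contMDiffOn_chart (I := 𝓘(ℝ, E)) (x := x₀) (n := 1)).contMDiffAt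
      (ψ.open_source.mem_nhds (hmaps t ht).1) |>.comp t hγ.contMDiffAt).contDiffAt
  have hdc : ∀ t ∈ Icc 0 T, ContinuousAt (deriv (ψ ∘ γ)) t := by
    intro t ht
    have h1 := ((hs t ht).fderiv_right (m := 0) (by norm_num)).continuousAt.clm_apply
      (continuousAt_const (y := (1 : ℝ)))
    simpa only [fderiv_apply_one_eq_deriv] using h1
  have h1 := (F.isMinkowskiNorm_fiber x₀).isAsymmetricNorm.ofReal_le_lintegral
    (u := ψ ∘ γ) (u' := deriv (ψ ∘ γ)) hT
    (fun t ht => (hs t ht).continuousAt.continuousWithinAt)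
    (fun t ht => ((hs t (Ioo_subset_Icc_self ht)).differentiableAt one_ne_zero).hasDerivAt)
    (fun t ht => (hdc t ht).continuousWithinAt)
  have hε' : 0 ≤ 1 - ε := by linarith
  rw [ENNReal.ofReal_mul hε']
  simp only [Function.comp_apply, h0] at h1
  calc _ ≤ ENNReal.ofReal (1 - ε) *
        ∫⁻ t in Icc 0 T, ENNReal.ofReal (F.fiber x₀ (deriv (ψ ∘ γ) t)) := by gcongr
    _ = ∫⁻ t in Icc 0 T, ENNReal.ofReal ((1 - ε) * F.fiber x₀ (deriv (ψ ∘ γ) t)) := by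
        rw [← lintegral_const_mul' _ _ ENNReal.ofReal_ne_top]
        simp_rw [ENNReal.ofReal_mul hε']
    _ ≤ F.pathLength γ 0 T := by
        refine setLIntegral_mono' measurableSet_Icc fun t ht => ENNReal.ofReal_le_ofReal ?_
        rw [F.velocity_eq_chartRep x₀ (hγ.mdifferentiable one_ne_zero t) (hmaps t ht).1]
        exact hest _ (hmaps t ht).2 _

/-- Points are either close in a chart, with almost the distance of the tangent space, or far. -/
theorem exists_le_edist [T2Space M] {ε : ℝ} (hε : 0 < ε) (hε1 : ε < 1) :
    ∃ c > 0, ∀ y, (y ∈ (chartAt E x₀).source ∧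
      ENNReal.ofReal ((1 - ε) * F.fiber x₀ (chartAt E x₀ y - chartAt E x₀ x₀)) ≤ F.edist x₀ y) ∨
        ENNReal.ofReal c ≤ F.edist x₀ y := by
  obtain ⟨δ, hδ, hsub, hest⟩ := F.exists_chartRep_close x₀ hε
  obtain ⟨c, C, hc, hC, hb⟩ := (F.isMinkowskiNorm_fiber x₀).isAsymmetricNorm.exists_bounds
  set ψ := chartAt E x₀ with hψ
  set U : Set M := ψ.source ∩ ψ ⁻¹' Metric.ball (ψ x₀) δ with hU
  set A : Set M := ψ.symm '' Metric.closedBall (ψ x₀) δ with hA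
  have hUo : IsOpen U := ψ.isOpen_inter_preimage Metric.isOpen_ball
  have hAc : IsClosed A := ((isCompact_closedBall (ψ x₀) δ).image_of_continuousOn
    (ψ.continuousOn_symm.mono hsub)).isClosed
  have hUA : U ⊆ A := fun y hy => ⟨ψ y, Metric.ball_subset_closedBall hy.2, ψ.left_inv hy.1⟩
  have hAs : ∀ y ∈ A, y ∈ ψ.source ∧ ψ y ∈ Metric.closedBall (ψ x₀) δ := by
    rintro _ ⟨e, he, rfl⟩
    exact ⟨ψ.map_target (hsub he), by rwa [ψ.right_inv (hsub he)]⟩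
  have hx₀U : x₀ ∈ U := ⟨mem_chart_source E x₀, Metric.mem_ball_self hδ⟩
  have hε' : 0 < 1 - ε := by linarith
  have hest' : ∀ e ∈ Metric.closedBall (ψ x₀) δ, ∀ u,
        (1 - ε) * F.fiber x₀ u ≤ F.chartRep x₀ (e, u) := fun e he u => (hest e he u).1
  -- Either the curve stays in U, or it has a first exit time T. By then its chart image has moved
  -- by at least δ, which costs length at least (1 - ε) c δ.
  have key : ∀ γ : ℝ → M, ContMDiff 𝓘(ℝ, ℝ) 𝓘(ℝ, E) 1 γ → γ 0 = x₀ →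
      (γ 1 ∈ ψ.source ∧ ENNReal.ofReal ((1 - ε) * F.fiber x₀ (ψ (γ 1) - ψ x₀)) ≤
        F.pathLength γ 0 1) ∨ ENNReal.ofReal ((1 - ε) * (c * δ)) ≤ F.pathLength γ 0 1 := by
    intro γ hγ h0
    by_cases hstay : ∀ t ∈ Icc (0 : ℝ) 1, γ t ∈ U
    · left
      have h1 := hAs _ (hUA (hstay 1 (by simp)))
      exact ⟨h1.1, F.le_pathLength_of_mapsTo x₀ hε1 hest' hγ h0 one_pos
        fun t ht => hAs _ (hUA (hstay t ht))⟩
    · right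
      push Not at hstay
      obtain ⟨t₁, ht₁, ht₁U⟩ := hstay
      have hK : IsCompact (Icc (0 : ℝ) 1 ∩ γ ⁻¹' Uᶜ) :=
        isCompact_Icc.inter_right (hUo.isClosed_compl.preimage hγ.continuous)
      obtain ⟨T, hT, hTmin⟩ := hK.exists_isLeast ⟨t₁, ht₁, ht₁U⟩
      have hlt : ∀ t ∈ Ico 0 T, γ t ∈ U := by
        intro t ht
        by_contra h
        exact absurd (hTmin ⟨⟨ht.1, ht.2.le.trans hT.1.2⟩, h⟩) (not_le.2 ht.2)
      have hT0 : 0 < T := by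
        rcases hT.1.1.eq_or_lt with h | h
        · exact absurd hx₀U (by rw [← h0, h]; exact hT.2)
        · exact h
      -- A is compact, hence closed in the Hausdorff space M, so the exit point is still in the
      -- chart.
      have hTA : γ T ∈ A := by
        have h1 : T ∈ closure (Ico 0 T) := by
          rw [closure_Ico hT0.ne]; exact ⟨hT0.le, le_rfl⟩
        have h2 := map_mem_closure hγ.continuous h1 (t := A) fun t ht => hUA (hlt t ht)
        rwa [hAc.closure_eq] at h2
      have hmaps : ∀ t ∈ Icc 0 T, γ t ∈ ψ.source ∧ ψ (γ t) ∈ Metric.closedBall (ψ x₀) δ := by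
        intro t ht
        rcases ht.2.eq_or_lt with rfl | h
        · exact hAs _ hTA
        · exact hAs _ (hUA (hlt t ⟨ht.1, h⟩))
      have h3 := F.le_pathLength_of_mapsTo x₀ hε1 hest' hγ h0 hT0 hmaps
      refine le_trans (ENNReal.ofReal_le_ofReal ?_) (h3.trans (F.pathLength_mono le_rfl hT.1.2))
      have h4 : δ ≤ ‖ψ (γ T) - ψ x₀‖ := by
        by_contra h
        apply hT.2
        refine ⟨(hAs _ hTA).1, ?_⟩
        rw [mem_preimage, mem_ball_iff_norm]
        exact not_le.1 h
      gcongr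
      exact le_trans (by gcongr) (hb _).1
  refine ⟨(1 - ε) * (c * δ), by positivity, fun y => ?_⟩
  by_contra hcon
  push Not at hcon
  obtain ⟨h1, h2⟩ := hcon
  by_cases hy : y ∈ ψ.source
  · obtain ⟨γ, hγ0, hγ1, hγ, hlen, -⟩ :=
      F.exists_pathLength_lt_of_edist_lt (lt_min (h1 hy) h2) one_pos
    rcases key γ hγ hγ0 with h | h
    · rw [hγ1] at h
      exact absurd (hlen.trans_le (min_le_left _ _)) (not_lt.2 h.2)
    · exact absurd (hlen.trans_le (min_le_right _ _)) (not_lt.2 h)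
  · obtain ⟨γ, hγ0, hγ1, hγ, hlen, -⟩ := F.exists_pathLength_lt_of_edist_lt h2 one_pos
    rcases key γ hγ hγ0 with h | h
    · rw [hγ1] at h
      exact hy h.1
    · exact absurd hlen (not_lt.2 h)

/-- Convergence for the distance implies convergence. -/
theorem tendsto_of_tendsto_edist [T2Space M] {ι : Type*} {l : Filter ι} {y : ι → M}
    (h : Filter.Tendsto (fun i => F.edist x₀ (y i)) l (𝓝 0)) : Filter.Tendsto y l (𝓝 x₀) := by
  obtain ⟨a, C, ha, hC, hb⟩ := (F.isMinkowskiNorm_fiber x₀).isAsymmetricNorm.exists_bounds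
  obtain ⟨c, hc, hy⟩ := F.exists_le_edist x₀ (ε := 1 / 2) (by norm_num) (by norm_num)
  set ψ := chartAt E x₀ with hψ
  have h1 : ∀ᶠ i in l, y i ∈ ψ.source ∧
      ENNReal.ofReal ((1 - 1 / 2) * F.fiber x₀ (ψ (y i) - ψ x₀)) ≤ F.edist x₀ (y i) := by
    filter_upwards [h.eventually (gt_mem_nhds (ENNReal.ofReal_pos.2 hc))] with i hi
    exact (hy (y i)).resolve_right (not_le.2 hi)
  have h2 : Filter.Tendsto (fun i => ψ (y i)) l (𝓝 (ψ x₀)) := by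
    rw [Metric.tendsto_nhds]
    intro r hr
    filter_upwards [h1, h.eventually (gt_mem_nhds (ENNReal.ofReal_pos.2
      (show 0 < (1 - 1 / 2) * (a * r) by norm_num; positivity)))] with i hi hi'
    have h3 := hi.2.trans_lt hi'
    rw [ENNReal.ofReal_lt_ofReal_iff (by norm_num; positivity)] at h3
    have h4 := (hb (ψ (y i) - ψ x₀)).1
    rw [dist_eq_norm]
    have h5 : a * ‖ψ (y i) - ψ x₀‖ < a * r := by linarith
    exact lt_of_mul_lt_mul_left h5 ha.le
  have h3 := (ψ.continuousAt_symm (mem_chart_target E x₀)).tendsto.comp h2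
  rw [ψ.left_inv (mem_chart_source E x₀)] at h3
  refine h3.congr' ?_
  filter_upwards [h1] with i hi
  exact ψ.left_inv hi.1

/-- The distance to a point tends to zero near it. -/
theorem tendsto_edist_nhds : Filter.Tendsto (fun y => F.edist y x₀) (𝓝 x₀) (𝓝 0) := by
  obtain ⟨U, hU, hUs, hle⟩ := F.exists_edist_le x₀ one_pos
  have h1 : Filter.Tendsto (fun y => ENNReal.ofReal
      ((1 + 1) * F.fiber x₀ (chartAt E x₀ x₀ - chartAt E x₀ y))) (𝓝 x₀) (𝓝 0) := by
    have hc : ContinuousAt (fun y => ENNReal.ofReal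
        ((1 + 1) * F.fiber x₀ (chartAt E x₀ x₀ - chartAt E x₀ y))) x₀ := by
      refine ENNReal.continuous_ofReal.continuousAt.comp ?_
      refine continuousAt_const.mul ?_
      exact (F.isMinkowskiNorm_fiber x₀).continuous.continuousAt.comp
        (continuousAt_const.sub ((chartAt E x₀).continuousAt (mem_chart_source E x₀)))
    have := hc.tendsto
    simpa [(F.isMinkowskiNorm_fiber x₀).map_zero] using this
  refine tendsto_of_tendsto_of_tendsto_of_le_of_le' tendsto_const_nhds h1
    (Filter.Eventually.of_forall fun _ => zero_le) ?_
  filter_upwards [hU] with y hy using hle y hy x₀ (mem_of_mem_nhds hU)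

end FinslerMetric

end DistanceBounds

/-! ### Derivatives read in the model spaces -/

section TangentDerivative

variable {E : Type*} [NormedAddCommGroup E] [NormedSpace ℝ E]
  {M : Type*} [TopologicalSpace M] [ChartedSpace E M]
  {E' : Type*} [NormedAddCommGroup E'] [NormedSpace ℝ E']
  {N : Type*} [TopologicalSpace N] [ChartedSpace E' N]
  {E'' : Type*} [NormedAddCommGroup E''] [NormedSpace ℝ E'']
  {P : Type*} [TopologicalSpace P] [ChartedSpace E'' P]

/-- The derivative of a map between manifolds, as a map between the model spaces. -/
noncomputable def tderiv (f : M → N) (x : M) : E →L[ℝ] E' := mfderiv 𝓘(ℝ, E) 𝓘(ℝ, E') f x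

theorem tderiv_comp {g : N → P} {f : M → N} (x : M) (hg : MDifferentiableAt 𝓘(ℝ, E') 𝓘(ℝ, E'') g (f x))
    (hf : MDifferentiableAt 𝓘(ℝ, E) 𝓘(ℝ, E') f x) :
    (tderiv (g ∘ f) x : E →L[ℝ] E'') = (tderiv g (f x) : E' →L[ℝ] E'').comp (tderiv f x) :=
  mfderiv_comp x hg hf

theorem tderiv_comp_apply {g : N → P} {f : M → N} (x : M)
    (hg : MDifferentiableAt 𝓘(ℝ, E') 𝓘(ℝ, E'') g (f x))
    (hf : MDifferentiableAt 𝓘(ℝ, E) 𝓘(ℝ, E') f x) (v : E) :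
    (tderiv (fun y => g (f y)) x : E →L[ℝ] E'') v =
      (tderiv g (f x) : E' →L[ℝ] E'') ((tderiv f x : E →L[ℝ] E') v) :=
  DFunLike.congr_fun (tderiv_comp x hg hf) v

theorem tderiv_id (x : M) : (tderiv (fun y : M => y) x : E →L[ℝ] E) = ContinuousLinearMap.id ℝ E :=
  mfderiv_id

theorem tderiv_congr {f g : M → N} {x : M} (h : f =ᶠ[𝓝 x] g) :
    (tderiv f x : E →L[ℝ] E') = tderiv g x :=
  h.mfderiv_eq

/-- A point of the tangent bundle given by a point and an element of the model space. -/
def tmk (x : M) (v : E) : TangentBundle 𝓘(ℝ, E) M := ⟨x, v⟩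

theorem tangentMap_eq (f : M → N) (v : TangentBundle 𝓘(ℝ, E) M) :
    tangentMap 𝓘(ℝ, E) 𝓘(ℝ, E') f v = tmk (f v.1) ((tderiv f v.1 : E →L[ℝ] E') v.2) := rfl

theorem velocity_eq (γ : ℝ → M) (t : ℝ) :
    (velocity γ t : TangentBundle 𝓘(ℝ, E) M) = tmk (γ t) ((tderiv γ t : ℝ →L[ℝ] E) 1) := rfl

theorem velocity_comp {f : M → N} {γ : ℝ → M} {t : ℝ}
    (hf : MDifferentiableAt 𝓘(ℝ, E) 𝓘(ℝ, E') f (γ t))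
    (hγ : MDifferentiableAt 𝓘(ℝ, ℝ) 𝓘(ℝ, E) γ t) :
    (velocity (f ∘ γ) t : TangentBundle 𝓘(ℝ, E') N) =
      tangentMap 𝓘(ℝ, E) 𝓘(ℝ, E') f (velocity γ t) := by
  rw [velocity_eq, tderiv_comp t hf hγ]
  rfl

end TangentDerivative

/-! ### Left trivialization and adjoint representation -/

section LieGroup

variable {E : Type*} [NormedAddCommGroup E] [NormedSpace ℝ E]
  {G : Type*} [TopologicalSpace G] [ChartedSpace E G] [Group G]

/-- The adjoint representation. -/
noncomputable def adjointAction (k : G) : E →L[ℝ] E := tderiv (fun x : G => k * x * k⁻¹) 1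

/-- The left trivialization of the tangent bundle of a Lie group. -/
noncomputable def leftTriv (v : TangentBundle 𝓘(ℝ, E) G) : E :=
  (tderiv (fun x => v.1⁻¹ * x) v.1 : E →L[ℝ] E) v.2

theorem tderiv_one_mul (x : G) (v : E) : (tderiv (fun y : G => 1 * y) x : E →L[ℝ] E) v = v := by
  simp only [one_mul, tderiv_id, ContinuousLinearMap.id_apply]

theorem adjointAction_one (w : E) : adjointAction (1 : G) w = w := by
  unfold adjointAction
  simp only [one_mul, inv_one, mul_one, tderiv_id, ContinuousLinearMap.id_apply]

variable [LieGroup 𝓘(ℝ, E) ∞ G]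

theorem mdifferentiable_leftMul (g : G) : MDifferentiable 𝓘(ℝ, E) 𝓘(ℝ, E) (fun x : G => g * x) :=
  (contMDiff_mul_left (I := 𝓘(ℝ, E)) (n := ∞) (a := g)).mdifferentiable (by simp)

theorem mdifferentiable_rightMul (g : G) : MDifferentiable 𝓘(ℝ, E) 𝓘(ℝ, E) (fun x : G => x * g) :=
  (contMDiff_mul_right (I := 𝓘(ℝ, E)) (n := ∞) (a := g)).mdifferentiable (by simp)

theorem mdifferentiable_conj (g h : G) :
    MDifferentiable 𝓘(ℝ, E) 𝓘(ℝ, E) (fun x : G => g * x * h) :=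
  (mdifferentiable_rightMul (E := E) h).comp (mdifferentiable_leftMul (E := E) g)

variable (E) in
theorem tderiv_mul_left_mul_left (g h x : G) (v : E) :
    (tderiv (fun y : G => g * y) (h * x) : E →L[ℝ] E) ((tderiv (fun y : G => h * y) x : E →L[ℝ] E) v)
      = (tderiv (fun y : G => g * h * y) x : E →L[ℝ] E) v := by
  rw [← tderiv_comp_apply x (mdifferentiable_leftMul g _) (mdifferentiable_leftMul h _)]
  simp only [mul_assoc]

theorem leftTriv_tmk_mul (g : G) (w : E) :
    leftTriv (tmk g ((tderiv (fun y : G => g * y) 1 : E →L[ℝ] E) w)) = w := by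
  have h := tderiv_mul_left_mul_left E g⁻¹ g 1 w
  rw [mul_one, inv_mul_cancel, tderiv_one_mul] at h
  exact h

theorem tderiv_mul_leftTriv (v : TangentBundle 𝓘(ℝ, E) G) :
    (tderiv (fun y : G => v.1 * y) 1 : E →L[ℝ] E) (leftTriv v) = v.2 := by
  have h := tderiv_mul_left_mul_left E v.1 v.1⁻¹ v.1 v.2
  rw [inv_mul_cancel, mul_inv_cancel] at h
  exact h.trans (tderiv_one_mul (E := E) v.1 v.2)

theorem leftTriv_mul_left (g : G) (v : TangentBundle 𝓘(ℝ, E) G) :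
    leftTriv (tangentMap 𝓘(ℝ, E) 𝓘(ℝ, E) (fun x => g * x) v) = leftTriv v := by
  have h := tderiv_mul_left_mul_left E (g * v.1)⁻¹ g v.1 v.2
  rw [mul_inv_rev, inv_mul_cancel_right] at h
  rw [tangentMap_eq]
  unfold leftTriv tmk
  rw [mul_inv_rev]
  exact h

/-- The adjoint action appears because (gk)⁻¹(xk) = k⁻¹(g⁻¹x)k. -/
theorem leftTriv_mul_right (k : G) (v : TangentBundle 𝓘(ℝ, E) G) :
    leftTriv (tangentMap 𝓘(ℝ, E) 𝓘(ℝ, E) (fun x => x * k) v) = adjointAction k⁻¹ (leftTriv v) := by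
  have h1 := tderiv_comp_apply (E := E) (E' := E) (E'' := E) v.1 (g := fun x => (v.1 * k)⁻¹ * x)
    (f := fun x => x * k) (mdifferentiable_leftMul _ _) (mdifferentiable_rightMul k _) v.2
  have h2 := tderiv_comp_apply (E := E) (E' := E) (E'' := E) v.1 (g := fun x => k⁻¹ * x * k⁻¹⁻¹)
    (f := fun x => v.1⁻¹ * x) (mdifferentiable_conj _ _ _) (mdifferentiable_leftMul _ _) v.2
  rw [inv_mul_cancel] at h2
  rw [tangentMap_eq]
  refine h1.symm.trans (Eq.trans ?_ h2)
  congr 2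
  ext x
  group

theorem adjointAction_mul (g h : G) (w : E) :
    adjointAction (g * h) w = adjointAction g (adjointAction h w) := by
  have h1 := tderiv_comp_apply (E := E) (E' := E) (E'' := E) (1 : G) (g := fun x => g * x * g⁻¹)
    (f := fun x => h * x * h⁻¹) (mdifferentiable_conj _ _ _) (mdifferentiable_conj _ _ _) w
  rw [mul_one, mul_inv_cancel] at h1
  refine Eq.trans ?_ h1
  unfold adjointAction
  congr 2
  ext x
  group

theorem adjointAction_inv_apply (g : G) (w : E) :
    adjointAction g⁻¹ (adjointAction g w) = w := by
  rw [← adjointAction_mul, inv_mul_cancel, adjointAction_one]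

theorem adjointAction_apply_inv (g : G) (w : E) :
    adjointAction g (adjointAction g⁻¹ w) = w := by
  rw [← adjointAction_mul, mul_inv_cancel, adjointAction_one]

/-- The left trivialization as a linear equivalence on each tangent space. -/
noncomputable def leftTrivEquiv (E : Type*) [NormedAddCommGroup E] [NormedSpace ℝ E]
    {G : Type*} [TopologicalSpace G] [ChartedSpace E G] [Group G] [LieGroup 𝓘(ℝ, E) ∞ G] (g : G) :
    E ≃L[ℝ] E :=
  ContinuousLinearEquiv.equivOfInverse (tderiv (fun x => g⁻¹ * x) g)
    (tderiv (fun x => g * x) 1) (fun v => tderiv_mul_leftTriv (tmk g v))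
    (fun w => leftTriv_tmk_mul g w)

/-- The tangent map of the multiplication is smooth. -/
theorem contMDiff_tangent_mul :
    ContMDiff (𝓘(ℝ, E).tangent.prod 𝓘(ℝ, E).tangent) 𝓘(ℝ, E).tangent ∞
      (fun p : TangentBundle 𝓘(ℝ, E) G × TangentBundle 𝓘(ℝ, E) G =>
        (tmk (p.1.1 * p.2.1) ((tderiv (fun x => x * p.2.1) p.1.1 : E →L[ℝ] E) p.1.2 +
          (tderiv (fun x => p.1.1 * x) p.2.1 : E →L[ℝ] E) p.2.2) : TangentBundle 𝓘(ℝ, E) G)) := by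
  have : IsManifold 𝓘(ℝ, E) 1 G := IsManifold.of_le (n := ∞) (by simp)
  have e1 : ((⊤ : ℕ∞) : ℕ∞ω) + 1 = ((⊤ : ℕ∞) : ℕ∞ω) := rfl
  let F₂ : (TangentBundle 𝓘(ℝ, E) G × TangentBundle 𝓘(ℝ, E) G) →
    TangentBundle (𝓘(ℝ, E).prod 𝓘(ℝ, E)) (G × G) := (equivTangentBundleProd 𝓘(ℝ, E) G 𝓘(ℝ, E) G).symm
  have S₂ : ContMDiff (𝓘(ℝ, E).tangent.prod 𝓘(ℝ, E).tangent) (𝓘(ℝ, E).prod 𝓘(ℝ, E)).tangent ∞ F₂ :=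
    contMDiff_equivTangentBundleProd_symm
  have S₃ : ContMDiff (𝓘(ℝ, E).prod 𝓘(ℝ, E)).tangent 𝓘(ℝ, E).tangent ∞
      (tangentMap (𝓘(ℝ, E).prod 𝓘(ℝ, E)) 𝓘(ℝ, E) (fun p : G × G => p.1 * p.2)) :=
    (contMDiff_mul 𝓘(ℝ, E) ∞).contMDiff_tangentMap e1.le
  refine (S₃.comp S₂).congr fun p => ?_
  have h := mfderiv_prod_eq_add_apply (I := 𝓘(ℝ, E)) (I' := 𝓘(ℝ, E)) (I'' := 𝓘(ℝ, E))
    (f := fun p : G × G => p.1 * p.2) (p := (p.1.1, p.2.1))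
    (((contMDiff_mul 𝓘(ℝ, E) ∞).mdifferentiable (by simp)) _) (v := ((p.1.2 : E), (p.2.2 : E)))
  exact (congrArg (tmk (E := E) (p.1.1 * p.2.1)) h).symm

/-- Over its own base point the preferred trivialization is the identity, so the fibre coordinate is
f itself. -/
theorem contMDiff_of_contMDiff_tmk {M : Type*} [TopologicalSpace M] [ChartedSpace E M]
    [IsManifold 𝓘(ℝ, E) ∞ M] {E₀ : Type*} [NormedAddCommGroup E₀] [NormedSpace ℝ E₀]
    {H₀ : Type*} [TopologicalSpace H₀] {I₀ : ModelWithCorners ℝ E₀ H₀} {N : Type*}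
    [TopologicalSpace N] [ChartedSpace H₀ N] {f : N → E} (x : M)
    (hf : ContMDiff I₀ 𝓘(ℝ, E).tangent ∞ (fun y => (tmk x (f y) : TangentBundle 𝓘(ℝ, E) M))) :
    ContMDiff I₀ 𝓘(ℝ, E) ∞ f := by
  have : IsManifold 𝓘(ℝ, E) 1 M := IsManifold.of_le (n := ∞) (by simp)
  intro v
  have h := (contMDiffAt_totalSpace.1 (hf v)).2
  refine h.congr_of_eventuallyEq (Filter.Eventually.of_forall fun w => ?_)
  exact (tangentBundleCore 𝓘(ℝ, E) M).coordChange_self (achart E x) x (mem_chart_source E x)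
    (f w) |>.symm

theorem contMDiff_tmk_zero (M : Type*) [TopologicalSpace M] [ChartedSpace E M]
    [IsManifold 𝓘(ℝ, E) ∞ M] :
    ContMDiff 𝓘(ℝ, E) 𝓘(ℝ, E).tangent ∞
      (fun x : M => (tmk x (0 : E) : TangentBundle 𝓘(ℝ, E) M)) := by
  have : IsManifold 𝓘(ℝ, E) 1 M := IsManifold.of_le (n := ∞) (by simp)
  exact contMDiff_zeroSection ℝ (TangentSpace 𝓘(ℝ, E) : M → Type _)

/-- For v over g, the left trivialization is the product, under the tangent map of multiplication,
of the zero vector at g⁻¹ and v. It therefore inherits smoothness from multiplication and inversion.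
-/
theorem contMDiff_leftTriv :
    ContMDiff 𝓘(ℝ, E).tangent 𝓘(ℝ, E) ∞ (leftTriv : TangentBundle 𝓘(ℝ, E) G → E) := by
  have : IsManifold 𝓘(ℝ, E) 1 G := IsManifold.of_le (n := ∞) (by simp)
  refine contMDiff_of_contMDiff_tmk (1 : G) ?_
  have sproj : ContMDiff 𝓘(ℝ, E).tangent 𝓘(ℝ, E) ∞ (fun v : TangentBundle 𝓘(ℝ, E) G => v.1) :=
    contMDiff_proj _
  have S := contMDiff_tangent_mul.comp
    (((contMDiff_tmk_zero G).comp ((contMDiff_inv 𝓘(ℝ, E) ∞).comp sproj)).prodMk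
      (contMDiff_id (I := 𝓘(ℝ, E).tangent) (M := TangentBundle 𝓘(ℝ, E) G) (n := ∞)))
  refine S.congr fun v => ?_
  have h5 : (tderiv (fun z : G => z * v.1) v.1⁻¹ : E →L[ℝ] E) 0 + leftTriv v = leftTriv v := by
    rw [map_zero, zero_add]
  have h4 : tmk (v.1⁻¹ * v.1) (leftTriv v) = tmk 1 (leftTriv v) := by rw [inv_mul_cancel v.1]
  exact h4.symm.trans (congrArg (tmk (E := E) (v.1⁻¹ * v.1)) h5.symm)

/-- Ad(g) w is the left trivialization of the product of w at the identity with the zero vector at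
g⁻¹. -/
theorem contMDiff_adjointAction (w : E) :
    ContMDiff 𝓘(ℝ, E) 𝓘(ℝ, E) ∞ (fun g : G => adjointAction g w) := by
  have S := contMDiff_leftTriv.comp (contMDiff_tangent_mul.comp
    ((contMDiff_const (I := 𝓘(ℝ, E)) (M := G) (c := (tmk 1 w : TangentBundle 𝓘(ℝ, E) G))).prodMk
      ((contMDiff_tmk_zero G).comp (contMDiff_inv 𝓘(ℝ, E) ∞))))
  refine S.congr fun g => ?_
  have h := leftTriv_mul_right g⁻¹ (tmk (1 : G) w)
  have h1 : leftTriv (tmk (1 : G) w) = w := by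
    have := leftTriv_tmk_mul (1 : G) w
    rwa [tderiv_one_mul] at this
  rw [h1, inv_inv] at h
  refine h.symm.trans ?_
  have h5 : (tderiv (fun z : G => z * g⁻¹) 1 : E →L[ℝ] E) w +
      (tderiv (fun z : G => 1 * z) g⁻¹ : E →L[ℝ] E) 0 =
      (tderiv (fun z : G => z * g⁻¹) 1 : E →L[ℝ] E) w := by
    rw [map_zero, add_zero]
  exact congrArg (fun v => leftTriv (tmk (1 * g⁻¹) v)) h5.symm

end LieGroup

/-! ### The commutator formula in coordinates -/

section Calculus

variable {E : Type*} [NormedAddCommGroup E] [NormedSpace ℝ E]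

/-- The commutator formula for the derivative of the conjugation in a local group. -/
theorem fderiv_apply_eq_sub_of_fderiv_eq {m : E × E → E} {b : E} (hm : ContDiffAt ℝ 2 m (b, b))
    (h1 : ∀ᶠ y in 𝓝 b, m (y, b) = y) {A : E → E} {v w : E} (hA : DifferentiableAt ℝ A b)
    (hAb : A b = w)
    (h : ∀ᶠ y in 𝓝 b, fderiv ℝ m (y, b) (0, w) = fderiv ℝ m (b, y) (A y, 0)) :
    fderiv ℝ A b v = fderiv ℝ (fun y => fderiv ℝ m (y, b) (0, w)) b v -
      fderiv ℝ (fun y => fderiv ℝ m (y, b) (0, v)) b w := by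
  have hm1 : ContDiffAt ℝ 1 (fderiv ℝ m) (b, b) := hm.fderiv_right (by norm_num)
  have hD : HasFDerivAt (fderiv ℝ m) (fderiv ℝ (fderiv ℝ m) (b, b)) (b, b) :=
    (hm1.differentiableAt (by norm_num)).hasFDerivAt
  have hsymm : IsSymmSndFDerivAt ℝ m (b, b) :=
    hm.isSymmSndFDerivAt (by simp)
  have hl : HasFDerivAt (fun y : E => (y, b)) (ContinuousLinearMap.inl ℝ E E) b :=
    hasFDerivAt_prodMk_left b b
  have hr : HasFDerivAt (fun y : E => (b, y)) (ContinuousLinearMap.inr ℝ E E) b :=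
    hasFDerivAt_prodMk_right b b
  have hL : ∀ u v : E, fderiv ℝ (fun y => fderiv ℝ m (y, b) (0, u)) b v =
      fderiv ℝ (fderiv ℝ m) (b, b) (v, 0) (0, u) := fun u v => by
    have h2 : HasFDerivAt (fun y => fderiv ℝ m (y, b) (0, u)) _ b :=
      (HasFDerivAt.comp (f := fun y : E => (y, b)) b hD hl).clm_apply
        (hasFDerivAt_const ((0 : E), u) b)
    rw [HasFDerivAt.fderiv h2]
    simp
  have hR : fderiv ℝ (fun y => fderiv ℝ m (b, y) (A y, 0)) b v =
      fderiv ℝ (fderiv ℝ m) (b, b) (0, v) (w, 0) + fderiv ℝ m (b, b) (fderiv ℝ A b v, 0) := by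
    have h2 : HasFDerivAt (fun y => fderiv ℝ m (b, y) (A y, 0)) _ b :=
      (HasFDerivAt.comp (f := fun y : E => (b, y)) b hD hr).clm_apply
        (HasFDerivAt.prodMk hA.hasFDerivAt (hasFDerivAt_const (0 : E) b))
    rw [HasFDerivAt.fderiv h2]
    simp [hAb, add_comm]
  have hid : ∀ u, fderiv ℝ m (b, b) (u, 0) = u := fun u => by
    have h2 := HasFDerivAt.comp (f := fun y : E => (y, b)) b (hm.differentiableAt (by norm_num)).hasFDerivAt hl
    have h3 : (m ∘ fun y => (y, b)) =ᶠ[𝓝 b] id := h1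
    have h4 := h2.unique ((hasFDerivAt_id b).congr_of_eventuallyEq h3)
    simpa using DFunLike.congr_fun h4 u
  -- Differentiate the hypothesis at b in the direction v. The derivative of A appears undisturbed
  -- since m(·, b) is the identity near b, and the symmetry of the second derivative of m turns the
  -- remaining mixed term into the derivative of the second field.
  have h5 := Filter.EventuallyEq.fderiv_eq (𝕜 := ℝ) h
  have h6 : fderiv ℝ (fun y => fderiv ℝ m (y, b) (0, w)) b v =
      fderiv ℝ (fun y => fderiv ℝ m (b, y) (A y, 0)) b v := by rw [h5]
  rw [h6, hL, hR, hid, hsymm.eq (w, 0) (0, v)]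
  abel

end Calculus

/-! ### The Lie bracket in the chart at the identity -/

section Bracket

variable {E : Type*} [NormedAddCommGroup E] [NormedSpace ℝ E]
  {G : Type*} [TopologicalSpace G] [ChartedSpace E G] [Group G] [LieGroup 𝓘(ℝ, E) ∞ G]

variable (E G) in
/-- The multiplication of a Lie group in the preferred chart at the identity. -/
noncomputable def chartMul (p : E × E) : E :=
  chartAt E (1 : G) ((chartAt E (1 : G)).symm p.1 * (chartAt E (1 : G)).symm p.2)

variable (E G) in
theorem contDiffAt_chartMul :
    ContDiffAt ℝ ∞ (chartMul E G) (chartAt E (1 : G) 1, chartAt E (1 : G) 1) := by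
  rw [← contMDiffAt_iff_contDiffAt]
  have : IsManifold 𝓘(ℝ, E) ∞ G := inferInstance
  have hs : ContMDiffAt 𝓘(ℝ, E) 𝓘(ℝ, E) ∞ (chartAt E (1 : G)).symm (chartAt E (1 : G) 1) :=
    contMDiffOn_chart_symm.contMDiffAt ((chartAt E (1 : G)).open_target.mem_nhds (mem_chart_target E 1))
  have hc : ContMDiffAt 𝓘(ℝ, E) 𝓘(ℝ, E) ∞ (chartAt E (1 : G))
      ((chartAt E (1 : G)).symm (chartAt E (1 : G) 1) *
        (chartAt E (1 : G)).symm (chartAt E (1 : G) 1)) := by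
    rw [(chartAt E (1 : G)).left_inv (mem_chart_source E 1), one_mul]
    exact contMDiffOn_chart.contMDiffAt ((chartAt E (1 : G)).open_source.mem_nhds (mem_chart_source E 1))
  have h1 : ContMDiffAt 𝓘(ℝ, E × E) 𝓘(ℝ, E) ∞ (fun p : E × E => (chartAt E (1 : G)).symm p.1)
      (chartAt E (1 : G) 1, chartAt E (1 : G) 1) :=
    ContMDiffAt.comp (g := (chartAt E (1 : G)).symm) (f := Prod.fst) _ hs contDiff_fst.contMDiff.contMDiffAt
  have h2 : ContMDiffAt 𝓘(ℝ, E × E) 𝓘(ℝ, E) ∞ (fun p : E × E => (chartAt E (1 : G)).symm p.2)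
      (chartAt E (1 : G) 1, chartAt E (1 : G) 1) :=
    ContMDiffAt.comp (g := (chartAt E (1 : G)).symm) (f := Prod.snd) _ hs contDiff_snd.contMDiff.contMDiffAt
  exact ContMDiffAt.comp (g := chartAt E (1 : G)) _ hc (h1.mul h2)

theorem tderiv_chartAt_self {M : Type*} [TopologicalSpace M] [ChartedSpace E M]
    [IsManifold 𝓘(ℝ, E) ∞ M] (x : M) (v : E) : (tderiv (chartAt E x) x : E →L[ℝ] E) v = v := by
  have : IsManifold 𝓘(ℝ, E) 1 M := IsManifold.of_le (n := ∞) (by simp)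
  exact DFunLike.congr_fun (mfderiv_extChartAt_self (I := 𝓘(ℝ, E)) (x := x)) v

theorem mdifferentiableAt_chartAt {M : Type*} [TopologicalSpace M] [ChartedSpace E M]
    [IsManifold 𝓘(ℝ, E) ∞ M] (x : M) {y : M} (hy : y ∈ (chartAt E x).source) :
    MDifferentiableAt 𝓘(ℝ, E) 𝓘(ℝ, E) (chartAt E x) y := by
  have : IsManifold 𝓘(ℝ, E) 1 M := IsManifold.of_le (n := ∞) (by simp)
  exact mdifferentiableAt_atlas (chart_mem_atlas E x) hy

theorem mdifferentiableAt_chartAt_symm {M : Type*} [TopologicalSpace M] [ChartedSpace E M]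
    [IsManifold 𝓘(ℝ, E) ∞ M] (x : M) {y : E} (hy : y ∈ (chartAt E x).target) :
    MDifferentiableAt 𝓘(ℝ, E) 𝓘(ℝ, E) (chartAt E x).symm y := by
  have : IsManifold 𝓘(ℝ, E) 1 M := IsManifold.of_le (n := ∞) (by simp)
  exact mdifferentiableAt_atlas_symm (chart_mem_atlas E x) hy

theorem tderiv_chartAt_comp_symm {M : Type*} [TopologicalSpace M] [ChartedSpace E M]
    [IsManifold 𝓘(ℝ, E) ∞ M] (x : M) {y : E} (hy : y ∈ (chartAt E x).target) (v : E) :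
    (tderiv (chartAt E x) ((chartAt E x).symm y) : E →L[ℝ] E)
      ((tderiv (chartAt E x).symm y : E →L[ℝ] E) v) = v := by
  rw [← tderiv_comp_apply y (mdifferentiableAt_chartAt x ((chartAt E x).map_target hy))
    (mdifferentiableAt_chartAt_symm x hy)]
  have h : (fun z => chartAt E x ((chartAt E x).symm z)) =ᶠ[𝓝 y] fun z => z := by
    filter_upwards [(chartAt E x).open_target.mem_nhds hy] with z hz
    exact (chartAt E x).right_inv hz
  rw [tderiv_congr h, tderiv_id]
  rfl

theorem tderiv_chartAt_symm_comp {M : Type*} [TopologicalSpace M] [ChartedSpace E M]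
    [IsManifold 𝓘(ℝ, E) ∞ M] (x : M) {y : M} (hy : y ∈ (chartAt E x).source) (v : E) :
    (tderiv (chartAt E x).symm (chartAt E x y) : E →L[ℝ] E)
      ((tderiv (chartAt E x) y : E →L[ℝ] E) v) = v := by
  rw [← tderiv_comp_apply y (mdifferentiableAt_chartAt_symm x ((chartAt E x).map_source hy))
    (mdifferentiableAt_chartAt x hy)]
  have h : (fun z => (chartAt E x).symm (chartAt E x z)) =ᶠ[𝓝 y] fun z => z := by
    filter_upwards [(chartAt E x).open_source.mem_nhds hy] with z hz
    exact (chartAt E x).left_inv hz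
  rw [tderiv_congr h, tderiv_id]
  rfl

theorem tderiv_chartAt_symm_self {M : Type*} [TopologicalSpace M] [ChartedSpace E M]
    [IsManifold 𝓘(ℝ, E) ∞ M] (x : M) (v : E) :
    (tderiv (chartAt E x).symm (chartAt E x x) : E →L[ℝ] E) v = v := by
  have h := tderiv_chartAt_symm_comp x (mem_chart_source E x) v
  rwa [tderiv_chartAt_self] at h

variable (E G) in
theorem eventually_fderiv_chartMul :
    ∀ᶠ y in 𝓝 (chartAt E (1 : G) 1), y ∈ (chartAt E (1 : G)).target ∧
      (∀ w, fderiv ℝ (chartMul E G) (y, chartAt E (1 : G) 1) (0, w) =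
        (tderiv (chartAt E (1 : G)) ((chartAt E (1 : G)).symm y) : E →L[ℝ] E)
          ((tderiv (fun x => (chartAt E (1 : G)).symm y * x) 1 : E →L[ℝ] E) w)) ∧
      (∀ w, fderiv ℝ (chartMul E G) (chartAt E (1 : G) 1, y) (w, 0) =
        (tderiv (chartAt E (1 : G)) ((chartAt E (1 : G)).symm y) : E →L[ℝ] E)
          ((tderiv (fun x => x * (chartAt E (1 : G)).symm y) 1 : E →L[ℝ] E) w)) := by
  have hd : ∀ᶠ p in 𝓝 (chartAt E (1 : G) 1, chartAt E (1 : G) 1),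
      DifferentiableAt ℝ (chartMul E G) p := by
    filter_upwards [((contDiffAt_chartMul E G).of_le (m := 1) (by simp)).eventually (by simp)]
      with p hp using hp.differentiableAt (by simp)
  have hb := mem_chart_target E (1 : G)
  have hbs : (chartAt E (1 : G)).symm (chartAt E (1 : G) 1) = 1 :=
    (chartAt E (1 : G)).left_inv (mem_chart_source E 1)
  have hl : ContinuousAt (fun y : E => (y, chartAt E (1 : G) 1)) (chartAt E (1 : G) 1) := by fun_prop
  have hr : ContinuousAt (fun y : E => (chartAt E (1 : G) 1, y)) (chartAt E (1 : G) 1) := by fun_prop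
  filter_upwards [(chartAt E (1 : G)).open_target.mem_nhds hb, hl.eventually hd, hr.eventually hd]
    with y hy hdl hdr
  have hys := (chartAt E (1 : G)).map_target hy
  refine ⟨hy, fun w => ?_, fun w => ?_⟩
  · have h1 : fderiv ℝ (chartMul E G) (y, chartAt E (1 : G) 1) (0, w) =
        fderiv ℝ (fun z => chartMul E G (y, z)) (chartAt E (1 : G) 1) w := by
      have h2 := HasFDerivAt.comp (f := fun z : E => (y, z)) (chartAt E (1 : G) 1) hdl.hasFDerivAt
        (hasFDerivAt_prodMk_right y (chartAt E (1 : G) 1))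
      have h3 := h2.fderiv
      exact (DFunLike.congr_fun h3 w).symm
    rw [h1, ← mfderiv_eq_fderiv]
    set g := (chartAt E (1 : G)).symm y
    have hg : g * (chartAt E (1 : G)).symm (chartAt E (1 : G) 1) = g := by rw [hbs, mul_one]
    have h4 := tderiv_comp_apply (E := E) (E' := E) (E'' := E) (chartAt E (1 : G) 1)
      (g := fun x : G => g * x) (f := (chartAt E (1 : G)).symm) (mdifferentiable_leftMul g _)
      (mdifferentiableAt_chartAt_symm 1 hb) w
    have h5 := tderiv_comp_apply (E := E) (E' := E) (E'' := E) (chartAt E (1 : G) 1)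
      (g := chartAt E (1 : G)) (f := fun x => g * (chartAt E (1 : G)).symm x)
      (mdifferentiableAt_chartAt 1 (by rw [hg]; exact hys))
      ((mdifferentiable_leftMul g _).comp _ (mdifferentiableAt_chartAt_symm 1 hb)) w
    rw [h4, tderiv_chartAt_symm_self, hg, hbs] at h5
    exact h5
  · have h1 : fderiv ℝ (chartMul E G) (chartAt E (1 : G) 1, y) (w, 0) =
        fderiv ℝ (fun z => chartMul E G (z, y)) (chartAt E (1 : G) 1) w := by
      have h2 := HasFDerivAt.comp (f := fun z : E => (z, y)) (chartAt E (1 : G) 1) hdr.hasFDerivAt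
        (hasFDerivAt_prodMk_left (chartAt E (1 : G) 1) y)
      have h3 := h2.fderiv
      exact (DFunLike.congr_fun h3 w).symm
    rw [h1, ← mfderiv_eq_fderiv]
    set g := (chartAt E (1 : G)).symm y
    have hg : (chartAt E (1 : G)).symm (chartAt E (1 : G) 1) * g = g := by rw [hbs, one_mul]
    have h4 := tderiv_comp_apply (E := E) (E' := E) (E'' := E) (chartAt E (1 : G) 1)
      (g := fun x : G => x * g) (f := (chartAt E (1 : G)).symm) (mdifferentiable_rightMul g _)
      (mdifferentiableAt_chartAt_symm 1 hb) w
    have h5 := tderiv_comp_apply (E := E) (E' := E) (E'' := E) (chartAt E (1 : G) 1)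
      (g := chartAt E (1 : G)) (f := fun x => (chartAt E (1 : G)).symm x * g)
      (mdifferentiableAt_chartAt 1 (by rw [hg]; exact hys))
      ((mdifferentiable_rightMul g _).comp _ (mdifferentiableAt_chartAt_symm 1 hb)) w
    rw [h4, tderiv_chartAt_symm_self, hg, hbs] at h5
    exact h5

theorem tderiv_mul_right_adjointAction (g : G) (w : E) :
    (tderiv (fun x : G => x * g) 1 : E →L[ℝ] E) (adjointAction g w) =
      (tderiv (fun x : G => g * x) 1 : E →L[ℝ] E) w := by
  have h := tderiv_comp_apply (E := E) (E' := E) (E'' := E) (1 : G)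
      (g := fun x : G => x * g) (f := fun x => g * x * g⁻¹) (mdifferentiable_rightMul g _)
      (mdifferentiable_conj _ _ _) w
  rw [mul_one, mul_inv_cancel] at h
  refine h.symm.trans ?_
  simp only [inv_mul_cancel_right]

open VectorField in
variable (G) in
/-- A left-invariant vector field in the preferred chart at the identity. -/
noncomputable def chartInvariantField (u : E) : E → E :=
  mpullbackWithin 𝓘(ℝ, E) 𝓘(ℝ, E) (extChartAt 𝓘(ℝ, E) (1 : G)).symm
    (mulInvariantVectorField (I := 𝓘(ℝ, E)) (G := G) u) (range 𝓘(ℝ, E))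

/-- The partial derivative of the multiplication in its second argument at the identity is the
differential of a left translation. -/
theorem eventually_chartInvariantField (u : E) :
    chartInvariantField G u =ᶠ[𝓝 (chartAt E (1 : G) 1)]
      fun y => fderiv ℝ (chartMul E G) (y, chartAt E (1 : G) 1) (0, u) := by
  filter_upwards [eventually_fderiv_chartMul E G] with y hy
  rw [hy.2.1]
  have hys := (chartAt E (1 : G)).map_target hy.1
  have h1 : ContinuousLinearMap.inverse (tderiv (chartAt E (1 : G)).symm y : E →L[ℝ] E) =
      tderiv (chartAt E (1 : G)) ((chartAt E (1 : G)).symm y) := by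
    refine ContinuousLinearMap.inverse_eq ?_ ?_
    · ext v
      have := tderiv_chartAt_symm_comp (E := E) (1 : G) hys v
      rwa [(chartAt E (1 : G)).right_inv hy.1] at this
    · ext v
      exact tderiv_chartAt_comp_symm (E := E) (1 : G) hy.1 v
  rw [← h1]
  have h2 : (mfderivWithin 𝓘(ℝ, E) 𝓘(ℝ, E) (extChartAt 𝓘(ℝ, E) (1 : G)).symm (range 𝓘(ℝ, E)) y :
      E →L[ℝ] E) = tderiv (E := E) (E' := E) (chartAt E (1 : G)).symm y := by
    have : range 𝓘(ℝ, E) = (univ : Set E) := range_id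
    rw [this, mfderivWithin_univ]
    rfl
  have h3 := congrArg (fun L : E →L[ℝ] E => ContinuousLinearMap.inverse L
    ((tderiv (fun x => (chartAt E (1 : G)).symm y * x) 1 : E →L[ℝ] E) u)) h2
  exact h3

open VectorField in
variable (G) in
/-- The bracket of the Lie algebra is a bracket of vector fields in the preferred chart. -/
theorem bracket_eq_fderiv_chartMul (v w : E) :
    @Bracket.bracket (GroupLieAlgebra 𝓘(ℝ, E) G) (GroupLieAlgebra 𝓘(ℝ, E) G) _ v w =
      fderiv ℝ (fun y => fderiv ℝ (chartMul E G) (y, chartAt E (1 : G) 1) (0, w))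
        (chartAt E (1 : G) 1) v -
      fderiv ℝ (fun y => fderiv ℝ (chartMul E G) (y, chartAt E (1 : G) 1) (0, v))
        (chartAt E (1 : G) 1) w := by
  have hv := eventually_chartInvariantField (G := G) v
  have hw := eventually_chartInvariantField (G := G) w
  have hS : ((extChartAt 𝓘(ℝ, E) (1 : G)).symm ⁻¹' univ ∩ range 𝓘(ℝ, E)) = (univ : Set E) := by
    simp
  have h1 : (mfderiv 𝓘(ℝ, E) 𝓘(ℝ, E) (extChartAt 𝓘(ℝ, E) (1 : G)) 1 : E →L[ℝ] E) =
      ContinuousLinearMap.id ℝ E := by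
    ext x
    exact tderiv_chartAt_self (E := E) (1 : G) x
  have hb : ∀ u : E, fderiv ℝ (chartMul E G) (chartAt E (1 : G) 1, chartAt E (1 : G) 1) (0, u) = u := by
    intro u
    have h := (eventually_fderiv_chartMul E G).self_of_nhds.2.1 u
    rw [(chartAt E (1 : G)).left_inv (mem_chart_source E 1)] at h
    rw [h, tderiv_one_mul, tderiv_chartAt_self]
  have h2 : lieBracketWithin ℝ
      (chartInvariantField G v) (chartInvariantField G w)
      ((extChartAt 𝓘(ℝ, E) (1 : G)).symm ⁻¹' univ ∩ range 𝓘(ℝ, E)) (chartAt E (1 : G) 1) =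
      fderiv ℝ (fun y => fderiv ℝ (chartMul E G) (y, chartAt E (1 : G) 1) (0, w))
        (chartAt E (1 : G) 1) v -
      fderiv ℝ (fun y => fderiv ℝ (chartMul E G) (y, chartAt E (1 : G) 1) (0, v))
        (chartAt E (1 : G) 1) w := by
    rw [hS, lieBracketWithin_univ, hv.lieBracket_vectorField_eq hw, lieBracket_eq]
    simp only [hb]
  exact (congrArg (fun L : E →L[ℝ] E => ContinuousLinearMap.inverse L _) h1).trans
    ((DFunLike.congr_fun ContinuousLinearMap.inverse_id _).trans h2)

end Bracket

/-! ### From ad-skew to Ad-invariant inner products -/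

section Invariance

variable {E : Type*} [NormedAddCommGroup E] [NormedSpace ℝ E]

theorem tderiv_comp_chartAt_symm {M : Type*} [TopologicalSpace M] [ChartedSpace E M]
    [IsManifold 𝓘(ℝ, E) ∞ M] {E' : Type*} [NormedAddCommGroup E'] [NormedSpace ℝ E']
    {f : M → E'} {x : M} {y : E} (hy : y ∈ (chartAt E x).target)
    (hf : MDifferentiableAt 𝓘(ℝ, E) 𝓘(ℝ, E') f ((chartAt E x).symm y)) (v : E) :
    fderiv ℝ (fun z => f ((chartAt E x).symm z)) y v =
      (tderiv f ((chartAt E x).symm y) : E →L[ℝ] E')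
        ((tderiv (chartAt E x).symm y : E →L[ℝ] E) v) := by
  have h := tderiv_comp_apply (E := E) (E' := E) (E'' := E') y hf
    (mdifferentiableAt_chartAt_symm x hy) v
  rw [← h, tderiv, mfderiv_eq_fderiv]

theorem eventually_eq_of_fderiv_eq_zero {M : Type*} [TopologicalSpace M] [ChartedSpace E M]
    [IsManifold 𝓘(ℝ, E) ∞ M] {E' : Type*} [NormedAddCommGroup E'] [NormedSpace ℝ E']
    {f : M → E'} {x : M}
    (h : ∀ᶠ y in 𝓝 x, MDifferentiableAt 𝓘(ℝ, E) 𝓘(ℝ, E') f y ∧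
      ∀ v, (tderiv f y : E →L[ℝ] E') v = 0) : ∀ᶠ y in 𝓝 x, f y = f x := by
  have hs := (chartAt E x).left_inv (mem_chart_source E x)
  have hcs : ContinuousAt (chartAt E x).symm (chartAt E x x) :=
    (chartAt E x).continuousAt_symm (mem_chart_target E x)
  rw [← hs] at h
  obtain ⟨r, hr, hb⟩ := Metric.eventually_nhds_iff_ball.1
    ((hcs.eventually h).and ((chartAt E x).open_target.mem_nhds (mem_chart_target E x)))
  have hc : ∀ᶠ y in 𝓝 x, chartAt E x y ∈ Metric.ball (chartAt E x x) r :=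
    ((chartAt E x).continuousAt (mem_chart_source E x)).eventually (Metric.ball_mem_nhds _ hr)
  have hd : DifferentiableOn ℝ (fun z => f ((chartAt E x).symm z))
      (Metric.ball (chartAt E x x) r) := fun z hz =>
    (((hb z hz).1.1.comp z
      (mdifferentiableAt_chartAt_symm x (hb z hz).2)).differentiableAt).differentiableWithinAt
  filter_upwards [hc, (chartAt E x).open_source.mem_nhds (mem_chart_source E x)] with y hy hys
  have := Metric.isOpen_ball.is_const_of_fderiv_eq_zero
    (convex_ball (chartAt E x x) r).isPreconnected hd
    (fun z hz => by
      ext v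
      rw [tderiv_comp_chartAt_symm (hb z hz).2 (hb z hz).1.1, (hb z hz).1.2]
      rfl) hy (Metric.mem_ball_self hr)
  simpa only [(chartAt E x).left_inv hys, hs] using this

/-- A map between manifolds with vanishing derivative is locally constant. -/
theorem eventually_eq_of_tderiv_eq_zero {M : Type*} [TopologicalSpace M] [ChartedSpace E M]
    [IsManifold 𝓘(ℝ, E) ∞ M] {E' : Type*} [NormedAddCommGroup E'] [NormedSpace ℝ E']
    {N : Type*} [TopologicalSpace N] [ChartedSpace E' N] [IsManifold 𝓘(ℝ, E') ∞ N]
    {f : M → N} {x : M}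
    (h : ∀ᶠ y in 𝓝 x, MDifferentiableAt 𝓘(ℝ, E) 𝓘(ℝ, E') f y ∧
      ∀ v, (tderiv f y : E →L[ℝ] E') v = 0) : ∀ᶠ y in 𝓝 x, f y = f x := by
  have h1 : ∀ᶠ y in 𝓝 x, f y ∈ (chartAt E' (f x)).source :=
    h.self_of_nhds.1.continuousAt.eventually
      ((chartAt E' (f x)).open_source.mem_nhds (mem_chart_source E' (f x)))
  have h2 : ∀ᶠ y in 𝓝 x, chartAt E' (f x) (f y) = chartAt E' (f x) (f x) := by
    refine eventually_eq_of_fderiv_eq_zero (E := E) (f := fun y => chartAt E' (f x) (f y)) ?_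
    filter_upwards [h, h1] with y hy hy1
    refine ⟨(mdifferentiableAt_chartAt _ hy1).comp y hy.1, fun v => ?_⟩
    rw [tderiv_comp_apply y (mdifferentiableAt_chartAt _ hy1) hy.1, hy.2, map_zero]
  filter_upwards [h1, h2] with y hy1 hy2
  exact (chartAt E' (f x)).injOn hy1 (mem_chart_source E' (f x)) hy2

variable {G : Type*} [TopologicalSpace G] [ChartedSpace E G] [Group G] [LieGroup 𝓘(ℝ, E) ∞ G]

/-- The differential of the adjoint representation is the bracket. -/
theorem tderiv_adjointAction (v w : E) :
    (tderiv (fun g : G => adjointAction g w) 1 : E →L[ℝ] E) v =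
      @Bracket.bracket (GroupLieAlgebra 𝓘(ℝ, E) G) (GroupLieAlgebra 𝓘(ℝ, E) G) _ v w := by
  have hb := mem_chart_target E (1 : G)
  have hbs : (chartAt E (1 : G)).symm (chartAt E (1 : G) 1) = 1 :=
    (chartAt E (1 : G)).left_inv (mem_chart_source E 1)
  have hA : MDifferentiable 𝓘(ℝ, E) 𝓘(ℝ, E) (fun g : G => adjointAction g w) :=
    (contMDiff_adjointAction w).mdifferentiable (by simp)
  have h1 := tderiv_comp_chartAt_symm (x := (1 : G)) hb (hA _) v
  rw [hbs, tderiv_chartAt_symm_self] at h1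
  have h2 := eventually_fderiv_chartMul E G
  refine h1.symm.trans (Eq.trans ?_ (bracket_eq_fderiv_chartMul G v w).symm)
  -- The commutator formula is applied to g ↦ Ad(g) w in the chart. Its last hypothesis says that
  -- right translation of Ad(g) w to g agrees with left translation of w.
  refine fderiv_apply_eq_sub_of_fderiv_eq ((contDiffAt_chartMul E G).of_le two_le_infty) ?_ ?_ ?_ ?_
  · filter_upwards [(chartAt E (1 : G)).open_target.mem_nhds hb] with y hy
    rw [chartMul, hbs, mul_one, (chartAt E (1 : G)).right_inv hy]
  · exact ((hA _).comp _ (mdifferentiableAt_chartAt_symm (1 : G) hb)).differentiableAt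
  · simp only [hbs, adjointAction_one]
  · filter_upwards [h2] with y hy
    rw [hy.2.1, hy.2.2, tderiv_mul_right_adjointAction]

/-- An inner product on the Lie algebra for which the adjoint maps are skew-symmetric is invariant
under the adjoint action of a connected group. -/
theorem apply_adjointAction_of_skew [FiniteDimensional ℝ E] [ConnectedSpace G]
    (B : LinearMap.BilinForm ℝ (GroupLieAlgebra 𝓘(ℝ, E) G))
    (hB : ∀ x y z : GroupLieAlgebra 𝓘(ℝ, E) G, B ⁅x, y⁆ z + B y ⁅x, z⁆ = 0) (g : G) (x y : E) :
    B (adjointAction (E := E) g x) (adjointAction (E := E) g y) = B x y := by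
  let B' : E →L[ℝ] E →L[ℝ] ℝ :=
    LinearMap.toContinuousBilinearMap (show E →ₗ[ℝ] E →ₗ[ℝ] ℝ from B)
  have hA : ∀ w : E, MDifferentiable 𝓘(ℝ, E) 𝓘(ℝ, E) (fun g : G => adjointAction g w) := fun w =>
    (contMDiff_adjointAction w).mdifferentiable (by simp)
  have hpair : ∀ x y : E, MDifferentiable 𝓘(ℝ, E) 𝓘(ℝ, E × E)
      (fun g : G => (adjointAction g x, adjointAction g y)) := fun x y =>
    ((contMDiff_adjointAction x).prodMk_space (contMDiff_adjointAction y)).mdifferentiable (by simp)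
  have hBb : IsBoundedBilinearMap ℝ fun p : E × E => B' p.1 p.2 := B'.isBoundedBilinearMap
  have hBd : MDifferentiable 𝓘(ℝ, E × E) 𝓘(ℝ, ℝ) (fun p : E × E => B' p.1 p.2) := fun p =>
    (hBb.differentiableAt p).mdifferentiableAt
  have hf : ∀ x y : E, MDifferentiable 𝓘(ℝ, E) 𝓘(ℝ, ℝ)
      (fun g : G => B' (adjointAction g x) (adjointAction g y)) := fun x y g =>
    MDifferentiableAt.comp (g := fun p : E × E => B' p.1 p.2) g (hBd _) (hpair x y g)
  -- At the identity the derivative in the direction v is B([v, x], y) + B(x, [v, y]), which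
  -- vanishes by skew-symmetry.
  have h1 : ∀ x y v : E,
      (tderiv (fun g : G => B' (adjointAction g x) (adjointAction g y)) 1 : E →L[ℝ] ℝ) v = 0 := by
    intro x y v
    have hb := mem_chart_target E (1 : G)
    have hbs : (chartAt E (1 : G)).symm (chartAt E (1 : G) 1) = 1 :=
      (chartAt E (1 : G)).left_inv (mem_chart_source E 1)
    have hder : ∀ w : E, HasFDerivAt (fun z => adjointAction ((chartAt E (1 : G)).symm z) w)
        (tderiv (fun g : G => adjointAction g w) 1 : E →L[ℝ] E) (chartAt E (1 : G) 1) := by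
      intro w
      have := ((hA w _).comp _ (mdifferentiableAt_chartAt_symm (1 : G) hb)).differentiableAt
      refine this.hasFDerivAt.congr_fderiv ?_
      ext u
      have h2 := tderiv_comp_chartAt_symm (x := (1 : G)) hb (hA w _) u
      rw [hbs, tderiv_chartAt_symm_self] at h2
      exact h2
    have h3 := HasFDerivAt.clm_apply (B'.hasFDerivAt.comp _ (hder x)) (hder y)
    have h4 := tderiv_comp_chartAt_symm (x := (1 : G)) hb (hf x y _) v
    rw [hbs, tderiv_chartAt_symm_self] at h4
    have h5 := h3.fderiv
    rw [← h4]
    refine (DFunLike.congr_fun h5 v).trans ?_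
    have h6 := hB v x y
    have h7 : B' ((tderiv (fun g : G => adjointAction g x) 1 : E →L[ℝ] E) v) y +
        B' x ((tderiv (fun g : G => adjointAction g y) 1 : E →L[ℝ] E) v) = 0 := by
      rw [tderiv_adjointAction, tderiv_adjointAction]
      exact h6
    simp only [hbs, adjointAction_one, add_apply,
      ContinuousLinearMap.comp_apply, ContinuousLinearMap.flip_apply, Function.comp_apply]
    rw [add_comm]
    exact h7
  have h2 : ∀ x y : E, ∀ g : G,
      (tderiv (fun g : G => B' (adjointAction g x) (adjointAction g y)) g : E →L[ℝ] ℝ) = 0 := by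
    intro x y g
    -- Right translation moves the derivative at g to the identity, at the price of replacing x and
    -- y by Ad(g) x and Ad(g) y.
    have h3 : (fun h : G => B' (adjointAction h x) (adjointAction h y)) = fun h =>
        (fun k : G => B' (adjointAction k (adjointAction g x)) (adjointAction k (adjointAction g y)))
          (h * g⁻¹) := by
      ext h
      simp only [← adjointAction_mul, inv_mul_cancel_right]
    ext v
    rw [h3]
    rw [tderiv_comp_apply g (hf _ _ _) (mdifferentiable_rightMul g⁻¹ g), mul_inv_cancel, h1]
    rfl
  have h3 := ((IsLocallyConstant.iff_eventually_eq _).2 fun g₀ : G => eventually_eq_of_tderiv_eq_zero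
    (x := g₀) (Filter.Eventually.of_forall
      fun g => ⟨hf x y g, fun v => by rw [h2 x y g]; rfl⟩)).apply_eq_of_preconnectedSpace g 1
  simp only [adjointAction_one] at h3
  exact h3

end Invariance

/-! ### Lifts and sections of submersions -/

section Submersion

variable {E : Type*} [NormedAddCommGroup E] [NormedSpace ℝ E]
  {M : Type*} [TopologicalSpace M] [ChartedSpace E M]
  {E' : Type*} [NormedAddCommGroup E'] [NormedSpace ℝ E']
  {N : Type*} [TopologicalSpace N] [ChartedSpace E' N]

theorem Manifold.IsSubmersionAt.codChart_apply_eq {p : M → N} {x : M}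
    (hp : Manifold.IsSubmersionAt 𝓘(ℝ, E) 𝓘(ℝ, E') ∞ p x) (z : E) (hz : z ∈ hp.domChart.target) :
    hp.codChart (p (hp.domChart.symm z)) = (hp.equiv z).1 :=
  hp.writtenInCharts (show z ∈ (hp.domChart.extend 𝓘(ℝ, E)).target by simpa using hz)

/-- Curves can be lifted along submersions, with a prescribed initial velocity. More generally any
`C^1` map from a normed space can be lifted. -/
theorem Manifold.IsSubmersionAt.exists_lift {X : Type*} [NormedAddCommGroup X] [NormedSpace ℝ X]
    {p : M → N} {x : M} (hp : Manifold.IsSubmersionAt 𝓘(ℝ, E) 𝓘(ℝ, E') ∞ p x)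
    {f : X → N} {t : X} (hf : ContMDiffAt 𝓘(ℝ, X) 𝓘(ℝ, E') 1 f t) (hft : f t = p x)
    (L : X →L[ℝ] E)
    (hL : ∀ u, (tderiv p x : E →L[ℝ] E') (L u) = (tderiv f t : X →L[ℝ] E') u) :
    ∃ c : X → M, c t = x ∧ ContMDiffAt 𝓘(ℝ, X) 𝓘(ℝ, E) 1 c t ∧
      (∀ u, (tderiv c t : X →L[ℝ] E) u = L u) ∧ ∀ᶠ s in 𝓝 t, p (c s) = f s := by
  have hw := hp.codChart_apply_eq
  have hsub := hp.source_subset_preimage_source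
  have hxs := hp.mem_domChart_source
  have hys := hp.mem_codChart_source
  have hxt := hp.domChart.map_source hxs
  have hDs : ContMDiffAt 𝓘(ℝ, E) 𝓘(ℝ, E) ∞ hp.domChart.symm (hp.domChart x) :=
    (contMDiffOn_symm_of_mem_maximalAtlas hp.domChart_mem_maximalAtlas).contMDiffAt
      (hp.domChart.open_target.mem_nhds hxt)
  have hD : ContMDiffAt 𝓘(ℝ, E) 𝓘(ℝ, E) ∞ hp.domChart x :=
    (contMDiffOn_of_mem_maximalAtlas hp.domChart_mem_maximalAtlas).contMDiffAt
      (hp.domChart.open_source.mem_nhds hxs)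
  have hC : ContMDiffAt 𝓘(ℝ, E') 𝓘(ℝ, E') ∞ hp.codChart (p x) :=
    (contMDiffOn_of_mem_maximalAtlas hp.codChart_mem_maximalAtlas).contMDiffAt
      (hp.codChart.open_source.mem_nhds hys)
  rw [← hft] at hC
  have hDd := hD.mdifferentiableAt (by simp)
  have hCf : ContMDiffAt 𝓘(ℝ, X) 𝓘(ℝ, E') 1 (fun s => hp.codChart (f s)) t :=
    (hC.of_le (by simp)).comp t hf
  let D' : E →L[ℝ] E := tderiv hp.domChart x
  let K : X →L[ℝ] hp.complement :=
    (ContinuousLinearMap.snd ℝ E' hp.complement).comp ((hp.equiv : E →L[ℝ] _).comp (D'.comp L))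
  -- In submersion charts p is the first projection. The first coordinate of the lift is dictated by
  -- f; the complementary one is affine, with slope prescribed by L.
  let ψ : X → E := fun s =>
    hp.equiv.symm (hp.codChart (f s), (hp.equiv (hp.domChart x)).2 + K (s - t))
  have hCp : ∀ v : E, (tderiv hp.codChart (f t) : E' →L[ℝ] E') ((tderiv p x : E →L[ℝ] E') v) =
      (hp.equiv (D' v)).1 := by
    intro v
    rw [hft] at hC ⊢
    rw [← tderiv_comp_apply x (hC.mdifferentiableAt (by simp))
      (hp.contMDiffAt.mdifferentiableAt (by simp))]
    have h1 : (fun y => hp.codChart (p y)) =ᶠ[𝓝 x] fun y => (hp.equiv (hp.domChart y)).1 := by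
      filter_upwards [hp.domChart.open_source.mem_nhds hxs] with y hy
      rw [← hw _ (hp.domChart.map_source hy), hp.domChart.left_inv hy]
    rw [tderiv_congr h1]
    have h2 : MDifferentiableAt 𝓘(ℝ, E) 𝓘(ℝ, E') (fun z => (hp.equiv z).1) (hp.domChart x) :=
      (((ContinuousLinearMap.fst ℝ E' hp.complement).comp
        (hp.equiv : E →L[ℝ] E' × hp.complement)).differentiableAt).mdifferentiableAt
    rw [tderiv_comp_apply x h2 hDd, tderiv, mfderiv_eq_fderiv]
    have h3 := ((ContinuousLinearMap.fst ℝ E' hp.complement).comp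
      (hp.equiv : E →L[ℝ] E' × hp.complement)).fderiv (x := hp.domChart x)
    exact DFunLike.congr_fun h3 (D' v)
  have hψt : ψ t = hp.domChart x := by
    have h := hw _ (hp.domChart.map_source hxs)
    rw [hp.domChart.left_inv hxs, ← hft] at h
    simp only [ψ, h, sub_self, map_zero, add_zero]
    exact hp.equiv.symm_apply_apply _
  have hψ : ContMDiffAt 𝓘(ℝ, X) 𝓘(ℝ, E) 1 ψ t := by
    have h1 := hCf.contDiffAt
    refine ContDiffAt.contMDiffAt ?_
    fun_prop
  have hψ' : ∀ u, (tderiv ψ t : X →L[ℝ] E) u = D' (L u) := by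
    intro u
    have h1 := (hCf.contDiffAt.differentiableAt (by simp)).hasFDerivAt
    have h2 : HasFDerivAt (fun s => (hp.equiv (hp.domChart x)).2 + K (s - t)) K t := by
      have := (K.hasFDerivAt (x := t - t)).comp (f := fun s => s - t) t ((hasFDerivAt_id t).sub_const t)
      exact (this.const_add _).congr_fderiv (by ext; rfl)
    have h3 := (hp.equiv.symm : E' × hp.complement →L[ℝ] E).hasFDerivAt.comp t (h1.prodMk h2)
    have h4 : (tderiv ψ t : X →L[ℝ] E) u = fderiv ℝ ψ t u := by
      rw [tderiv, mfderiv_eq_fderiv]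
    have h5 : fderiv ℝ (fun s => hp.codChart (f s)) t u =
        (tderiv (fun s => hp.codChart (f s)) t : X →L[ℝ] E') u := by
      rw [tderiv, mfderiv_eq_fderiv]
    rw [h4]
    refine (DFunLike.congr_fun h3.fderiv u).trans ?_
    have h6 : fderiv ℝ (fun s => hp.codChart (f s)) t u = (hp.equiv (D' (L u))).1 := by
      rw [h5, tderiv_comp_apply t (hC.mdifferentiableAt (by simp))
        (hf.mdifferentiableAt (by simp)), ← hL, hCp]
    change hp.equiv.symm (fderiv ℝ (fun s => hp.codChart (f s)) t u, (hp.equiv (D' (L u))).2) = _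
    rw [h6]
    exact hp.equiv.symm_apply_apply _
  refine ⟨fun s => hp.domChart.symm (ψ s), ?_, ?_, fun u => ?_, ?_⟩
  · beta_reduce
    rw [hψt, hp.domChart.left_inv hxs]
  · refine ContMDiffAt.comp (g := hp.domChart.symm) t ?_ hψ
    rw [hψt]
    exact hDs.of_le (by simp)
  · rw [tderiv_comp_apply t (by rw [hψt]; exact hDs.mdifferentiableAt (by simp))
      (hψ.mdifferentiableAt (by simp)), hψ', hψt,
      ← tderiv_comp_apply x (hDs.mdifferentiableAt (by simp)) hDd]
    have h : (fun z => hp.domChart.symm (hp.domChart z)) =ᶠ[𝓝 x] fun z => z := by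
      filter_upwards [hp.domChart.open_source.mem_nhds hxs] with z hz
      exact hp.domChart.left_inv hz
    rw [tderiv_congr h, tderiv_id]
    rfl
  · have h1 := hψ.continuousAt.eventually (p := fun z => z ∈ hp.domChart.target) (by
      rw [hψt]
      exact hp.domChart.open_target.mem_nhds hxt)
    have h0 := hf.continuousAt.eventually (p := fun z => z ∈ hp.codChart.source) (by
      rw [hft]
      exact hp.codChart.open_source.mem_nhds hys)
    filter_upwards [h1, h0] with y hy hy2
    have h2 := hw _ hy
    rw [hp.equiv.apply_symm_apply] at h2
    exact hp.codChart.injOn (hsub (hp.domChart.map_target hy)) hy2 h2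

/-- A submersion has local smooth sections. -/
theorem Manifold.IsSubmersionAt.exists_section {p : M → N} {x : M}
    (hp : Manifold.IsSubmersionAt 𝓘(ℝ, E) 𝓘(ℝ, E') ∞ p x) :
    ∃ (σ : N → M) (U : Set N), IsOpen U ∧ p x ∈ U ∧ σ (p x) = x ∧
      ContMDiffOn 𝓘(ℝ, E') 𝓘(ℝ, E) ∞ σ U ∧ ∀ y ∈ U, p (σ y) = y := by
  have hw := hp.codChart_apply_eq
  have hsub := hp.source_subset_preimage_source
  have hxs := hp.mem_domChart_source
  have hys := hp.mem_codChart_source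
  have hD : ContMDiffOn 𝓘(ℝ, E) 𝓘(ℝ, E) ∞ hp.domChart.symm hp.domChart.target :=
    contMDiffOn_symm_of_mem_maximalAtlas hp.domChart_mem_maximalAtlas
  have hC : ContMDiffOn 𝓘(ℝ, E') 𝓘(ℝ, E') ∞ hp.codChart hp.codChart.source :=
    contMDiffOn_of_mem_maximalAtlas hp.codChart_mem_maximalAtlas
  have hx0 : hp.equiv.symm (hp.codChart (p x), (hp.equiv (hp.domChart x)).2) = hp.domChart x := by
    have h := hw _ (hp.domChart.map_source hxs)
    rw [hp.domChart.left_inv hxs] at h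
    rw [h]
    exact hp.equiv.symm_apply_apply _
  let φ : N → E := fun y => hp.equiv.symm (hp.codChart y, (hp.equiv (hp.domChart x)).2)
  have hφ : ContMDiffOn 𝓘(ℝ, E') 𝓘(ℝ, E) ∞ φ hp.codChart.source := by
    have h1 : ContDiff ℝ ∞ (fun y : E' => hp.equiv.symm (y, (hp.equiv (hp.domChart x)).2)) := by
      fun_prop
    exact h1.contMDiff.comp_contMDiffOn hC
  refine ⟨fun y => hp.domChart.symm (φ y), hp.codChart.source ∩ φ ⁻¹' hp.domChart.target,
    hφ.continuousOn.isOpen_inter_preimage hp.codChart.open_source hp.domChart.open_target,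
    ⟨hys, ?_⟩, ?_, ?_, fun y hy => ?_⟩
  · rw [mem_preimage, show φ (p x) = _ from hx0]
    exact hp.domChart.map_source hxs
  · beta_reduce
    rw [show φ (p x) = _ from hx0, hp.domChart.left_inv hxs]
  · exact hD.comp (hφ.mono inter_subset_left) (fun y hy => hy.2)
  · have h2 := hw _ hy.2
    rw [hp.equiv.apply_symm_apply] at h2
    exact hp.codChart.injOn (hsub (hp.domChart.map_target hy.2)) hy.1 h2

end Submersion

/-! ### The coset space and its fundamental vector fields -/

section Coset

theorem QuotientGroup.mk_mul_eq_smul {G : Type*} [Group G] {H : Subgroup G} (g x : G) :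
    (QuotientGroup.mk (g * x) : G ⧸ H) = g • QuotientGroup.mk x := rfl

variable {E : Type*} [NormedAddCommGroup E] [NormedSpace ℝ E]
  {G : Type*} [TopologicalSpace G] [ChartedSpace E G] [Group G]
  {E' : Type*} [NormedAddCommGroup E'] [NormedSpace ℝ E']
  {H : Subgroup G} [ChartedSpace E' (G ⧸ H)]

variable (E E' H) in
/-- The derivative at the identity of the projection to a coset space. -/
noncomputable def cosetDeriv : E →L[ℝ] E' := tderiv (QuotientGroup.mk : G → G ⧸ H) 1

theorem mdifferentiable_cosetMk
    (hπ : Manifold.IsSubmersion 𝓘(ℝ, E) 𝓘(ℝ, E') ∞ (QuotientGroup.mk : G → G ⧸ H)) :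
    MDifferentiable 𝓘(ℝ, E) 𝓘(ℝ, E') (QuotientGroup.mk : G → G ⧸ H) :=
  hπ.contMDiff.mdifferentiable (by simp)

variable [LieGroup 𝓘(ℝ, E) ∞ G]
  (hπ : Manifold.IsSubmersion 𝓘(ℝ, E) 𝓘(ℝ, E') ∞ (QuotientGroup.mk : G → G ⧸ H))
include hπ

/-- Locally the action of g is a section of the projection, followed by left translation and the
projection. -/
theorem contMDiff_smul_coset (g : G) :
    ContMDiff 𝓘(ℝ, E') 𝓘(ℝ, E') ∞ (fun x : G ⧸ H => g • x) := by
  intro x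
  obtain ⟨a, rfl⟩ := QuotientGroup.mk_surjective x
  obtain ⟨σ, U, hU, haU, -, hσU, hpσ⟩ := (hπ.isSubmersionAt a).exists_section
  have hσ := hσU.contMDiffAt (hU.mem_nhds haU)
  have h : ContMDiffAt 𝓘(ℝ, E') 𝓘(ℝ, E') ∞
      (fun y => (QuotientGroup.mk (g * σ y) : G ⧸ H)) (QuotientGroup.mk a) :=
    (hπ.contMDiff _).comp _ ((contMDiff_mul_left (I := 𝓘(ℝ, E)) (n := ∞) (a := g) _).comp _ hσ)
  refine h.congr_of_eventuallyEq ?_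
  filter_upwards [hU.mem_nhds haU] with y hy
  rw [QuotientGroup.mk_mul_eq_smul, hpσ y hy]

theorem mdifferentiable_smul_coset (g : G) :
    MDifferentiable 𝓘(ℝ, E') 𝓘(ℝ, E') (fun x : G ⧸ H => g • x) :=
  (contMDiff_smul_coset hπ g).mdifferentiable (by simp)

omit [LieGroup 𝓘(ℝ, E) ∞ G] in
theorem tderiv_cosetMk_surjective (g : G) :
    Function.Surjective (tderiv (QuotientGroup.mk : G → G ⧸ H) g : E →L[ℝ] E') := by
  intro v
  obtain ⟨σ, U, hU, hgU, hσg, hσU, hpσ⟩ := (hπ.isSubmersionAt g).exists_section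
  have hσ := hσU.contMDiffAt (hU.mem_nhds hgU)
  have hpσ' : (fun y => (QuotientGroup.mk (σ y) : G ⧸ H)) =ᶠ[𝓝 (QuotientGroup.mk g)] fun y => y := by
    filter_upwards [hU.mem_nhds hgU] with y hy using hpσ y hy
  refine ⟨(tderiv σ (QuotientGroup.mk g) : E' →L[ℝ] E) v, ?_⟩
  have h := tderiv_comp_apply (E := E') (E' := E) (E'' := E') (QuotientGroup.mk g : G ⧸ H)
    (g := (QuotientGroup.mk : G → G ⧸ H)) (f := σ) (mdifferentiable_cosetMk hπ _)
    (hσ.mdifferentiableAt (by simp)) v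
  rw [hσg] at h
  rw [← h, tderiv_congr hpσ', tderiv_id]
  rfl

omit [LieGroup 𝓘(ℝ, E) ∞ G] in
theorem cosetDeriv_surjective : Function.Surjective (cosetDeriv E E' H) :=
  tderiv_cosetMk_surjective hπ 1

theorem tderiv_cosetMk_mul_left (g x : G) (w : E) :
    (tderiv (QuotientGroup.mk : G → G ⧸ H) (g * x) : E →L[ℝ] E')
      ((tderiv (fun y : G => g * y) x : E →L[ℝ] E) w) =
      (tderiv (fun y : G ⧸ H => g • y) (QuotientGroup.mk x) : E' →L[ℝ] E')
        ((tderiv (QuotientGroup.mk : G → G ⧸ H) x : E →L[ℝ] E') w) := by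
  rw [← tderiv_comp_apply x (mdifferentiable_cosetMk hπ _) (mdifferentiable_leftMul g _),
    ← tderiv_comp_apply x (mdifferentiable_smul_coset hπ g _) (mdifferentiable_cosetMk hπ _)]
  rfl

theorem tderiv_cosetMk_eq (g : G) (u : E) :
    (tderiv (QuotientGroup.mk : G → G ⧸ H) g : E →L[ℝ] E') u =
      (tderiv (fun y : G ⧸ H => g • y) (QuotientGroup.mk 1) : E' →L[ℝ] E')
        (cosetDeriv E E' H (leftTriv (tmk g u))) := by
  have h := tderiv_cosetMk_mul_left hπ g 1 (leftTriv (tmk g u))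
  rw [mul_one] at h
  rw [cosetDeriv, ← h]
  exact (congrArg (tderiv (QuotientGroup.mk : G → G ⧸ H) g : E →L[ℝ] E')
    (tderiv_mul_leftTriv (tmk g u))).symm

variable [IsManifold 𝓘(ℝ, E') ∞ (G ⧸ H)]

omit [LieGroup 𝓘(ℝ, E) ∞ G] hπ in
theorem FinslerMetric.IsHomogeneous.fiber_smul {F : FinslerMetric E' (G ⧸ H)}
    (hF : F.IsHomogeneous) (g : G) (x : G ⧸ H) (u : E') :
    F.fiber (g • x) ((tderiv (fun y : G ⧸ H => g • y) x : E' →L[ℝ] E') u) = F.fiber x u :=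
  hF g ⟨x, u⟩

theorem FinslerMetric.IsHomogeneous.fiber_cosetMk {F : FinslerMetric E' (G ⧸ H)}
    (hF : F.IsHomogeneous) (g : G) (u : E) :
    F.fiber (QuotientGroup.mk g) ((tderiv (QuotientGroup.mk : G → G ⧸ H) g : E →L[ℝ] E') u) =
      F.fiber (QuotientGroup.mk 1) (cosetDeriv E E' H (leftTriv (tmk g u))) := by
  rw [tderiv_cosetMk_eq hπ, ← hF.fiber_smul g (QuotientGroup.mk 1), ← QuotientGroup.mk_mul_eq_smul, mul_one]

/-- The speed of the orbit of a point under a curve in the group. -/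
theorem FinslerMetric.IsHomogeneous.apply_velocity_mul {F : FinslerMetric E' (G ⧸ H)}
    (hF : F.IsHomogeneous) {c : ℝ → G} {s : ℝ} (hc : MDifferentiableAt 𝓘(ℝ, ℝ) 𝓘(ℝ, E) c s) (k : G) :
    F (velocity (fun s => (QuotientGroup.mk (c s * k) : G ⧸ H)) s) =
      F.fiber (QuotientGroup.mk 1) (cosetDeriv E E' H (adjointAction k⁻¹ (leftTriv (velocity c s)))) := by
  have h1 : (velocity (fun s => (QuotientGroup.mk (c s * k) : G ⧸ H)) s :
      TangentBundle 𝓘(ℝ, E') (G ⧸ H)) = tangentMap 𝓘(ℝ, E) 𝓘(ℝ, E') QuotientGroup.mk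
        (velocity (fun s => c s * k) s) :=
    velocity_comp (mdifferentiable_cosetMk hπ _)
      ((mdifferentiable_rightMul (E := E) k _).comp s hc)
  have h2 : (velocity (fun s => c s * k) s : TangentBundle 𝓘(ℝ, E) G) =
      tangentMap 𝓘(ℝ, E) 𝓘(ℝ, E) (fun x => x * k) (velocity c s) :=
    velocity_comp (mdifferentiable_rightMul (E := E) k _) hc
  rw [h1, h2, ← leftTriv_mul_right]
  exact hF.fiber_cosetMk hπ _ _

/-- This is the infinitesimal form of effectiveness. Let c be an integral curve through 1 of the
left-invariant field of b. The velocity of c(s)kH is a translate of π_* Ad(k⁻¹) b, which is 0, so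
c(s) fixes every coset. Hence c is constantly 1 near 0 and b = 0. -/
theorem eq_zero_of_forall_cosetDeriv_eq_zero [FiniteDimensional ℝ E] [FaithfulSMul G (G ⧸ H)] {b : E}
    (hb : ∀ k : G, cosetDeriv E E' H (adjointAction k b) = 0) : b = 0 := by
  have : IsManifold 𝓘(ℝ, E) 1 G := IsManifold.of_le (n := ∞) (by simp)
  have : CompleteSpace E := FiniteDimensional.complete ℝ E
  let W : G → E := fun g => (tderiv (fun x => g * x) 1 : E →L[ℝ] E) b
  let V : (g : G) → TangentSpace 𝓘(ℝ, E) g := W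
  have hV : ContMDiff 𝓘(ℝ, E) 𝓘(ℝ, E).tangent ∞ (fun g => (⟨g, V g⟩ : TangentBundle 𝓘(ℝ, E) G)) := by
    have S := contMDiff_tangent_mul.comp ((contMDiff_tmk_zero (E := E) G).prodMk
      (contMDiff_const (I := 𝓘(ℝ, E)) (M := G) (c := (tmk 1 b : TangentBundle 𝓘(ℝ, E) G))))
    refine S.congr fun g => ?_
    have h1 : (tderiv (fun z : G => z * 1) g : E →L[ℝ] E) 0 +
        (tderiv (fun z : G => g * z) 1 : E →L[ℝ] E) b =
        (tderiv (fun z : G => g * z) 1 : E →L[ℝ] E) b := by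
      rw [map_zero, zero_add]
    have h2 : (tmk (g * 1) ((tderiv (fun z : G => g * z) 1 : E →L[ℝ] E) b) :
        TangentBundle 𝓘(ℝ, E) G) = tmk g ((tderiv (fun z : G => g * z) 1 : E →L[ℝ] E) b) := by
      rw [mul_one]
    exact h2.symm.trans (congrArg (tmk (E := E) (g * 1)) h1.symm)
  obtain ⟨c, hc0, hc⟩ := exists_isMIntegralCurveAt_of_contMDiffAt_boundaryless (I := 𝓘(ℝ, E)) (v := V) 0
    ((hV.of_le (by simp) : ContMDiff 𝓘(ℝ, E) 𝓘(ℝ, E).tangent 1 _) (1 : G))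
  have hd : ∀ {s}, HasMFDerivAt 𝓘(ℝ, ℝ) 𝓘(ℝ, E) c s ((1 : ℝ →L[ℝ] ℝ).smulRight <| V (c s)) →
      (tderiv c s : ℝ →L[ℝ] E) 1 = W (c s) := fun {s} h =>
    (DFunLike.congr_fun h.mfderiv (1 : ℝ)).trans (one_smul ℝ (W (c s)))
  obtain ⟨r, hr, hball⟩ := Metric.eventually_nhds_iff_ball.1 hc
  have hzero : ∀ k : G, ∀ s ∈ Metric.ball (0 : ℝ) r,
      MDifferentiableAt 𝓘(ℝ, ℝ) 𝓘(ℝ, E') (fun s => (QuotientGroup.mk (c s * k) : G ⧸ H)) s ∧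
      ∀ v, (tderiv (fun s => (QuotientGroup.mk (c s * k) : G ⧸ H)) s : ℝ →L[ℝ] E') v = 0 := by
    intro k s hs
    have hcs : MDifferentiableAt 𝓘(ℝ, ℝ) 𝓘(ℝ, E) c s := (hball s hs).mdifferentiableAt
    have hck : MDifferentiableAt 𝓘(ℝ, ℝ) 𝓘(ℝ, E) (fun s => c s * k) s :=
      (mdifferentiable_rightMul (E := E) k _).comp s hcs
    refine ⟨(mdifferentiable_cosetMk hπ _).comp s hck, fun v => ?_⟩
    have h1 : (tderiv (fun s => (QuotientGroup.mk (c s * k) : G ⧸ H)) s : ℝ →L[ℝ] E') 1 = 0 := by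
      rw [tderiv_comp_apply s (mdifferentiable_cosetMk hπ _) hck, tderiv_cosetMk_eq hπ,
        tderiv_comp_apply s (mdifferentiable_rightMul (E := E) k _) hcs, hd (hball s hs)]
      have h2 := leftTriv_mul_right k (tmk (c s) (W (c s)))
      have h3 : leftTriv (tmk (c s) (W (c s))) = b := leftTriv_tmk_mul (c s) b
      rw [h3] at h2
      have h4 := congrArg (cosetDeriv E E' H) h2
      rw [hb] at h4
      exact (congrArg _ h4).trans (map_zero _)
    have h5 : v = v • (1 : ℝ) := by simp
    rw [h5, map_smul, h1, smul_zero]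
  have hone : ∀ s ∈ Metric.ball (0 : ℝ) r, c s = 1 := by
    intro s hs
    refine FaithfulSMul.eq_of_smul_eq_smul (α := G ⧸ H) fun z => ?_
    obtain ⟨k, rfl⟩ := QuotientGroup.mk_surjective z
    have hlc : IsLocallyConstant fun s : Metric.ball (0 : ℝ) r =>
        (QuotientGroup.mk (c s * k) : G ⧸ H) := by
      rw [IsLocallyConstant.iff_eventually_eq]
      intro s
      have := eventually_eq_of_tderiv_eq_zero (E := ℝ) (E' := E') (x := (s : ℝ)) (by
        filter_upwards [Metric.isOpen_ball.mem_nhds s.2] with t ht using hzero k t ht)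
      exact continuous_subtype_val.continuousAt.eventually this
    have hpc : PreconnectedSpace (Metric.ball (0 : ℝ) r) :=
      Subtype.preconnectedSpace (convex_ball (0 : ℝ) r).isPreconnected
    have h1 := hlc.apply_eq_of_preconnectedSpace ⟨s, hs⟩ ⟨0, Metric.mem_ball_self hr⟩
    simp only [hc0, QuotientGroup.mk_mul_eq_smul] at h1
    exact h1
  have h1 : (tderiv c 0 : ℝ →L[ℝ] E) 1 = 0 := by
    have h2 : c =ᶠ[𝓝 0] fun _ => 1 := by
      filter_upwards [Metric.ball_mem_nhds (0 : ℝ) hr] with s hs using hone s hs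
    rw [tderiv_congr h2]
    exact DFunLike.congr_fun (mfderiv_const (I := 𝓘(ℝ, ℝ)) (I' := 𝓘(ℝ, E)) (c := (1 : G))) (1 : ℝ)
  have h2 := hd (hball 0 (Metric.mem_ball_self hr))
  rw [h1, hc0] at h2
  exact (tderiv_one_mul (1 : G) b).symm.trans h2.symm

end Coset

/-! ### Invariant metrics built from norms -/

section Constructions

variable {E : Type*} [NormedAddCommGroup E] [NormedSpace ℝ E]
  {G : Type*} [TopologicalSpace G] [ChartedSpace E G] [Group G] [LieGroup 𝓘(ℝ, E) ∞ G]

theorem IsMinkowskiNorm.contMDiffAt {V : Type*} [NormedAddCommGroup V] [NormedSpace ℝ V]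
    {F : V → ℝ} (hF : IsMinkowskiNorm F) {y : V} (hy : y ≠ 0) :
    ContMDiffAt 𝓘(ℝ, V) 𝓘(ℝ, ℝ) ∞ F y :=
  (hF.contDiffAt hy).contMDiffAt

/-- The left-invariant Finsler metric on a Lie group given by a Minkowski norm on its Lie algebra. -/
noncomputable def leftInvariantMetric (G : Type*) [TopologicalSpace G] [ChartedSpace E G] [Group G]
    [LieGroup 𝓘(ℝ, E) ∞ G] (P : E → ℝ) (hP : IsMinkowskiNorm P) : FinslerMetric E G where
  toFun v := P (leftTriv v)
  continuous_toFun := hP.continuous.comp contMDiff_leftTriv.continuous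
  smooth_slit := fun v hv => by
    refine ContMDiffAt.contMDiffWithinAt ((hP.contMDiffAt ?_).comp v (contMDiff_leftTriv v))
    intro h0
    refine hv ?_
    have h := tderiv_mul_leftTriv v
    rw [h0] at h
    exact h.symm.trans (map_zero (tderiv (fun y => v.1 * y) 1 : E →L[ℝ] E))
  minkowski x := hP.comp_equiv (leftTrivEquiv E x)

theorem leftInvariantMetric_apply {P : E → ℝ} (hP : IsMinkowskiNorm P)
    (v : TangentBundle 𝓘(ℝ, E) G) : leftInvariantMetric G P hP v = P (leftTriv v) := rfl

theorem leftInvariantMetric_isBiinvariant {P : E → ℝ} (hP : IsMinkowskiNorm P)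
    (h : ∀ (g : G) (w : E), P (adjointAction g w) = P w) :
    (leftInvariantMetric G P hP).IsBiinvariant := by
  refine ⟨fun g v => ?_, fun g v => ?_⟩
  · rw [leftInvariantMetric_apply, leftInvariantMetric_apply, leftTriv_mul_left]
  · rw [leftInvariantMetric_apply, leftInvariantMetric_apply, leftTriv_mul_right, h]

variable {E' : Type*} [NormedAddCommGroup E'] [NormedSpace ℝ E']
  {H : Subgroup G} [ChartedSpace E' (G ⧸ H)]
  (hπ : Manifold.IsSubmersion 𝓘(ℝ, E) 𝓘(ℝ, E') ∞ (QuotientGroup.mk : G → G ⧸ H))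
include hπ

theorem tderiv_smul_smul (g h : G) (x : G ⧸ H) (v : E') :
    (tderiv (fun y : G ⧸ H => g • y) (h • x) : E' →L[ℝ] E')
      ((tderiv (fun y : G ⧸ H => h • y) x : E' →L[ℝ] E') v) =
      (tderiv (fun y : G ⧸ H => (g * h) • y) x : E' →L[ℝ] E') v := by
  rw [← tderiv_comp_apply x (mdifferentiable_smul_coset hπ g _) (mdifferentiable_smul_coset hπ h _)]
  simp only [mul_smul]

/-- The derivative of the translation by a group element, as a linear equivalence. -/
noncomputable def smulDerivEquiv (g : G) (x : G ⧸ H) : E' ≃L[ℝ] E' :=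
  ContinuousLinearEquiv.equivOfInverse (tderiv (fun y : G ⧸ H => g • y) x)
    (tderiv (fun y : G ⧸ H => g⁻¹ • y) (g • x))
    (fun v => by
      rw [tderiv_smul_smul hπ, inv_mul_cancel]
      simp only [one_smul, tderiv_id, ContinuousLinearMap.id_apply])
    (fun v => by
      have h := tderiv_smul_smul hπ g g⁻¹ (g • x) v
      rw [inv_smul_smul, mul_inv_cancel] at h
      rw [h]
      simp only [one_smul, tderiv_id, ContinuousLinearMap.id_apply])

theorem smulDerivEquiv_apply (g : G) (x : G ⧸ H) (v : E') :
    smulDerivEquiv hπ g x v = (tderiv (fun y : G ⧸ H => g • y) x : E' →L[ℝ] E') v := rfl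

/-- The isotropy representation is induced by the adjoint one. -/
theorem cosetDeriv_adjointAction {h : G} (hh : h ∈ H) (w : E) :
    cosetDeriv E E' H (adjointAction h w) =
      (tderiv (fun y : G ⧸ H => h • y) (QuotientGroup.mk 1) : E' →L[ℝ] E') (cosetDeriv E E' H w) := by
  have h1 := tderiv_comp_apply (E := E) (E' := E) (E'' := E') (1 : G)
    (g := (QuotientGroup.mk : G → G ⧸ H)) (f := fun x => h * x * h⁻¹) (mdifferentiable_cosetMk hπ _)
    (mdifferentiable_conj h h⁻¹ _) w
  rw [mul_one, mul_inv_cancel] at h1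
  have h2 := tderiv_comp_apply (E := E) (E' := E') (E'' := E') (1 : G)
    (g := fun y : G ⧸ H => h • y) (f := (QuotientGroup.mk : G → G ⧸ H))
    (mdifferentiable_smul_coset hπ h _) (mdifferentiable_cosetMk hπ _) w
  refine h1.symm.trans (Eq.trans ?_ h2)
  congr 2
  ext x
  exact QuotientGroup.mk_mul_of_mem (h * x) (H.inv_mem hh)

omit [LieGroup 𝓘(ℝ, E) ∞ G] in
theorem tangentMap_cosetMk_surjective :
    Function.Surjective (tangentMap 𝓘(ℝ, E) 𝓘(ℝ, E') (QuotientGroup.mk : G → G ⧸ H)) := by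
  rintro ⟨x, v⟩
  obtain ⟨g, rfl⟩ := QuotientGroup.mk_surjective x
  obtain ⟨u, hu⟩ := tderiv_cosetMk_surjective hπ g v
  exact ⟨tmk g u, congrArg (tmk (E := E') (QuotientGroup.mk g : G ⧸ H)) hu⟩

variable [IsManifold 𝓘(ℝ, E') ∞ (G ⧸ H)]

omit [IsManifold 𝓘(ℝ, E') ∞ (G ⧸ H)] in
theorem tderiv_cosetMk_ne_zero (g : G) {u : E}
    (hu : (tderiv (QuotientGroup.mk : G → G ⧸ H) g : E →L[ℝ] E') u ≠ 0) :
    cosetDeriv E E' H (leftTriv (tmk g u)) ≠ 0 := by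
  intro h
  rw [tderiv_cosetMk_eq hπ, h, map_zero] at hu
  exact hu rfl

/-- With these sections, regularity of a function on T(G/H) can be checked after pulling it back to
TG, where the left trivialization is global. -/
theorem exists_tangentMap_section (v₀ : TangentBundle 𝓘(ℝ, E') (G ⧸ H)) :
    ∃ s : TangentBundle 𝓘(ℝ, E') (G ⧸ H) → TangentBundle 𝓘(ℝ, E) G,
      ContMDiffAt 𝓘(ℝ, E').tangent 𝓘(ℝ, E).tangent ∞ s v₀ ∧
      ∀ᶠ v in 𝓝 v₀, tangentMap 𝓘(ℝ, E) 𝓘(ℝ, E') (QuotientGroup.mk : G → G ⧸ H) (s v) = v := by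
  have : IsManifold 𝓘(ℝ, E') 1 (G ⧸ H) := IsManifold.of_le (n := ∞) (by simp)
  have : IsManifold 𝓘(ℝ, E) 1 G := IsManifold.of_le (n := ∞) (by simp)
  have e1 : ((⊤ : ℕ∞) : ℕ∞ω) + 1 = ((⊤ : ℕ∞) : ℕ∞ω) := rfl
  obtain ⟨g, hg⟩ := QuotientGroup.mk_surjective v₀.1
  obtain ⟨σ, U, hU, hgU, -, hσ, hpσ⟩ := (hπ.isSubmersionAt g).exists_section
  rw [hg] at hgU
  have hW : IsOpen ((fun v : TangentBundle 𝓘(ℝ, E') (G ⧸ H) => v.1) ⁻¹' U) :=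
    hU.preimage (FiberBundle.continuous_proj E' (TangentSpace 𝓘(ℝ, E') : G ⧸ H → Type _))
  refine ⟨tangentMap 𝓘(ℝ, E') 𝓘(ℝ, E) σ, ?_, ?_⟩
  · have h1 := hσ.contMDiffOn_tangentMapWithin e1.le hU.uniqueMDiffOn
    have h2 := h1.contMDiffAt (x := v₀) (hW.mem_nhds hgU)
    refine h2.congr_of_eventuallyEq ?_
    filter_upwards [hW.mem_nhds hgU] with v hv
    exact (tangentMapWithin_eq_tangentMap (hU.uniqueMDiffOn v.1 hv)
      ((hσ.contMDiffAt (hU.mem_nhds hv)).mdifferentiableAt (by simp))).symm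
  · filter_upwards [hW.mem_nhds hgU] with v hv
    have h1 : (fun y => (QuotientGroup.mk (σ y) : G ⧸ H)) =ᶠ[𝓝 v.1] fun y => y := by
      filter_upwards [hU.mem_nhds hv] with y hy using hpσ y hy
    have h2 := tderiv_comp_apply (E := E') (E' := E) (E'' := E') v.1
      (g := (QuotientGroup.mk : G → G ⧸ H)) (f := σ) (mdifferentiable_cosetMk hπ _)
      ((hσ.contMDiffAt (hU.mem_nhds hv)).mdifferentiableAt (by simp)) v.2
    rw [tderiv_congr h1, tderiv_id] at h2
    have h3 : ∀ w : E', (tmk (QuotientGroup.mk (σ v.1)) w : TangentBundle 𝓘(ℝ, E') (G ⧸ H)) =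
        tmk v.1 w := fun w => by rw [hpσ v.1 hv]
    exact (congrArg (tmk (E := E') (QuotientGroup.mk (σ v.1) : G ⧸ H)) h2).symm.trans (h3 v.2)

/-- A homogeneous function on the tangent bundle of a coset space, given by a function on the
tangent space at the base point. -/
noncomputable def homogeneousFun (N : E' → ℝ) (v : TangentBundle 𝓘(ℝ, E') (G ⧸ H)) : ℝ :=
  N ((smulDerivEquiv hπ (Quotient.out v.1) (QuotientGroup.mk 1)).symm v.2)

omit [IsManifold 𝓘(ℝ, E') ∞ (G ⧸ H)] in
-- The representative picked by `Quotient.out` differs from u.1 by an element of H, which N ignores.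
-- This makes the pullback to TG regular although the choice of representatives is arbitrary.
theorem homogeneousFun_tangentMap {N : E' → ℝ}
    (hN : ∀ h ∈ H, ∀ w, N ((tderiv (fun y : G ⧸ H => h • y) (QuotientGroup.mk 1) : E' →L[ℝ] E') w) =
      N w) (u : TangentBundle 𝓘(ℝ, E) G) :
    homogeneousFun hπ N (tangentMap 𝓘(ℝ, E) 𝓘(ℝ, E') QuotientGroup.mk u) =
      N (cosetDeriv E E' H (leftTriv u)) := by
  obtain ⟨h, hh⟩ := QuotientGroup.mk_out_eq_mul H u.1
  have hmem : (h : G)⁻¹ ∈ H := H.inv_mem h.2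
  have h1 : (smulDerivEquiv hπ (Quotient.out (QuotientGroup.mk u.1 : G ⧸ H)) (QuotientGroup.mk 1)).symm
      ((tderiv (QuotientGroup.mk : G → G ⧸ H) u.1 : E →L[ℝ] E') u.2) =
      (tderiv (fun y : G ⧸ H => (h : G)⁻¹ • y) (QuotientGroup.mk 1) : E' →L[ℝ] E')
        (cosetDeriv E E' H (leftTriv u)) := by
    rw [ContinuousLinearEquiv.symm_apply_eq, hh, smulDerivEquiv_apply]
    have h2 := tderiv_smul_smul hπ (u.1 * h) (h : G)⁻¹ (QuotientGroup.mk 1)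
      (cosetDeriv E E' H (leftTriv u))
    have h3 : (h : G)⁻¹ • (QuotientGroup.mk 1 : G ⧸ H) = QuotientGroup.mk 1 := by
      rw [← QuotientGroup.mk_mul_eq_smul]
      have := QuotientGroup.mk_mul_of_mem (s := H) 1 hmem
      rwa [one_mul, ← mul_one (h : G)⁻¹] at this
    rw [h3, mul_inv_cancel_right] at h2
    rw [h2]
    exact tderiv_cosetMk_eq hπ u.1 u.2
  exact (congrArg N h1).trans (hN _ hmem _)

/-- The homogeneous Finsler metric given by an invariant Minkowski norm on the tangent space at the
base point. -/
noncomputable def homogeneousMetric (N : E' → ℝ) (hNm : IsMinkowskiNorm N)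
    (hN : ∀ h ∈ H, ∀ w, N ((tderiv (fun y : G ⧸ H => h • y) (QuotientGroup.mk 1) : E' →L[ℝ] E') w) =
      N w) : FinslerMetric E' (G ⧸ H) where
  toFun := homogeneousFun hπ N
  continuous_toFun := by
    refine continuous_iff_continuousAt.2 fun v => ?_
    obtain ⟨s, hs, hv⟩ := exists_tangentMap_section hπ v
    have h : ContinuousAt (fun v => N (cosetDeriv E E' H (leftTriv (s v)))) v :=
      (hNm.continuous.comp ((cosetDeriv E E' H).continuous.comp
        contMDiff_leftTriv.continuous)).continuousAt.comp hs.continuousAt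
    refine h.congr ?_
    filter_upwards [hv] with w hw
    conv_rhs => rw [← hw]
    exact (homogeneousFun_tangentMap hπ hN (s w)).symm
  smooth_slit := fun v hv => by
    obtain ⟨s, hs, hsv⟩ := exists_tangentMap_section hπ v
    have h0 : cosetDeriv E E' H (leftTriv (s v)) ≠ 0 := by
      intro h0
      have h1 : (tangentMap 𝓘(ℝ, E) 𝓘(ℝ, E') (QuotientGroup.mk : G → G ⧸ H) (s v)).2 ≠ 0 := by
        rw [hsv.self_of_nhds]
        exact hv
      exact tderiv_cosetMk_ne_zero hπ (s v).1 (u := (s v).2) h1 h0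
    have h : ContMDiffAt 𝓘(ℝ, E').tangent 𝓘(ℝ, ℝ) ∞
        (fun v => N (cosetDeriv E E' H (leftTriv (s v)))) v :=
      (hNm.contMDiffAt h0).comp v (((cosetDeriv E E' H).contMDiff (n := ∞) _).comp v
        ((contMDiff_leftTriv _).comp v hs))
    refine (h.congr_of_eventuallyEq ?_).contMDiffWithinAt
    filter_upwards [hsv] with w hw
    conv_lhs => rw [← hw]
    exact homogeneousFun_tangentMap hπ hN (s w)
  minkowski x := hNm.comp_equiv (smulDerivEquiv hπ (Quotient.out x) (QuotientGroup.mk 1)).symm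

theorem homogeneousMetric_isHomogeneous {N : E' → ℝ} (hNm : IsMinkowskiNorm N)
    (hN : ∀ h ∈ H, ∀ w, N ((tderiv (fun y : G ⧸ H => h • y) (QuotientGroup.mk 1) : E' →L[ℝ] E') w) =
      N w) : (homogeneousMetric hπ N hNm hN).IsHomogeneous := by
  intro g v
  obtain ⟨u, rfl⟩ := tangentMap_cosetMk_surjective hπ v
  have h1 : tangentMap 𝓘(ℝ, E') 𝓘(ℝ, E') (fun x : G ⧸ H => g • x)
      (tangentMap 𝓘(ℝ, E) 𝓘(ℝ, E') QuotientGroup.mk u) =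
      tangentMap 𝓘(ℝ, E) 𝓘(ℝ, E') (QuotientGroup.mk : G → G ⧸ H)
        (tangentMap 𝓘(ℝ, E) 𝓘(ℝ, E) (fun x => g * x) u) :=
    congrArg (tmk (E := E') (g • (QuotientGroup.mk u.1 : G ⧸ H)))
      (tderiv_cosetMk_mul_left hπ g u.1 u.2).symm
  rw [h1]
  exact (homogeneousFun_tangentMap hπ hN _).trans
    ((congrArg (fun w => N (cosetDeriv E E' H w)) (leftTriv_mul_left g u)).trans
      (homogeneousFun_tangentMap hπ hN u).symm)

end Constructions

/-! ### Continuity of velocities and semicontinuity of the distance -/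

section Velocity

variable {E : Type*} [NormedAddCommGroup E] [NormedSpace ℝ E]
  {M : Type*} [TopologicalSpace M] [ChartedSpace E M] [IsManifold 𝓘(ℝ, E) ∞ M]

theorem continuousAt_velocity {c : ℝ → M} {t : ℝ} (hc : ContMDiffAt 𝓘(ℝ, ℝ) 𝓘(ℝ, E) 1 c t) :
    ContinuousAt (fun s => (velocity c s : TangentBundle 𝓘(ℝ, E) M)) t := by
  have : IsManifold 𝓘(ℝ, E) 1 M := IsManifold.of_le (n := ∞) (by simp)
  obtain ⟨U, hU, hcU⟩ := (contMDiffAt_iff_contMDiffOn_nhds (by simp)).1 hc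
  obtain ⟨V, hVU, hV, htV⟩ := mem_nhds_iff.1 hU
  have h1 := (hcU.mono hVU).continuousOn_tangentMapWithin le_rfl hV.uniqueMDiffOn
  have h2 : Continuous fun s : ℝ => (tmk s (1 : ℝ) : TangentBundle 𝓘(ℝ, ℝ) ℝ) :=
    (tangentBundleModelSpaceHomeomorph 𝓘(ℝ, ℝ)).symm.continuous.comp
      (continuous_id.prodMk continuous_const)
  have h3 := h1.comp h2.continuousOn (s := V) (fun s hs => hs)
  refine (h3.continuousAt (hV.mem_nhds htV)).congr ?_
  filter_upwards [hV.mem_nhds htV] with s hs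
  exact (tangentMapWithin_eq_tangentMap (p := (tmk s (1 : ℝ) : TangentBundle 𝓘(ℝ, ℝ) ℝ))
    (hV.uniqueMDiffOn s hs) ((((hcU.mono hVU).contMDiffAt (hV.mem_nhds hs))).mdifferentiableAt (by simp)))

/-- Points y' of the set near a limit y satisfy d(z, y) ≤ r + d(y', y), and d(y', y) tends to 0.
This lets displacement bounds pass to limits of group elements. -/
theorem FinslerMetric.isClosed_setOf_edist_le [FiniteDimensional ℝ E] (F : FinslerMetric E M)
    (z : M) (r : ℝ≥0∞) : IsClosed {y | F.edist z y ≤ r} := by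
  refine isClosed_of_closure_subset fun y hy => ?_
  rw [mem_closure_iff_frequently] at hy
  refine ENNReal.le_of_forall_pos_le_add fun ε hε _ => ?_
  have h1 := (F.tendsto_edist_nhds y).eventually (gt_mem_nhds (ENNReal.coe_pos.2 hε))
  obtain ⟨y', hy', hlt⟩ := (hy.and_eventually h1).exists
  exact (F.edist_triangle z y' y).trans (add_le_add hy' hlt.le)

end Velocity

/-! ### Boundedness of the adjoint group -/

section Adjoint

variable {E : Type*} [NormedAddCommGroup E] [NormedSpace ℝ E] [FiniteDimensional ℝ E]
  {G : Type*} [TopologicalSpace G] [ChartedSpace E G] [Group G] [LieGroup 𝓘(ℝ, E) ∞ G]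
  [ConnectedSpace G]

/-- The adjoint action of a connected quasi-compact Lie group is isometric for a suitable Euclidean
structure. -/
theorem IsQuasiCompact.exists_norm_adjointAction (hG : IsQuasiCompact E G) :
    ∃ (n : ℕ) (e : E ≃L[ℝ] EuclideanSpace ℝ (Fin n)), ∀ (g : G) (w : E),
      ‖e (adjointAction g w)‖ = ‖e w‖ := by
  obtain ⟨B, hsymm, hpos, hskew⟩ := hG
  obtain ⟨n, e, he⟩ := exists_linearEquiv_euclideanSpace
    (show LinearMap.BilinForm ℝ E from B) hsymm hpos
  refine ⟨n, e.toContinuousLinearEquiv, fun g w => ?_⟩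
  have h := apply_adjointAction_of_skew B hskew g w w
  have h1 : ‖e (adjointAction g w)‖ ^ 2 = ‖e w‖ ^ 2 := by
    rw [he, he]
    exact h
  exact (sq_eq_sq₀ (norm_nonneg _) (norm_nonneg _)).1 h1

theorem IsQuasiCompact.exists_norm_adjointAction_le (hG : IsQuasiCompact E G) :
    ∃ C : ℝ, 0 < C ∧ ∀ (g : G) (w : E), ‖adjointAction g w‖ ≤ C * ‖w‖ := by
  obtain ⟨n, e, he⟩ := hG.exists_norm_adjointAction
  refine ⟨‖(e.symm : EuclideanSpace ℝ (Fin n) →L[ℝ] E)‖ * ‖(e : E →L[ℝ] EuclideanSpace ℝ (Fin n))‖ + 1, by positivity,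
    fun g w => ?_⟩
  calc ‖adjointAction g w‖ = ‖e.symm (e (adjointAction g w))‖ := by rw [e.symm_apply_apply]
    _ ≤ ‖(e.symm : EuclideanSpace ℝ (Fin n) →L[ℝ] E)‖ * ‖e (adjointAction g w)‖ :=
        (e.symm : EuclideanSpace ℝ (Fin n) →L[ℝ] E).le_opNorm _
    _ ≤ ‖(e.symm : EuclideanSpace ℝ (Fin n) →L[ℝ] E)‖ * (‖(e : E →L[ℝ] EuclideanSpace ℝ (Fin n))‖ * ‖w‖) := by
        rw [he]
        gcongr
        exact (e : E →L[ℝ] EuclideanSpace ℝ (Fin n)).le_opNorm _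
    _ ≤ _ := by nlinarith [norm_nonneg w]

end Adjoint

/-! ### From almost maximal lifts to δ-homogeneity -/

section Displacement

variable {E : Type*} [NormedAddCommGroup E] [NormedSpace ℝ E]
  {G : Type*} [TopologicalSpace G] [ChartedSpace E G] [Group G]
  {E' : Type*} [NormedAddCommGroup E'] [NormedSpace ℝ E']
  {H : Subgroup G} [ChartedSpace E' (G ⧸ H)] [IsManifold 𝓘(ℝ, E') ∞ (G ⧸ H)]

namespace FinslerMetric

variable (E) in
/-- Every tangent vector at the base point is, up to an arbitrarily small error, the value of a
fundamental vector field whose length is maximal there. -/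
def HasAlmostMaximalLifts (F : FinslerMetric E' (G ⧸ H)) : Prop :=
  ∀ (v : E') (δ : ℝ), 0 < δ → ∃ w : E, cosetDeriv E E' H w = v ∧
    ∀ k : G, F.fiber (QuotientGroup.mk 1) (cosetDeriv E E' H (adjointAction k w)) ≤
      (1 + δ) * F.fiber (QuotientGroup.mk 1) v

variable [FiniteDimensional ℝ E] [FiniteDimensional ℝ E'] [LieGroup 𝓘(ℝ, E) ∞ G] [ConnectedSpace G]
  (hG : IsQuasiCompact E G)
  (hπ : Manifold.IsSubmersion 𝓘(ℝ, E) 𝓘(ℝ, E') ∞ (QuotientGroup.mk : G → G ⧸ H))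
  {F : FinslerMetric E' (G ⧸ H)}
include hG hπ

omit hπ in
theorem exists_fiber_adjointAction_le (F : FinslerMetric E' (G ⧸ H)) : ∃ C : ℝ, 0 < C ∧ ∀ (k : G) (u : E),
    F.fiber (QuotientGroup.mk 1) (cosetDeriv E E' H (adjointAction k u)) ≤ C * ‖u‖ := by
  obtain ⟨c, C, -, hC, hb⟩ := (F.isMinkowskiNorm_fiber (QuotientGroup.mk 1)).isAsymmetricNorm.exists_bounds
  obtain ⟨A, hA, hAd⟩ := hG.exists_norm_adjointAction_le
  refine ⟨C * ((‖cosetDeriv E E' H‖ + 1) * A), by positivity, fun k u => ?_⟩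
  calc _ ≤ C * ‖cosetDeriv E E' H (adjointAction k u)‖ := (hb _).2
    _ ≤ C * (‖cosetDeriv E E' H‖ * ‖adjointAction k u‖) := by
        gcongr
        exact (cosetDeriv E E' H).le_opNorm _
    _ ≤ C * ((‖cosetDeriv E E' H‖ + 1) * (A * ‖u‖)) := by
        gcongr
        · linarith
        · exact hAd k u
    _ = _ := by ring

/-- Lift γ near t to a curve c in G whose velocity at t is a translate of an almost maximal lift w.
Then c(b) c(a)⁻¹ moves a point mH along c(s) c(a)⁻¹ mH. Its speed is governed by Ad of the velocity
of c, which is close to w, so it exceeds that of γ by at most ε, uniformly in m. -/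
theorem IsHomogeneous.exists_local_displacement (hF : F.IsHomogeneous)
    (hI : F.HasAlmostMaximalLifts E) {γ : ℝ → G ⧸ H}
    (hγ : ContMDiff 𝓘(ℝ, ℝ) 𝓘(ℝ, E') 1 γ) (t : ℝ) {ε : ℝ} (hε : 0 < ε) :
    ∃ r > 0, ∀ a ∈ Metric.ball t r, ∀ b ∈ Metric.ball t r, a ≤ b → ∃ g : G, g • γ a = γ b ∧
      ∀ z, F.edist z (g • z) ≤ F.pathLength γ a b + ENNReal.ofReal (ε * (b - a)) := by
  obtain ⟨C, hC, hCb⟩ := exists_fiber_adjointAction_le hG F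
  obtain ⟨g₀, hg₀⟩ := QuotientGroup.mk_surjective (γ t)
  obtain ⟨u, hu⟩ := tderiv_cosetMk_surjective hπ g₀ ((tderiv γ t : ℝ →L[ℝ] E') 1)
  set N := F.fiber (QuotientGroup.mk 1) with hN
  have hNm : IsMinkowskiNorm N := F.isMinkowskiNorm_fiber _
  set v := cosetDeriv E E' H (leftTriv (tmk g₀ u)) with hv
  have hspeed : F (velocity γ t) = N v := by
    rw [hN, hv, ← hF.fiber_cosetMk hπ, hu, hg₀]
    rfl
  have hNv : 0 ≤ N v := hNm.nonneg v
  -- The relative slack becomes an absolute error of at most ε / 4, even for N v = 0. Two further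
  -- errors of ε / 4 come from the variation of the velocities of c and of γ.
  obtain ⟨w, hw, hwb⟩ := hI v (ε / 4 / (N v + 1)) (by positivity)
  have hδ : ε / 4 / (N v + 1) * N v ≤ ε / 4 := by
    rw [div_mul_eq_mul_div, div_le_iff₀ (by positivity)]
    nlinarith
  set w' : E := (tderiv (fun y : G => g₀ * y) 1 : E →L[ℝ] E) w with hw'
  have hlw : leftTriv (tmk g₀ w') = w := leftTriv_tmk_mul g₀ w
  have hπw : (tderiv (QuotientGroup.mk : G → G ⧸ H) g₀ : E →L[ℝ] E') w' =
      (tderiv γ t : ℝ →L[ℝ] E') 1 := by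
    rw [← hu, tderiv_cosetMk_eq hπ, tderiv_cosetMk_eq hπ, hlw, hw]
  obtain ⟨c, hct, hc, hc', hπc⟩ := (hπ.isSubmersionAt g₀).exists_lift (hγ t) hg₀.symm
    ((1 : ℝ →L[ℝ] ℝ).smulRight w') (fun s => by
      rw [ContinuousLinearMap.smulRight_apply, _root_.map_smul, hπw, ← _root_.map_smul]
      simp)
  have hvel : leftTriv (velocity c t) = w := by
    have h1 : (velocity c t : TangentBundle 𝓘(ℝ, E) G) = tmk g₀ w' := by
      have h2 : (tderiv c t : ℝ →L[ℝ] E) 1 = w' := by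
        rw [hc']
        simp
      rw [velocity_eq, h2, hct]
    rw [h1, hlw]
  have hcont : ContinuousAt (fun s => leftTriv (velocity c s : TangentBundle 𝓘(ℝ, E) G)) t :=
    contMDiff_leftTriv.continuous.continuousAt.comp (continuousAt_velocity hc)
  have hev1 : ∀ᶠ s in 𝓝 t, ‖leftTriv (velocity c s : TangentBundle 𝓘(ℝ, E) G) - w‖ < ε / 4 / C := by
    have h1 := (hcont.sub (continuousAt_const (y := w))).norm
    refine h1.eventually (gt_mem_nhds ?_)
    change ‖leftTriv (velocity c t : TangentBundle 𝓘(ℝ, E) G) - w‖ < _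
    rw [hvel, sub_self, norm_zero]
    positivity
  have hev2 : ∀ᶠ s in 𝓝 t, F (velocity γ t) < F (velocity γ s) + ε / 4 := by
    have h1 : ContinuousAt (fun s => F (velocity γ s)) t :=
      F.continuous_toFun.continuousAt.comp (continuousAt_velocity (hγ t))
    filter_upwards [h1.eventually (lt_mem_nhds (sub_lt_self _ (by positivity : 0 < ε / 4)))] with s hs
    linarith
  have hev3 : ∀ᶠ s in 𝓝 t, ContMDiffAt 𝓘(ℝ, ℝ) 𝓘(ℝ, E) 1 c s := by
    obtain ⟨U, hU, hcU⟩ := (contMDiffAt_iff_contMDiffOn_nhds (by simp)).1 hc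
    obtain ⟨V, hVU, hV, htV⟩ := mem_nhds_iff.1 hU
    filter_upwards [hV.mem_nhds htV] with s hs
    exact (hcU.mono hVU).contMDiffAt (hV.mem_nhds hs)
  obtain ⟨r, hr, hball⟩ := Metric.eventually_nhds_iff_ball.1
    (((hev1.and hev2).and hev3).and hπc)
  refine ⟨r, hr, fun a ha b hb hab => ⟨c b * (c a)⁻¹, ?_, fun z => ?_⟩⟩
  · rw [← (hball a ha).2, ← (hball b hb).2, ← QuotientGroup.mk_mul_eq_smul, inv_mul_cancel_right]
  obtain ⟨m, rfl⟩ := QuotientGroup.mk_surjective z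
  have hIcc : ∀ s ∈ Icc a b, s ∈ Metric.ball t r := fun s hs =>
    (convex_ball t r).ordConnected.out ha hb hs
  set k := (c a)⁻¹ * m with hk
  have hη : ContMDiffOn 𝓘(ℝ, ℝ) 𝓘(ℝ, E') 1 (fun s => (QuotientGroup.mk (c s * k) : G ⧸ H)) (Icc a b) :=
    fun s hs => ((((hπ.contMDiff.of_le (by simp)) _).comp s
      (((contMDiff_mul_right (I := 𝓘(ℝ, E)) (n := ∞) (a := k)).of_le (by simp) _).comp s
        (hball s (hIcc s hs)).1.2))).contMDiffWithinAt
  have h1 := F.edist_le_pathLength hη rfl rfl hab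
  have e1 : (QuotientGroup.mk (c a * k) : G ⧸ H) = QuotientGroup.mk m := by
    rw [hk, mul_inv_cancel_left]
  have e2 : (QuotientGroup.mk (c b * k) : G ⧸ H) = (c b * (c a)⁻¹) • QuotientGroup.mk m := by
    rw [← QuotientGroup.mk_mul_eq_smul, hk, mul_assoc]
  rw [e1, e2] at h1
  refine h1.trans ?_
  calc F.pathLength (fun s => (QuotientGroup.mk (c s * k) : G ⧸ H)) a b
      ≤ ∫⁻ s in Icc a b, (ENNReal.ofReal (F (velocity γ s)) + ENNReal.ofReal ε) := by
        refine setLIntegral_mono' measurableSet_Icc fun s hs => ?_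
        rw [← ENNReal.ofReal_add (F.nonneg _) hε.le]
        refine ENNReal.ofReal_le_ofReal ?_
        obtain ⟨⟨⟨hs1, hs2⟩, hs3⟩, -⟩ := hball s (hIcc s hs)
        rw [hF.apply_velocity_mul hπ (hs3.mdifferentiableAt (by simp))]
        set q := leftTriv (velocity c s : TangentBundle 𝓘(ℝ, E) G)
        have h2 : cosetDeriv E E' H (adjointAction k⁻¹ q) =
            cosetDeriv E E' H (adjointAction k⁻¹ w) + cosetDeriv E E' H (adjointAction k⁻¹ (q - w)) := by
          rw [map_sub, map_sub]
          abel
        have h3 := hNm.add_le (cosetDeriv E E' H (adjointAction k⁻¹ w))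
          (cosetDeriv E E' H (adjointAction k⁻¹ (q - w)))
        have h4 := hwb k⁻¹
        have h5 := hCb k⁻¹ (q - w)
        have h6 : C * ‖q - w‖ ≤ ε / 4 := by
          rw [lt_div_iff₀ hC] at hs1
          linarith
        rw [h2]
        rw [hspeed] at hs2
        linarith
    _ = F.pathLength γ a b + ENNReal.ofReal (ε * (b - a)) := by
        rw [lintegral_add_right _ measurable_const, setLIntegral_const, Real.volume_Icc,
          ENNReal.ofReal_mul hε.le]
        rfl

/-- Cut an almost shortest curve into pieces to which the local statement applies. By the triangle
inequality the displacements of a product of group elements add up, just as the lengths and the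
errors do. -/
theorem IsHomogeneous.exists_displacement_le (hF : F.IsHomogeneous)
    (hI : F.HasAlmostMaximalLifts E) {x y : G ⧸ H} {r : ℝ≥0∞} (hr : F.edist x y < r) :
    ∃ g : G, g • x = y ∧ ∀ z, F.edist z (g • z) ≤ r := by
  obtain ⟨γ, hγ0, hγ1, hγ, hlen, -, -⟩ := F.exists_pathLength_lt_of_edist_lt hr (zero_lt_one (α := ℝ))
  obtain ⟨ε, hε, hεr⟩ := ENNReal.lt_iff_exists_add_pos_lt.1 hlen
  choose ρ hρ hloc using fun t =>
    hF.exists_local_displacement hG hπ hI hγ t (ε := (ε : ℝ)) (by exact_mod_cast hε)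
  obtain ⟨s, hs0, hs, ⟨n, hn⟩, hcov⟩ := exists_monotone_Icc_subset_open_cover_Icc
    (zero_le_one (α := ℝ)) (c := fun t : ℝ => (Subtype.val ⁻¹' Metric.ball t (ρ t) : Set (Icc (0 : ℝ) 1)))
    (fun t => Metric.isOpen_ball.preimage continuous_subtype_val)
    (fun t _ => mem_iUnion.2 ⟨t, Metric.mem_ball_self (hρ t)⟩)
  have key : ∀ i, ∃ g : G, g • γ 0 = γ (s i) ∧ ∀ z, F.edist z (g • z) ≤
      F.pathLength γ 0 (s i) + ENNReal.ofReal (ε * (s i - 0)) := by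
    intro i
    induction i with
    | zero =>
      refine ⟨1, ?_, fun z => ?_⟩
      · rw [hs0, one_smul]
      · rw [one_smul, F.edist_self]
        exact zero_le
    | succ i ih =>
      obtain ⟨g, hg, hgz⟩ := ih
      obtain ⟨t, ht⟩ := hcov i
      have hle : s i ≤ s (i + 1) := hs (Nat.le_succ i)
      have hle' : (s i : ℝ) ≤ s (i + 1) := hle
      obtain ⟨h, hh, hhz⟩ := hloc t (s i) (ht (left_mem_Icc.2 hle)) (s (i + 1))
        (ht (right_mem_Icc.2 hle)) hle
      refine ⟨h * g, by rw [mul_smul, hg, hh], fun z => ?_⟩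
      rw [mul_smul]
      calc F.edist z (h • g • z) ≤ F.edist z (g • z) + F.edist (g • z) (h • g • z) :=
            F.edist_triangle _ _ _
        _ ≤ (F.pathLength γ 0 (s i) + ENNReal.ofReal (ε * (s i - 0))) +
            (F.pathLength γ (s i) (s (i + 1)) + ENNReal.ofReal (ε * (s (i + 1) - s i))) :=
            add_le_add (hgz z) (hhz _)
        _ = F.pathLength γ 0 (s (i + 1)) + ENNReal.ofReal (ε * (s (i + 1) - 0)) := by
            rw [← F.pathLength_add (s i).2.1 hle', add_add_add_comm, ← ENNReal.ofReal_add]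
            · congr 2
              ring
            · exact mul_nonneg ε.2 (by linarith [(s i).2.1])
            · exact mul_nonneg ε.2 (by linarith)
  obtain ⟨g, hg, hgz⟩ := key n
  rw [hn n le_rfl] at hg hgz
  refine ⟨g, by rw [← hγ0, ← hγ1, hg], fun z => (hgz z).trans ?_⟩
  simpa using hεr.le

/-- The elements carrying x to y form a compact set of the form b H a⁻¹. Those with displacements at
most d(x, y) + 1/(n + 1) form a decreasing sequence of nonempty compact subsets, and a common
element has maximal displacement at x. -/
theorem IsHomogeneous.isDeltaHomogeneous (hF : F.IsHomogeneous) [T2Space G]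
    (hH : IsCompact (H : Set G)) (hI : F.HasAlmostMaximalLifts E) : F.IsDeltaHomogeneous := by
  have : IsTopologicalGroup G := topologicalGroup_of_lieGroup 𝓘(ℝ, E) ∞
  have : IsClosed (H : Set G) := hH.isClosed
  refine ⟨hF, fun x y => ?_⟩
  rcases eq_or_ne (F.edist x y) ⊤ with htop | htop
  · obtain ⟨g, hg⟩ := MulAction.exists_smul_eq G x y
    exact ⟨g, hg, fun z => by rw [hg, htop]; exact le_top⟩
  have hK : IsCompact {g : G | g • x = y} := by
    obtain ⟨a, rfl⟩ := QuotientGroup.mk_surjective x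
    obtain ⟨b, rfl⟩ := QuotientGroup.mk_surjective y
    have h1 : {g : G | g • (QuotientGroup.mk a : G ⧸ H) = QuotientGroup.mk b} =
        (fun h => b * h * a⁻¹) '' (H : Set G) := by
      ext g
      simp only [mem_ofPred_eq, mem_image, SetLike.mem_coe]
      rw [← QuotientGroup.mk_mul_eq_smul, eq_comm, QuotientGroup.eq]
      constructor
      · intro h
        exact ⟨_, h, by group⟩
      · rintro ⟨h, hh, rfl⟩
        convert hh using 1
        group
    rw [h1]
    exact hH.image (by fun_prop)
  have hclosed : ∀ r, IsClosed {g : G | ∀ z, F.edist z (g • z) ≤ r} := by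
    intro r
    simp only [ofPred_forall]
    exact isClosed_iInter fun z => (F.isClosed_setOf_edist_le z r).preimage
      (continuous_id.smul continuous_const)
  obtain ⟨g, hg⟩ := IsCompact.nonempty_iInter_of_sequence_nonempty_isCompact_isClosed
    (fun n : ℕ => {g : G | g • x = y} ∩ {g : G | ∀ z, F.edist z (g • z) ≤ F.edist x y + (n + 1 : ℝ≥0∞)⁻¹})
    (fun n g hg => ⟨hg.1, fun z => (hg.2 z).trans (by gcongr; simp)⟩)
    (fun n => by
      obtain ⟨g, hg, hgz⟩ := hF.exists_displacement_le hG hπ hI (x := x) (y := y)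
        (r := F.edist x y + (n + 1 : ℝ≥0∞)⁻¹) (ENNReal.lt_add_right htop (by simp))
      exact ⟨g, hg, hgz⟩)
    (hK.inter_right (hclosed _)) (fun n => hK.isClosed.inter (hclosed _))
  rw [mem_iInter] at hg
  refine ⟨g, (hg 0).1, fun z => ?_⟩
  rw [show g • x = y from (hg 0).1]
  refine ENNReal.le_of_forall_pos_le_add fun ε hε _ => ?_
  obtain ⟨n, hn⟩ := ENNReal.exists_inv_nat_lt (ENNReal.coe_pos.2 hε).ne'
  refine ((hg n).2 z).trans (add_le_add le_rfl (le_trans ?_ hn.le))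
  exact ENNReal.inv_le_inv.2 le_self_add

end FinslerMetric

end Displacement

/-! ### From δ-homogeneity to almost maximal lifts -/

section Lifts

theorem IsCompact.exists_tendsto_ultrafilter {ι X : Type*} [TopologicalSpace X] {K : Set X}
    (hK : IsCompact K) (l : Ultrafilter ι) {u : ι → X} (hu : ∀ᶠ i in (l : Filter ι), u i ∈ K) :
    ∃ x ∈ K, Filter.Tendsto u l (𝓝 x) :=
  hK.ultrafilter_le_nhds' (l.map u) hu

variable {E : Type*} [NormedAddCommGroup E] [NormedSpace ℝ E] [FiniteDimensional ℝ E]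
  {G : Type*} [TopologicalSpace G] [ChartedSpace E G] [Group G] [LieGroup 𝓘(ℝ, E) ∞ G] [T2Space G]
  {E' : Type*} [NormedAddCommGroup E'] [NormedSpace ℝ E'] [FiniteDimensional ℝ E']
  {H : Subgroup G} [ChartedSpace E' (G ⧸ H)] [IsManifold 𝓘(ℝ, E') ∞ (G ⧸ H)]

namespace FinslerMetric

/-- The lift is a first-order limit of group elements whose displacement is maximal at the base
point. It even satisfies the bound without the factor 1 + δ. -/
theorem IsDeltaHomogeneous.hasAlmostMaximalLifts [FaithfulSMul G (G ⧸ H)]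
    (hπ : Manifold.IsSubmersion 𝓘(ℝ, E) 𝓘(ℝ, E') ∞ (QuotientGroup.mk : G → G ⧸ H))
    (hH : IsCompact (H : Set G)) {F : FinslerMetric E' (G ⧸ H)} (hF : F.IsDeltaHomogeneous) :
    F.HasAlmostMaximalLifts E := by
  have : IsTopologicalGroup G := topologicalGroup_of_lieGroup 𝓘(ℝ, E) ∞
  have : IsClosed (H : Set G) := hH.isClosed
  intro v δ hδ
  set o : G ⧸ H := QuotientGroup.mk 1 with ho
  set N := F.fiber o with hN
  have hNm : IsMinkowskiNorm N := F.isMinkowskiNorm_fiber _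
  have hNv : 0 ≤ N v := hNm.nonneg v
  set φ := chartAt E' o with hφ
  set ψ := chartAt E (1 : G) with hψ
  have hφo : φ o ∈ φ.target := mem_chart_target E' o
  -- points on a straight line in the chart
  let y : ℝ → G ⧸ H := fun s => φ.symm (φ o + s • v)
  have hline : Filter.Tendsto (fun s : ℝ => φ o + s • v) (𝓝 0) (𝓝 (φ o)) := by
    have : Continuous fun s : ℝ => φ o + s • v := by fun_prop
    simpa using this.tendsto 0
  have hyt : ∀ᶠ s in 𝓝 (0 : ℝ), φ o + s • v ∈ φ.target :=
    hline.eventually (φ.open_target.mem_nhds hφo)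
  have hyo : Filter.Tendsto y (𝓝 0) (𝓝 o) := by
    have h1 := (φ.continuousAt_symm hφo).tendsto.comp hline
    rwa [φ.left_inv (mem_chart_source E' o)] at h1
  have hdist : ∀ ε : ℝ, 0 < ε → ∀ᶠ s in 𝓝[>] (0 : ℝ),
      F.edist o (y s) ≤ ENNReal.ofReal (s * ((1 + ε) * N v)) := by
    intro ε hε
    obtain ⟨U, hU, -, hUd⟩ := F.exists_edist_le o hε
    filter_upwards [nhdsWithin_le_nhds hyt, nhdsWithin_le_nhds (hyo.eventually hU),
      self_mem_nhdsWithin] with s hs1 hs2 hs3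
    have h1 := hUd o (mem_of_mem_nhds hU) (y s) hs2
    have h2 : φ (y s) - φ o = s • v := by
      rw [φ.right_inv hs1, add_sub_cancel_left]
    rw [h2, ← hN, hNm.homogeneous s v (le_of_lt hs3)] at h1
    convert h1 using 2
    ring
  choose g hgy hg using fun s => hF.2 o (y s)
  have hd0 : Filter.Tendsto (fun s : ℝ => ENNReal.ofReal (s * ((1 + 1) * N v))) (𝓝[>] 0) (𝓝 0) := by
    have h1 : Continuous fun s : ℝ => ENNReal.ofReal (s * ((1 + 1) * N v)) :=
      ENNReal.continuous_ofReal.comp (by fun_prop)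
    have h2 := (h1.tendsto 0).mono_left (nhdsWithin_le_nhds (s := Ioi 0))
    simpa using h2
  -- Maximality at o bounds the displacement of every z by that of o, which is of order s.
  have hgz0 : ∀ z, Filter.Tendsto (fun s => F.edist z (g s • z)) (𝓝[>] 0) (𝓝 0) := by
    intro z
    refine tendsto_of_tendsto_of_tendsto_of_le_of_le' tendsto_const_nhds hd0
      (Filter.Eventually.of_forall fun s => zero_le) ?_
    filter_upwards [hdist 1 one_pos] with s hs
    have := hg s z
    rw [hgy] at this
    exact this.trans hs
  have hgz : ∀ z, Filter.Tendsto (fun s => g s • z) (𝓝[>] 0) (𝓝 z) := fun z =>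
    F.tendsto_of_tendsto_edist z (hgz0 z)
  let l : Ultrafilter ℝ := Ultrafilter.of (𝓝[>] 0)
  have hl : (l : Filter ℝ) ≤ 𝓝[>] 0 := Ultrafilter.of_le _
  have hl0 : (l : Filter ℝ) ≤ 𝓝 0 := hl.trans nhdsWithin_le_nhds
  have hpos : ∀ᶠ s in (l : Filter ℝ), 0 < s := hl self_mem_nhdsWithin
  have hmk : ∀ s, (QuotientGroup.mk (g s) : G ⧸ H) = y s := by
    intro s
    rw [← hgy s, ho, ← QuotientGroup.mk_mul_eq_smul, mul_one]
  -- the group elements converge to the identity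
  have hg1 : Filter.Tendsto g l (𝓝 1) := by
    -- Here g(s) is a section value tending to 1 times an element of H. By compactness of H it has a
    -- limit, which fixes every point and is therefore 1 by effectiveness.
    obtain ⟨σ, U, hU, hoU, hσo, hσ, hpσ⟩ := (hπ.isSubmersionAt (1 : G)).exists_section
    have hσc : Filter.Tendsto (fun s => σ (y s)) l (𝓝 1) := by
      have h1 := (hσ.continuousOn.continuousAt (hU.mem_nhds hoU)).tendsto
      rw [hσo] at h1
      exact h1.comp (hyo.mono_left hl0)
    obtain ⟨h, hh, hlim⟩ := hH.exists_tendsto_ultrafilter l (u := fun s => (σ (y s))⁻¹ * g s) (by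
      filter_upwards [hl0 (hyo.eventually (hU.mem_nhds hoU))] with s hs
      exact QuotientGroup.eq.1 ((hpσ _ hs).trans (hmk s).symm))
    have h1 : Filter.Tendsto g l (𝓝 h) := by
      have := hσc.mul hlim
      simpa using this
    have h2 : h = 1 := by
      refine FaithfulSMul.eq_of_smul_eq_smul (α := G ⧸ H) fun z => ?_
      rw [one_smul]
      exact tendsto_nhds_unique (h1.smul_const z) ((hgz z).mono_left hl)
    rwa [h2] at h1
  let e : ℝ → E := fun s => ψ (g s) - ψ 1
  have hψ1 : ψ.symm (ψ 1) = 1 := ψ.left_inv (mem_chart_source E 1)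
  have he0 : Filter.Tendsto e l (𝓝 0) := by
    have h1 := (ψ.continuousAt (mem_chart_source E 1)).tendsto.comp hg1
    simpa using h1.sub_const (ψ 1)
  have hgs : ∀ᶠ s in (l : Filter ℝ), ψ.symm (ψ 1 + e s) = g s := by
    filter_upwards [hg1.eventually (ψ.open_source.mem_nhds (mem_chart_source E 1))] with s hs
    simp only [e, add_sub_cancel]
    exact ψ.left_inv hs
  -- It is not known in advance that e(s) = O(s), so both are rescaled by their joint size. The
  -- limits σ of s / r and b of e / r satisfy σ + ‖b‖ = 1 and cannot vanish together.
  let r : ℝ → ℝ := fun s => s + ‖e s‖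
  have hr : ∀ᶠ s in (l : Filter ℝ), 0 < r s := by
    filter_upwards [hpos] with s hs
    positivity
  obtain ⟨σ, hσI, hσ⟩ := (isCompact_Icc (a := (0 : ℝ)) (b := 1)).exists_tendsto_ultrafilter l
    (u := fun s => s / r s) (by
      filter_upwards [hpos, hr] with s hs hrs
      exact ⟨by positivity, (div_le_one hrs).2 (le_add_of_nonneg_right (norm_nonneg _))⟩)
  obtain ⟨b, hbI, hb⟩ := (isCompact_closedBall (0 : E) 1).exists_tendsto_ultrafilter l
    (u := fun s => (r s)⁻¹ • e s) (by
      filter_upwards [hpos, hr] with s hs hrs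
      rw [mem_closedBall_zero_iff, norm_smul, norm_inv, Real.norm_of_nonneg hrs.le,
        inv_mul_le_iff₀ hrs, mul_one]
      exact le_add_of_nonneg_left hs.le)
  have hσb : σ + ‖b‖ = 1 := by
    have h1 := hσ.add hb.norm
    refine tendsto_nhds_unique h1 (tendsto_const_nhds.congr' ?_)
    filter_upwards [hr] with s hrs
    rw [norm_smul, norm_inv, Real.norm_of_nonneg hrs.le]
    field_simp
    rfl
  -- the displacements, to first order
  have hdisp : ∀ k : G, Filter.Tendsto (fun s => (r s)⁻¹ •
      (chartAt E' (QuotientGroup.mk k : G ⧸ H) (g s • QuotientGroup.mk k) -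
        chartAt E' (QuotientGroup.mk k : G ⧸ H) (QuotientGroup.mk k))) l
      (𝓝 ((tderiv (fun x : G => (QuotientGroup.mk (x * k) : G ⧸ H)) 1 : E →L[ℝ] E') b)) := by
    intro k
    set z : G ⧸ H := QuotientGroup.mk k with hz
    have hz1 : (QuotientGroup.mk (1 * k) : G ⧸ H) = z := by rw [one_mul]
    have hm : MDifferentiableAt 𝓘(ℝ, E) 𝓘(ℝ, E') (fun x : G => (QuotientGroup.mk (x * k) : G ⧸ H)) 1 :=
      (mdifferentiable_cosetMk hπ _).comp 1 (mdifferentiable_rightMul (E := E) k 1)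
    have hχ : MDifferentiableAt 𝓘(ℝ, E') 𝓘(ℝ, E') (chartAt E' z) (QuotientGroup.mk (1 * k) : G ⧸ H) := by
      rw [hz1]
      exact mdifferentiableAt_chartAt z (mem_chart_source E' z)
    have hf : MDifferentiableAt 𝓘(ℝ, E) 𝓘(ℝ, E')
        (fun x : G => chartAt E' z (QuotientGroup.mk (x * k) : G ⧸ H)) (ψ.symm (ψ 1)) := by
      rw [hψ1]
      exact hχ.comp 1 hm
    have hd : HasFDerivAt (fun x => chartAt E' z (QuotientGroup.mk (ψ.symm x * k) : G ⧸ H))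
        (tderiv (fun x : G => (QuotientGroup.mk (x * k) : G ⧸ H)) 1 : E →L[ℝ] E') (ψ 1) := by
      have h1 := (hf.comp _ (mdifferentiableAt_chartAt_symm (1 : G)
        (mem_chart_target E (1 : G)))).differentiableAt.hasFDerivAt
      refine h1.congr_fderiv ?_
      ext u
      have h2 := tderiv_comp_chartAt_symm (x := (1 : G)) (mem_chart_target E (1 : G)) hf u
      rw [hψ1, tderiv_chartAt_symm_self, tderiv_comp_apply 1 hχ hm, hz1, tderiv_chartAt_self] at h2
      exact h2
    have h1 := (hasFDerivWithinAt_univ.2 hd).lim he0 (.of_forall fun _ => mem_univ _) hb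
    refine h1.congr' ?_
    filter_upwards [hgs] with s hs
    rw [hs, hψ1, one_mul, QuotientGroup.mk_mul_eq_smul]
  -- Divide d(z, g(s) z) ≤ d(o, y(s)) ≤ s (1 + ε) N(v) by r(s), pass to the limit and then let ε
  -- tend to 0.
  have hlow : ∀ k : G, N (cosetDeriv E E' H (adjointAction k⁻¹ b)) ≤ σ * N v := by
    intro k
    set z : G ⧸ H := QuotientGroup.mk k with hz
    have hz1 : (QuotientGroup.mk (1 * k) : G ⧸ H) = z := by rw [one_mul]
    have hzm : IsMinkowskiNorm (F.fiber z) := F.isMinkowskiNorm_fiber z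
    have hJ : F.fiber z ((tderiv (fun x : G => (QuotientGroup.mk (x * k) : G ⧸ H)) 1 : E →L[ℝ] E') b) =
        N (cosetDeriv E E' H (adjointAction k⁻¹ b)) := by
      rw [tderiv_comp_apply 1 (mdifferentiable_cosetMk hπ _) (mdifferentiable_rightMul (E := E) k 1)]
      have h1 := hF.1.fiber_cosetMk hπ (1 * k) ((tderiv (fun x : G => x * k) 1 : E →L[ℝ] E) b)
      have h2 := leftTriv_mul_right k (tmk (1 : G) b)
      have h3 : leftTriv (tmk (1 : G) b) = b := by
        have := leftTriv_tmk_mul (1 : G) b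
        rwa [tderiv_one_mul] at this
      rw [h3] at h2
      rw [hz1] at h1
      exact h1.trans (congrArg (fun w => N (cosetDeriv E E' H w)) h2)
    have hε : ∀ ε : ℝ, 0 < ε → ε < 1 →
        (1 - ε) * N (cosetDeriv E E' H (adjointAction k⁻¹ b)) ≤ σ * ((1 + ε) * N v) := by
      intro ε hε hε1
      obtain ⟨c, hc, hcz⟩ := F.exists_le_edist z hε hε1
      have h1 := ((hzm.continuous.tendsto _).comp (hdisp k)).const_mul (1 - ε)
      rw [hJ] at h1
      refine le_of_tendsto_of_tendsto h1 (hσ.mul_const ((1 + ε) * N v)) ?_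
      filter_upwards [hpos, hr, hl (hdist ε hε),
        hl ((hgz0 z).eventually (gt_mem_nhds (ENNReal.ofReal_pos.2 hc)))] with s hs hrs hds hcs
      have h2 : F.edist z (g s • z) ≤ ENNReal.ofReal (s * ((1 + ε) * N v)) := by
        have := hg s z
        rw [hgy] at this
        exact this.trans hds
      rcases hcz (g s • z) with ⟨-, h3⟩ | h3
      · have h4 := (ENNReal.ofReal_le_ofReal_iff (by positivity)).1 (h3.trans h2)
        have h5 := hzm.homogeneous (r s)⁻¹ (chartAt E' z (g s • z) - chartAt E' z z)
          (inv_nonneg.2 hrs.le)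
        change (1 - ε) * F.fiber z ((r s)⁻¹ • (chartAt E' z (g s • z) - chartAt E' z z)) ≤ _
        rw [h5, div_mul_eq_mul_div, le_div_iff₀ hrs]
        calc (1 - ε) * ((r s)⁻¹ * F.fiber z (chartAt E' z (g s • z) - chartAt E' z z)) * r s
            = (1 - ε) * F.fiber z (chartAt E' z (g s • z) - chartAt E' z z) := by
              field_simp
          _ ≤ _ := h4
      · exact absurd (h3.trans_lt hcs) (lt_irrefl _)
    have hc1 : Continuous fun ε : ℝ => (1 - ε) * N (cosetDeriv E E' H (adjointAction k⁻¹ b)) := by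
      fun_prop
    have hc2 : Continuous fun ε : ℝ => σ * ((1 + ε) * N v) := by fun_prop
    have h1 := (hc1.tendsto 0).mono_left (nhdsWithin_le_nhds (s := Ioi 0))
    have h2 := (hc2.tendsto 0).mono_left (nhdsWithin_le_nhds (s := Ioi 0))
    simp only [sub_zero, one_mul, add_zero] at h1 h2
    refine le_of_tendsto_of_tendsto h1 h2 ?_
    filter_upwards [self_mem_nhdsWithin, nhdsWithin_le_nhds (gt_mem_nhds zero_lt_one)] with ε h3 h4
    exact hε ε h3 h4
  have hone : cosetDeriv E E' H b = σ • v := by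
    have h1 := hdisp 1
    simp only [mul_one] at h1
    refine tendsto_nhds_unique h1 ((hσ.smul_const v).congr' ?_)
    filter_upwards [hl0 hyt] with s hs
    have h2 : φ (y s) - φ o = s • v := by
      rw [φ.right_inv hs, add_sub_cancel_left]
    change _ = (r s)⁻¹ • (φ (g s • o) - φ o)
    rw [hgy, h2, smul_smul, div_eq_inv_mul]
  -- If σ = 0, every π_* Ad(k) b vanishes, so b = 0 by effectiveness, contradicting σ + ‖b‖ = 1.
  have hσ0 : 0 < σ := by
    refine lt_of_le_of_ne hσI.1 fun h0 => ?_
    have hb0 : b = 0 := eq_zero_of_forall_cosetDeriv_eq_zero hπ fun k => by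
      have h1 := hlow k⁻¹
      rw [inv_inv, ← h0, zero_mul] at h1
      exact hNm.eq_zero_of_le h1
    rw [← h0, hb0, norm_zero, add_zero] at hσb
    exact zero_ne_one hσb
  refine ⟨σ⁻¹ • b, ?_, fun k => ?_⟩
  · rw [_root_.map_smul, hone, inv_smul_smul₀ hσ0.ne']
  · rw [_root_.map_smul, _root_.map_smul]
    refine (hNm.homogeneous _ _ (inv_nonneg.2 hσ0.le)).le.trans ?_
    have h1 := hlow k⁻¹
    rw [inv_inv] at h1
    calc σ⁻¹ * N (cosetDeriv E E' H (adjointAction k b)) ≤ σ⁻¹ * (σ * N v) := by gcongr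
      _ = N v := by rw [inv_mul_cancel_left₀ hσ0.ne']
      _ ≤ (1 + δ) * N v := by nlinarith

end FinslerMetric

end Lifts

/-! ### Approximation by normal homogeneous metrics -/

section MaximalNorm

variable {E : Type*} [NormedAddCommGroup E] [NormedSpace ℝ E] [FiniteDimensional ℝ E]
  {G : Type*} [TopologicalSpace G] [ChartedSpace E G] [Group G] [LieGroup 𝓘(ℝ, E) ∞ G]
  {E' : Type*} [NormedAddCommGroup E'] [NormedSpace ℝ E']
  {H : Subgroup G} [ChartedSpace E' (G ⧸ H)] [IsManifold 𝓘(ℝ, E') ∞ (G ⧸ H)]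

omit [FiniteDimensional ℝ E] [IsManifold 𝓘(ℝ, E') ∞ (G ⧸ H)] in
theorem tderiv_cosetMk_mul_leftTriv
    (hπ : Manifold.IsSubmersion 𝓘(ℝ, E) 𝓘(ℝ, E') ∞ (QuotientGroup.mk : G → G ⧸ H))
    (g : G) {u : E} {w : E} (h : cosetDeriv E E' H w = cosetDeriv E E' H (leftTriv (tmk g u))) :
    (tderiv (QuotientGroup.mk : G → G ⧸ H) g : E →L[ℝ] E')
      ((tderiv (fun y : G => g * y) 1 : E →L[ℝ] E) w) =
      (tderiv (QuotientGroup.mk : G → G ⧸ H) g : E →L[ℝ] E') u := by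
  rw [tderiv_cosetMk_eq hπ, tderiv_cosetMk_eq hπ, leftTriv_tmk_mul, h]

/-- The adjoint action in coordinates in which it is isometric. -/
noncomputable def adjointIsometry {n : ℕ} {e : E ≃L[ℝ] EuclideanSpace ℝ (Fin n)}
    (he : ∀ (g : G) (w : E), ‖e (adjointAction g w)‖ = ‖e w‖) (g : G) :
    EuclideanSpace ℝ (Fin n) ≃ₗᵢ[ℝ] EuclideanSpace ℝ (Fin n) where
  toFun y := e (adjointAction g (e.symm y))
  invFun y := e (adjointAction g⁻¹ (e.symm y))
  map_add' x y := by simp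
  map_smul' c y := by simp
  left_inv y := by simp [adjointAction_inv_apply]
  right_inv y := by simp [adjointAction_apply_inv]
  norm_map' y := by
    change ‖e (adjointAction g (e.symm y))‖ = ‖y‖
    rw [he, e.apply_symm_apply]

omit [FiniteDimensional ℝ E] in
theorem adjointIsometry_apply {n : ℕ} {e : E ≃L[ℝ] EuclideanSpace ℝ (Fin n)}
    (he : ∀ (g : G) (w : E), ‖e (adjointAction g w)‖ = ‖e w‖) (g : G)
    (y : EuclideanSpace ℝ (Fin n)) :
    adjointIsometry he g y = e (adjointAction g (e.symm y)) := rfl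

namespace FinslerMetric

variable (E) in
/-- The maximal length of the fundamental vector field given by an element of the Lie algebra. -/
noncomputable def maximalNorm (F : FinslerMetric E' (G ⧸ H)) (w : E) : ℝ :=
  ⨆ k : G, F.fiber (QuotientGroup.mk 1) (cosetDeriv E E' H (adjointAction k w))

omit [FiniteDimensional ℝ E] in
theorem maximalNorm_adjointAction (F : FinslerMetric E' (G ⧸ H)) (g : G) (w : E) :
    F.maximalNorm E (adjointAction g w) = F.maximalNorm E w := by
  unfold maximalNorm
  simp only [← adjointAction_mul]
  exact (Equiv.mulRight g).iSup_comp
    (g := fun k => F.fiber (QuotientGroup.mk 1) (cosetDeriv E E' H (adjointAction k w)))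

variable [FiniteDimensional ℝ E'] [ConnectedSpace G] (hG : IsQuasiCompact E G)
include hG

theorem fiber_le_maximalNorm (F : FinslerMetric E' (G ⧸ H)) (k : G) (w : E) :
    F.fiber (QuotientGroup.mk 1) (cosetDeriv E E' H (adjointAction k w)) ≤ F.maximalNorm E w := by
  obtain ⟨C, -, hC⟩ := exists_fiber_adjointAction_le hG F
  exact le_ciSup (f := fun k : G =>
    F.fiber (QuotientGroup.mk 1) (cosetDeriv E E' H (adjointAction k w)))
    ⟨C * ‖w‖, by rintro _ ⟨k, rfl⟩; exact hC k w⟩ k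

/-- Boundedness of Ad(G) makes the supremum finite and, with subadditivity, Lipschitz. Definiteness
is the infinitesimal form of effectiveness. -/
theorem isAsymmetricNorm_maximalNorm [FaithfulSMul G (G ⧸ H)]
    (hπ : Manifold.IsSubmersion 𝓘(ℝ, E) 𝓘(ℝ, E') ∞ (QuotientGroup.mk : G → G ⧸ H))
    (F : FinslerMetric E' (G ⧸ H)) : IsAsymmetricNorm (F.maximalNorm E) := by
  have hNm : IsMinkowskiNorm (F.fiber (QuotientGroup.mk 1)) := F.isMinkowskiNorm_fiber _
  obtain ⟨C, hC0, hC⟩ := exists_fiber_adjointAction_le hG F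
  have hadd : ∀ x y : E, F.maximalNorm E (x + y) ≤ F.maximalNorm E x + F.maximalNorm E y := by
    intro x y
    refine ciSup_le fun k => ?_
    rw [map_add, map_add]
    exact (hNm.add_le _ _).trans
      (add_le_add (F.fiber_le_maximalNorm hG k x) (F.fiber_le_maximalNorm hG k y))
  have hle : ∀ x : E, F.maximalNorm E x ≤ C * ‖x‖ := fun x => ciSup_le fun k => hC k x
  refine ⟨?_, fun w hw => ?_, fun c w hc => ?_, hadd⟩
  · refine LipschitzWith.continuous (K := ⟨C, hC0.le⟩)
      (LipschitzWith.of_le_add_mul ⟨C, hC0.le⟩ fun x y => ?_)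
    have h1 := hadd y (x - y)
    rw [add_sub_cancel] at h1
    rw [dist_eq_norm]
    exact h1.trans (add_le_add le_rfl (hle _))
  · by_contra hcon
    refine hw (eq_zero_of_forall_cosetDeriv_eq_zero hπ fun k => ?_)
    exact hNm.eq_zero_of_le ((F.fiber_le_maximalNorm hG k w).trans (not_lt.1 hcon))
  · unfold maximalNorm
    rw [Real.mul_iSup_of_nonneg hc]
    congr 1
    ext k
    rw [_root_.map_smul, _root_.map_smul, hNm.homogeneous _ _ hc]

/-- A homogeneous metric with almost maximal lifts is approximated by normal homogeneous ones. -/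
theorem IsHomogeneous.exists_isNormalHomogeneous [FaithfulSMul G (G ⧸ H)]
    (hπ : Manifold.IsSubmersion 𝓘(ℝ, E) 𝓘(ℝ, E') ∞ (QuotientGroup.mk : G → G ⧸ H))
    {F : FinslerMetric E' (G ⧸ H)} (hF : F.IsHomogeneous) (hI : F.HasAlmostMaximalLifts E)
    {ε : ℝ} (hε : 0 < ε) (hε1 : ε < 1) :
    ∃ F' : FinslerMetric E' (G ⧸ H), F'.IsNormalHomogeneous E ∧ ∀ v, |F' v - F v| ≤ 3 * ε * F v := by
  have hNm : IsMinkowskiNorm (F.fiber (QuotientGroup.mk 1)) := F.isMinkowskiNorm_fiber _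
  have hA := F.isAsymmetricNorm_maximalNorm hG hπ
  obtain ⟨n, e, he⟩ := hG.exists_norm_adjointAction
  have hp : IsAsymmetricNorm (fun y => F.maximalNorm E (e.symm y)) :=
    ⟨hA.continuous.comp e.symm.continuous,
      fun y hy => hA.pos _ (by simpa using hy),
      fun c y hc => by rw [_root_.map_smul, hA.homogeneous _ _ hc],
      fun x y => by rw [map_add]; exact hA.add_le _ _⟩
  obtain ⟨Q, m, hm, hQ1, hQ2, hQ3, hQ4, hQ5, hQinv, hQb⟩ := hp.exists_smooth_approx hε hε1
  have hQ : IsStrongEnergy Q m := ⟨hm, hQ1, hQ2, hQ3, hQ4, hQ5⟩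
  -- Ad(g) preserves the Euclidean norm and the maximal norm, so the smoothing retains it as a
  -- symmetry.
  have hQad : ∀ (g : G) (w : E), Q (e (adjointAction g w)) = Q (e w) := by
    intro g w
    have h := hQinv (adjointIsometry he g) (fun y => by
      rw [adjointIsometry_apply, e.symm_apply_apply, maximalNorm_adjointAction]) (e w)
    rwa [adjointIsometry_apply, e.symm_apply_apply] at h
  obtain ⟨Q', m', hQ', hle, hlift⟩ := hQ.exists_pushforward
    (P := (cosetDeriv E E' H).comp (e.symm : EuclideanSpace ℝ (Fin n) →L[ℝ] E))
    ((cosetDeriv_surjective hπ).comp e.symm.surjective)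
  have hle' : ∀ w : E, Q' (cosetDeriv E E' H w) ≤ Q (e w) := fun w => by
    simpa using hle (e w)
  have hlift' : ∀ v, ∃ w : E, cosetDeriv E E' H w = v ∧ Q (e w) = Q' v := fun v => by
    obtain ⟨y, hy, hyQ⟩ := hlift v
    exact ⟨e.symm y, hy, by rw [e.apply_symm_apply, hyQ]⟩
  -- For h in H, Ad(h) covers the isotropy action and preserves Q, so it sends an optimal lift of v
  -- to a lift of its image with the same energy.
  have hinv1 : ∀ h ∈ H, ∀ v : E', Q' ((tderiv (fun y : G ⧸ H => h • y) (QuotientGroup.mk 1) :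
      E' →L[ℝ] E') v) ≤ Q' v := by
    intro h hh v
    obtain ⟨w, rfl, hw⟩ := hlift' v
    rw [← cosetDeriv_adjointAction hπ hh, ← hw, ← hQad h w]
    exact hle' _
  have hinv : ∀ h ∈ H, ∀ v : E', √(Q' ((tderiv (fun y : G ⧸ H => h • y) (QuotientGroup.mk 1) :
      E' →L[ℝ] E') v)) = √(Q' v) := by
    intro h hh v
    refine congrArg _ (le_antisymm (hinv1 h hh v) ?_)
    obtain ⟨w, rfl⟩ := cosetDeriv_surjective hπ v
    have h1 := hinv1 h⁻¹ (H.inv_mem hh) (cosetDeriv E E' H (adjointAction h w))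
    rw [← cosetDeriv_adjointAction hπ (H.inv_mem hh), adjointAction_inv_apply] at h1
    rwa [← cosetDeriv_adjointAction hπ hh]
  have hPm : IsMinkowskiNorm (fun w : E => √(Q (e w))) := hQ.isMinkowskiNorm.comp_equiv e
  let F' : FinslerMetric E' (G ⧸ H) := homogeneousMetric hπ _ hQ'.isMinkowskiNorm hinv
  let Fbar : FinslerMetric E G := leftInvariantMetric G _ hPm
  have hF' : ∀ (g : G) (u : E), F'.fiber (QuotientGroup.mk g)
      ((tderiv (QuotientGroup.mk : G → G ⧸ H) g : E →L[ℝ] E') u) =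
      √(Q' (cosetDeriv E E' H (leftTriv (tmk g u)))) := fun g u =>
    homogeneousFun_tangentMap hπ (N := fun v => √(Q' v)) hinv (tmk g u)
  have hFbar : ∀ (g : G) (u : E), Fbar (tmk g u) = √(Q (e (leftTriv (tmk g u)))) := fun g u => rfl
  refine ⟨F', ⟨homogeneousMetric_isHomogeneous hπ _ _, Fbar,
    leftInvariantMetric_isBiinvariant hPm (fun g w => by rw [hQad]), hπ.contMDiff, fun g => ?_⟩, ?_⟩
  · refine Subset.antisymm ?_ ?_
    · rintro _ ⟨u, hu, rfl⟩
      have hu' : √(Q (e (leftTriv (tmk g (show E from u))))) ≤ 1 := hu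
      have h1 := (hF' g u).trans_le ((Real.sqrt_le_sqrt (hle' _)).trans hu')
      exact h1
    · intro v hv
      obtain ⟨u, rfl⟩ := tderiv_cosetMk_surjective hπ g v
      have hv' : √(Q' (cosetDeriv E E' H (leftTriv (tmk g u)))) ≤ 1 := (hF' g u).symm.trans_le hv
      obtain ⟨w, hw, hwQ⟩ := hlift' (cosetDeriv E E' H (leftTriv (tmk g u)))
      refine ⟨(tderiv (fun y : G => g * y) 1 : E →L[ℝ] E) w, ?_,
        tderiv_cosetMk_mul_leftTriv hπ g hw⟩
      have h1 := hFbar g ((tderiv (fun y : G => g * y) 1 : E →L[ℝ] E) w)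
      rw [leftTriv_tmk_mul, hwQ] at h1
      exact h1.trans_le hv'
  · intro v
    obtain ⟨⟨g, u⟩, rfl⟩ := tangentMap_cosetMk_surjective hπ v
    have h1 : F' (tangentMap 𝓘(ℝ, E) 𝓘(ℝ, E') QuotientGroup.mk ⟨g, u⟩) = _ := hF' g u
    have h2 : F (tangentMap 𝓘(ℝ, E) 𝓘(ℝ, E') QuotientGroup.mk ⟨g, u⟩) = _ := hF.fiber_cosetMk hπ g u
    rw [h1, h2]
    generalize cosetDeriv E E' H (leftTriv (tmk g (show E from u))) = v
    have hN := hNm.nonneg v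
    -- Any lift w bounds N(v) by its maximal norm (take k = 1), which gives the lower estimate. An
    -- almost maximal lift gives the upper one, and (1 + ε)² ≤ 1 + 3 ε as ε < 1.
    have hlow : (1 - ε) * F.fiber (QuotientGroup.mk 1) v ≤ √(Q' v) := by
      obtain ⟨w, rfl, hw⟩ := hlift' v
      refine Real.le_sqrt_of_sq_le ?_
      rw [← hw]
      refine le_trans ?_ (hQb (e w)).1
      have h3 := F.fiber_le_maximalNorm hG 1 w
      rw [adjointAction_one] at h3
      rw [e.symm_apply_apply]
      have : 0 ≤ 1 - ε := by linarith
      gcongr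
    have hup : √(Q' v) ≤ (1 + ε) * ((1 + ε) * F.fiber (QuotientGroup.mk 1) v) := by
      obtain ⟨w, rfl, hw⟩ := hI v ε hε
      have h3 : F.maximalNorm E w ≤ (1 + ε) * F.fiber (QuotientGroup.mk 1) (cosetDeriv E E' H w) :=
        ciSup_le hw
      refine Real.sqrt_le_iff.2 ⟨by positivity, ((hle' w).trans (hQb (e w)).2).trans ?_⟩
      rw [e.symm_apply_apply]
      have := hA.nonneg w
      gcongr
    rw [abs_le]
    constructor
    · nlinarith
    · nlinarith [mul_nonneg hε.le hN, mul_nonneg (mul_nonneg hε.le (sub_nonneg.2 hε1.le)) hN]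

end FinslerMetric

end MaximalNorm

/-! ### The closure of the normal homogeneous metrics -/

section Closure

namespace FinslerMetric

theorem continuous_apply {E : Type*} [NormedAddCommGroup E] [NormedSpace ℝ E]
    {M : Type*} [TopologicalSpace M] [ChartedSpace E M] [IsManifold 𝓘(ℝ, E) ∞ M]
    (v : TangentBundle 𝓘(ℝ, E) M) : Continuous fun F : FinslerMetric E M => F v :=
  (continuous_eval_const v).comp
    (continuous_induced_dom (f := toContinuousMap (E := E) (M := M)))

/-- Metrics that are close to a given one are so in a relative sense on each tangent space. -/
theorem eventually_abs_fiber_sub_le {E : Type*} [NormedAddCommGroup E] [NormedSpace ℝ E]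
    [FiniteDimensional ℝ E] {M : Type*} [TopologicalSpace M] [ChartedSpace E M]
    [IsManifold 𝓘(ℝ, E) ∞ M] (F : FinslerMetric E M) (x : M) {ε : ℝ} (hε : 0 < ε) :
    ∀ᶠ F' in 𝓝 F, ∀ u : E, |F'.fiber x u - F.fiber x u| ≤ ε * F.fiber x u := by
  obtain ⟨c, C, hc, -, hb⟩ := (F.isMinkowskiNorm_fiber x).isAsymmetricNorm.exists_bounds
  have hcont : Continuous fun u : E => (tmk x u : TangentBundle 𝓘(ℝ, E) M) :=
    FiberBundle.continuous_totalSpaceMk E (TangentSpace 𝓘(ℝ, E)) x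
  have h := tendsto_iff.1 (Filter.tendsto_id (x := 𝓝 F)) _
    ((isCompact_sphere (0 : E) 1).image hcont)
  filter_upwards [Metric.tendstoUniformlyOn_iff.1 h (ε * c) (by positivity)] with F' hF' u
  rcases eq_or_ne u 0 with rfl | hu
  · rw [(F.isMinkowskiNorm_fiber x).map_zero, (F'.isMinkowskiNorm_fiber x).map_zero]
    simp
  have hu' : 0 < ‖u‖ := norm_pos_iff.2 hu
  set y : E := ‖u‖⁻¹ • u with hy
  have hyu : u = ‖u‖ • y := by rw [hy, smul_inv_smul₀ hu'.ne']
  have hyn : ‖y‖ = 1 := by rw [hy, norm_smul, norm_inv, norm_norm, inv_mul_cancel₀ hu'.ne']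
  have h1 : dist (F.fiber x y) (F'.fiber x y) < ε * c :=
    hF' (tmk x y) ⟨y, by simpa using hyn, rfl⟩
  have h2 := (hb y).1
  rw [hyn, mul_one] at h2
  rw [dist_comm, Real.dist_eq] at h1
  have h3 : |F'.fiber x y - F.fiber x y| ≤ ε * F.fiber x y :=
    h1.le.trans (mul_le_mul_of_nonneg_left h2 hε.le)
  rw [hyu, (F.isMinkowskiNorm_fiber x).homogeneous _ _ hu'.le,
    (F'.isMinkowskiNorm_fiber x).homogeneous _ _ hu'.le, ← mul_sub, abs_mul, abs_of_pos hu',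
    mul_left_comm]
  exact mul_le_mul_of_nonneg_left h3 hu'.le

/-- Relative approximation implies approximation in the local `C⁰` topology. -/
theorem mem_closure_of_forall_exists {E : Type*} [NormedAddCommGroup E] [NormedSpace ℝ E]
    {M : Type*} [TopologicalSpace M] [ChartedSpace E M] [IsManifold 𝓘(ℝ, E) ∞ M]
    {S : Set (FinslerMetric E M)} {F : FinslerMetric E M}
    (h : ∀ ε : ℝ, 0 < ε → ∃ F' ∈ S, ∀ v, |F' v - F v| ≤ ε * F v) : F ∈ closure S := by
  choose Fs hS hFs using fun n : ℕ => h (1 / ((n : ℝ) + 1)) (by positivity)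
  refine mem_closure_of_tendsto (f := Fs) (b := Filter.atTop) (tendsto_iff.2 fun K hK => ?_)
    (Filter.Eventually.of_forall hS)
  obtain ⟨B, hB⟩ := hK.bddAbove_image F.continuous_toFun.continuousOn
  rw [Metric.tendstoUniformlyOn_iff]
  intro ε hε
  have hlim : Filter.Tendsto (fun n : ℕ => 1 / ((n : ℝ) + 1) * B) Filter.atTop (𝓝 0) := by
    simpa using tendsto_one_div_add_atTop_nhds_zero_nat.mul_const B
  filter_upwards [hlim.eventually (gt_mem_nhds hε)] with n hn v hv
  rw [dist_comm, Real.dist_eq]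
  refine lt_of_le_of_lt ((hFs n v).trans ?_) hn
  exact mul_le_mul_of_nonneg_left (hB ⟨v, hv, rfl⟩) (by positivity)

section Biinvariant

variable {E : Type*} [NormedAddCommGroup E] [NormedSpace ℝ E]
  {G : Type*} [TopologicalSpace G] [ChartedSpace E G] [Group G] [LieGroup 𝓘(ℝ, E) ∞ G]

theorem IsBiinvariant.apply_eq {F : FinslerMetric E G} (hF : F.IsBiinvariant)
    (v : TangentBundle 𝓘(ℝ, E) G) : F v = F.fiber 1 (leftTriv v) := by
  have h1 : F (tmk (v.1⁻¹ * v.1) (leftTriv v)) = F v := hF.1 v.1⁻¹ v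
  rw [inv_mul_cancel] at h1
  exact h1.symm

theorem IsBiinvariant.fiber_adjointAction {F : FinslerMetric E G} (hF : F.IsBiinvariant)
    (k : G) (w : E) : F.fiber 1 (adjointAction k w) = F.fiber 1 w := by
  have h1 := hF.2 k⁻¹ (tmk 1 w)
  have h2 : leftTriv (tmk (1 : G) w) = w := by
    have := leftTriv_tmk_mul (1 : G) w
    rwa [tderiv_one_mul] at this
  rw [hF.apply_eq, hF.apply_eq, leftTriv_mul_right, h2, inv_inv] at h1
  exact h1

end Biinvariant

variable {E : Type*} [NormedAddCommGroup E] [NormedSpace ℝ E]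
  {G : Type*} [TopologicalSpace G] [ChartedSpace E G] [Group G] [LieGroup 𝓘(ℝ, E) ∞ G]
  {E' : Type*} [NormedAddCommGroup E'] [NormedSpace ℝ E']
  {H : Subgroup G} [ChartedSpace E' (G ⧸ H)] [IsManifold 𝓘(ℝ, E') ∞ (G ⧸ H)]

theorem isClosed_setOf_isHomogeneous :
    IsClosed {F : FinslerMetric E' (G ⧸ H) | F.IsHomogeneous} := by
  have h : {F : FinslerMetric E' (G ⧸ H) | F.IsHomogeneous} =
      ⋂ (g : G) (v : TangentBundle 𝓘(ℝ, E') (G ⧸ H)),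
        {F | F (tangentMap 𝓘(ℝ, E') 𝓘(ℝ, E') (fun x : G ⧸ H => g • x) v) = F v} := by
    ext F
    simp only [mem_iInter]
    rfl
  rw [h]
  exact isClosed_iInter fun g => isClosed_iInter fun v =>
    isClosed_eq (continuous_apply _) (continuous_apply _)

/-- For a normal homogeneous metric, every tangent vector at the base point is the value of a
fundamental vector field whose length is maximal there. -/
theorem IsNormalHomogeneous.exists_maximal_lift {F : FinslerMetric E' (G ⧸ H)}
    (hF : F.IsNormalHomogeneous E) (v : E') : ∃ w : E, cosetDeriv E E' H w = v ∧
      ∀ k : G, F.fiber (QuotientGroup.mk 1) (cosetDeriv E E' H (adjointAction k w)) ≤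
        F.fiber (QuotientGroup.mk 1) v := by
  obtain ⟨-, Fbar, hbi, -, hsub⟩ := hF
  have hNm : IsMinkowskiNorm (F.fiber (QuotientGroup.mk 1)) := F.isMinkowskiNorm_fiber _
  have hball : ∀ w : E, Fbar.fiber 1 w ≤ 1 →
      F.fiber (QuotientGroup.mk 1) (cosetDeriv E E' H w) ≤ 1 := fun w hw =>
    (hsub 1).subset ⟨w, hw, rfl⟩
  rcases eq_or_ne v 0 with rfl | hv
  · exact ⟨0, map_zero _, fun k => by rw [map_zero, map_zero]⟩
  have ha := hNm.pos v hv
  set a := F.fiber (QuotientGroup.mk 1) v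
  have h1 : F.fiber (QuotientGroup.mk 1) (a⁻¹ • v) ≤ 1 := by
    rw [hNm.homogeneous _ _ (inv_nonneg.2 ha.le), inv_mul_cancel₀ ha.ne']
  -- The normalized vector has a lift in the unit ball of the bi-invariant norm. Ad preserves that
  -- ball, and its projection lies in the unit ball of F.
  obtain ⟨w, hw, hwv⟩ := (hsub 1).superset h1
  have hw' : Fbar.fiber 1 (show E from w) ≤ 1 := hw
  have hwv' : cosetDeriv E E' H (show E from w) = a⁻¹ • v := hwv
  refine ⟨a • (show E from w), ?_, fun k => ?_⟩
  · rw [_root_.map_smul, hwv', smul_inv_smul₀ ha.ne']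
  · rw [_root_.map_smul, _root_.map_smul, hNm.homogeneous _ _ ha.le]
    refine mul_le_of_le_one_right ha.le (hball _ ?_)
    rwa [hbi.fiber_adjointAction]

/-- An exact maximal lift for a nearby normal metric is almost maximal for F: only the tangent space
at o is involved, and there closeness is uniform in the relative sense. -/
theorem hasAlmostMaximalLifts_of_mem_closure [FiniteDimensional ℝ E'] {F : FinslerMetric E' (G ⧸ H)}
    (hF : F ∈ closure {F : FinslerMetric E' (G ⧸ H) | F.IsNormalHomogeneous E}) :
    F.HasAlmostMaximalLifts E := by
  intro v δ hδ
  -- The tolerance θ = δ / (2 + δ) is the solution of (1 + θ) / (1 - θ) = 1 + δ.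
  obtain ⟨F', hF', hclose⟩ := ((mem_closure_iff_frequently.1 hF).and_eventually
    (F.eventually_abs_fiber_sub_le (QuotientGroup.mk 1) (ε := δ / (2 + δ)) (by positivity))).exists
  obtain ⟨w, hw, hmax⟩ := IsNormalHomogeneous.exists_maximal_lift (E := E) hF' v
  refine ⟨w, hw, fun k => ?_⟩
  have h1 := (abs_le.1 (hclose v)).2
  have h2 := (abs_le.1 (hclose (cosetDeriv E E' H (adjointAction k w)))).1
  have h3 := hmax k
  set N := F.fiber (QuotientGroup.mk 1)
  generalize N (cosetDeriv E E' H (adjointAction k w)) = X at *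
  have h4 : X - δ / (2 + δ) * X ≤ N v + δ / (2 + δ) * N v := by linarith
  have e1 : X - δ / (2 + δ) * X = 2 * X / (2 + δ) := by field_simp; ring
  have e2 : N v + δ / (2 + δ) * N v = (2 + 2 * δ) * N v / (2 + δ) := by field_simp; ring
  rw [e1, e2, div_le_div_iff_of_pos_right (by positivity)] at h4
  linarith

end FinslerMetric

end Closure

/-- `G` is a connected quasi-compact Lie group, `H` a compact subgroup, `G ⧸ H` carries its smooth
structure (the unique one on the topological quotient for which the projection is a submersion),
and `G` acts effectively on `G ⧸ H`. -/
theorem theorem1p1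
    {E : Type*} [NormedAddCommGroup E] [NormedSpace ℝ E] [FiniteDimensional ℝ E]
    {G : Type*} [TopologicalSpace G] [T2Space G] [SecondCountableTopology G]
    [ChartedSpace E G] [Group G] [LieGroup 𝓘(ℝ, E) ∞ G]
    [ConnectedSpace G] (hG : IsQuasiCompact E G)
    (H : Subgroup G) (hH : IsCompact (H : Set G))
    {E' : Type*} [NormedAddCommGroup E'] [NormedSpace ℝ E'] [FiniteDimensional ℝ E']
    [ChartedSpace E' (G ⧸ H)] [IsManifold 𝓘(ℝ, E') ∞ (G ⧸ H)]
    (hπ : Manifold.IsSubmersion 𝓘(ℝ, E) 𝓘(ℝ, E') ∞ (QuotientGroup.mk : G → G ⧸ H))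
    [FaithfulSMul G (G ⧸ H)] :
    {F : FinslerMetric E' (G ⧸ H) | F.IsDeltaHomogeneous} =
      closure {F : FinslerMetric E' (G ⧸ H) | F.IsNormalHomogeneous E} := by
  refine Subset.antisymm (fun F hF => ?_) (fun F hF => ?_)
  · have hI := FinslerMetric.IsDeltaHomogeneous.hasAlmostMaximalLifts hπ hH hF
    refine FinslerMetric.mem_closure_of_forall_exists fun ε hε => ?_
    -- Division by 3 absorbs the factor in the approximation; the bound 1 / 2 keeps the parameter
    -- below 1.
    obtain ⟨F', hF', h⟩ := hF.1.exists_isNormalHomogeneous hG hπ hI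
      (ε := min (ε / 3) (1 / 2)) (by positivity) ((min_le_right _ _).trans_lt (by norm_num))
    refine ⟨F', hF', fun v => (h v).trans (mul_le_mul_of_nonneg_right ?_ (F.nonneg v))⟩
    linarith [min_le_left (ε / 3) (1 / 2)]
  · have hhom : F.IsHomogeneous := closure_minimal (fun F' hF' => hF'.1)
      FinslerMetric.isClosed_setOf_isHomogeneous hF
    exact hhom.isDeltaHomogeneous hG hπ hH (FinslerMetric.hasAlmostMaximalLifts_of_mem_closure hF)
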